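/- Let $D$ be an EAS division ring, i.e. a division ring such that every (unital) ring endomorphism $D\to D$ is surjective, and let $m,n,p,q$ be arbitrary positive integers. The rank of a matrix over $D$ is the dimension of the left vector space generated by its rows (equivalently, of the right vector space generated by its columns). Let $\varphi : M_{m\times n}(D)\to M_{p\times q}(D)$ be a map that preserves adjacency: for all $A,B\in M_{m\times n}(D)$, $\operatorname{rank}(A-B)=1$ implies $\operatorname{rank}(\varphi(A)-\varphi(B))=1$. Then at least one of the following holds. (1) $\varphi$ is degenerate: for every $A\in M_{m\times n}(D)$ there exist a nonzero column ${}^{t}x\in M_{p\times 1}(D)$ and a nonzero row $y\in M_{1\times q}(D)$ such that $$\varphi\bigl(\{B : \operatorname{rank}(A-B)\le 1\}\bigr)\subset \bigl(\varphi(A)+R(y)\bigr)\cup\bigl(\varphi(A)+L({}^{t}x)\bigr),$$ where $R(y)=\{{}^{t}v\,y : {}^{t}v\in M_{p\times 1}(D)\}$ and $L({}^{t}x)=\{{}^{t}x\,u : u\in M_{1\times q}(D)\}$. (2) $\varphi$ is standard: there exist invertible matrices $T\in M_p(D)$ and $S\in M_q(D)$ and a matrix $R\in M_{p\times q}(D)$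 such that either $p\ge m$, $q\ge n$ and there is an automorphism $\tau$ of $D$ with $$\varphi(A)=T\begin{pmatrix}A^{\tau}&0\\0&0\end{pmatrix}S+R\quad\text{for all }A\in M_{m\times n}(D),$$ or $p\ge n$, $q\ge m$ and there is an anti-automorphism $\sigma$ of $D$ with $$\varphi(A)=T\begin{pmatrix}{}^{t}(A^{\sigma})&0\\0&0\end{pmatrix}S+R\quad\text{for all }A\in M_{m\times n}(D).$$ Here $A^{\tau}$ and $A^{\sigma}$ are obtained by applying $\tau$, resp. $\sigma$, to every entry of $A$, ${}^{t}$ denotes the transpose, and the zero blocks (possibly empty) complete the matrix to size $p\times q$. -/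

import Mathlib

noncomputable section

namespace HuaGeometry

/-- A division ring is EAS if every (unital) ring endomorphism of it is surjective. -/
def IsEAS (D : Type*) [DivisionRing D] : Prop :=
  ∀ f : D →+* D, Function.Surjective f

/-- The rank of a matrix over a division ring: the dimension of the left vector subspace of
`Dⁿ` generated by the rows. (Over a noncommutative division ring, `Matrix.cRank`, which is the
dimension of the *left* span of the columns, is a different number.) -/
def rowRank {D : Type*} [DivisionRing D] {m n : ℕ} (A : Matrix (Fin m) (Fin n) D) : ℕ :=
  Module.finrank D (Submodule.span D (Set.range A.row))

/-- Two matrices are adjacent if their difference has rank one. -/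
def Adjacent {D : Type*} [DivisionRing D] {m n : ℕ} (A B : Matrix (Fin m) (Fin n) D) : Prop :=
  rowRank (A - B) = 1

/-- Preservation of adjacency (in one direction). -/
def PreservesAdjacency {D : Type*} [DivisionRing D] {m n p q : ℕ}
    (φ : Matrix (Fin m) (Fin n) D → Matrix (Fin p) (Fin q) D) : Prop :=
  ∀ A B : Matrix (Fin m) (Fin n) D, Adjacent A B → Adjacent (φ A) (φ B)

/-- The unit ball centred at `A` for the arithmetic distance `(A, B) ↦ rank (A - B)`. -/
def unitBall {D : Type*} [DivisionRing D] {m n : ℕ} (A : Matrix (Fin m) (Fin n) D) :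
    Set (Matrix (Fin m) (Fin n) D) :=
  {B | rowRank (A - B) ≤ 1}

/-- `L(ᵗx)`: all products (column `x`) · (row `u`), where `u` is an arbitrary row. -/
def setL {D : Type*} [DivisionRing D] {p : ℕ} (q : ℕ) (x : Fin p → D) :
    Set (Matrix (Fin p) (Fin q) D) :=
  Set.range fun u : Fin q → D => Matrix.vecMulVec x u

/-- `R(y)`: all products (column `v`) · (row `y`), where `v` is an arbitrary column. -/
def setR {D : Type*} [DivisionRing D] (p : ℕ) {q : ℕ} (y : Fin q → D) :
    Set (Matrix (Fin p) (Fin q) D) :=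
  Set.range fun v : Fin p → D => Matrix.vecMulVec v y

/-- Degeneracy of a map with respect to one matrix `A`. -/
def IsDegenerateAt {D : Type*} [DivisionRing D] {m n p q : ℕ}
    (φ : Matrix (Fin m) (Fin n) D → Matrix (Fin p) (Fin q) D)
    (A : Matrix (Fin m) (Fin n) D) : Prop :=
  ∃ (x : Fin p → D) (y : Fin q → D), x ≠ 0 ∧ y ≠ 0 ∧
    φ '' unitBall A ⊆
      ((fun M => φ A + M) '' setR p y) ∪ ((fun M => φ A + M) '' setL q x)

/-- A degenerate map: degenerate with respect to every matrix. -/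
def IsDegenerate {D : Type*} [DivisionRing D] {m n p q : ℕ}
    (φ : Matrix (Fin m) (Fin n) D → Matrix (Fin p) (Fin q) D) : Prop :=
  ∀ A : Matrix (Fin m) (Fin n) D, IsDegenerateAt φ A

/-- The `p × q` block matrix with `A` in the upper left corner and zeros elsewhere
(used only when `m ≤ p` and `n ≤ q`). -/
def corner {D : Type*} [DivisionRing D] {m n : ℕ} (p q : ℕ) (A : Matrix (Fin m) (Fin n) D) :
    Matrix (Fin p) (Fin q) D :=
  Matrix.of fun i j =>
    if h : (i : ℕ) < m ∧ (j : ℕ) < n then A ⟨i, h.1⟩ ⟨j, h.2⟩ else 0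

/-- `A ↦ T [[A^τ, 0], [0, 0]] S + R` with `τ` an automorphism of `D`, and `T`, `S` invertible. -/
def IsStandardAut {D : Type*} [DivisionRing D] {m n p q : ℕ}
    (φ : Matrix (Fin m) (Fin n) D → Matrix (Fin p) (Fin q) D) : Prop :=
  m ≤ p ∧ n ≤ q ∧
    ∃ (τ : D ≃+* D) (T : Matrix (Fin p) (Fin p) D) (S : Matrix (Fin q) (Fin q) D)
      (R : Matrix (Fin p) (Fin q) D), IsUnit T ∧ IsUnit S ∧
      ∀ A : Matrix (Fin m) (Fin n) D,
        φ A = T * corner p q (A.map fun a => τ a) * S + R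

/-- `A ↦ T [[ᵗ(A^σ), 0], [0, 0]] S + R` with `σ` an anti-automorphism of `D` (a ring isomorphism
onto the opposite ring), and `T`, `S` invertible. -/
def IsStandardAnti {D : Type*} [DivisionRing D] {m n p q : ℕ}
    (φ : Matrix (Fin m) (Fin n) D → Matrix (Fin p) (Fin q) D) : Prop :=
  n ≤ p ∧ m ≤ q ∧
    ∃ (σ : D ≃+* Dᵐᵒᵖ) (T : Matrix (Fin p) (Fin p) D) (S : Matrix (Fin q) (Fin q) D)
      (R : Matrix (Fin p) (Fin q) D), IsUnit T ∧ IsUnit S ∧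
      ∀ A : Matrix (Fin m) (Fin n) D,
        φ A = T * corner p q (A.map fun a => MulOpposite.unop (σ a)).transpose * S + R

/-- A standard map: one of the two forms above. -/
def IsStandard {D : Type*} [DivisionRing D] {m n p q : ℕ}
    (φ : Matrix (Fin m) (Fin n) D → Matrix (Fin p) (Fin q) D) : Prop :=
  IsStandardAut φ ∨ IsStandardAnti φ

end HuaGeometry

end

/-!
The rank one matrices `x ⊠ y` map to rank one matrices, whose columns and rows are points of two
projective spaces. Moving `x` or `y` alone keeps the matrices adjacent, so it changes only one of
the two image points. Hence the images lie in a cross, which is degeneracy, or the column of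
`φ (x ⊠ y)` depends only on `x` and the row only on `y`, up to transposition.

In the last case, on `2 × 2` matrices, the graph `{(v, v M)}` of the row action of `M` is a plane in
`E² × E²`, and matrices are adjacent when their graphs meet in a line. The matrices `A` with a given
value `a` of `l A`, for a fixed row `l`, form a maximal clique, and the graphs of the `φ A` share a
line, represented by a vector `P a`. The maps `a ↦ P a` send lines to lines, so the fundamental
theorem of affine geometry makes them semilinear when `D` has more than two elements, and over the
field of two elements three such rows `l` suffice by a direct count. The surjectivity of the
homomorphisms then brings `φ` to the form `A ↦ U A^τ V`.

For general sizes, `φ` has this form on every `2 × 2` block `x₁, x₂; y₁, y₂` on which it is not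
projectively constant. The representations of overlapping blocks can be normalised to agree, so that
`φ (x ⊠ y)` is `τ`-semilinear in `x` and in `y`. Applied at every base point, this also yields
additivity, whence the standard form.
-/

noncomputable section

namespace HuaGeometry

open Matrix MulOpposite
open scoped LinearAlgebra.Projectivization

local infixl:72 " ⊠ " => Matrix.vecMulVec

/-! ### Proportional vectors and matrices of rank one -/

section Parallel

variable {R V : Type*} [DivisionRing R] [AddCommGroup V] [Module R V] {u v w : V} {c : R}

variable (R) in
/-- Proportionality of vectors. On nonzero vectors this is equality of points of `ℙ R V`; the zero
vector is proportional to itself only. -/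
def Parallel (v w : V) : Prop := ∃ c : R, c ≠ 0 ∧ w = c • v

/-- Rows are vectors of a left space. -/
abbrev RowParallel {ι : Type*} (w w' : ι → R) : Prop := Parallel R w w'

/-- Columns are vectors of a right space, that is, of a module over the opposite ring. -/
abbrev ColParallel {ι : Type*} (u u' : ι → R) : Prop := Parallel Rᵐᵒᵖ u u'

theorem Parallel.refl (v : V) : Parallel R v v := ⟨1, one_ne_zero, (one_smul R v).symm⟩

theorem Parallel.symm : Parallel R v w → Parallel R w v := by
  rintro ⟨c, hc, rfl⟩
  exact ⟨c⁻¹, inv_ne_zero hc, (inv_smul_smul₀ hc v).symm⟩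

theorem Parallel.trans : Parallel R u v → Parallel R v w → Parallel R u w := by
  rintro ⟨c, hc, rfl⟩ ⟨d, hd, rfl⟩
  exact ⟨d * c, mul_ne_zero hd hc, (mul_smul d c u).symm⟩

theorem parallel_smul (hc : c ≠ 0) (v : V) : Parallel R v (c • v) := ⟨c, hc, rfl⟩

theorem parallel_neg (v : V) : Parallel R v (-v) := ⟨-1, by simp, by simp⟩

theorem parallel_smul_left_iff (hc : c ≠ 0) : Parallel R (c • v) w ↔ Parallel R v w :=
  ⟨(parallel_smul hc v).trans, (parallel_smul hc v).symm.trans⟩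

theorem parallel_smul_right_iff (hc : c ≠ 0) : Parallel R v (c • w) ↔ Parallel R v w :=
  ⟨fun h => h.trans (parallel_smul hc w).symm, fun h => h.trans (parallel_smul hc w)⟩

theorem mk_eq_mk_iff_parallel (hv : v ≠ 0) (hw : w ≠ 0) :
    Projectivization.mk R v hv = Projectivization.mk R w hw ↔ Parallel R v w := by
  rw [Projectivization.mk_eq_mk_iff']
  constructor
  · rintro ⟨c, rfl⟩
    exact (parallel_smul (left_ne_zero_of_smul hv) w).symm
  · intro h
    obtain ⟨c, -, h⟩ := h.symm
    exact ⟨c, h.symm⟩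

theorem sub_ne_zero_of_not_parallel_map {A : Type*} [AddGroup A] {f : A → V} {a b : A}
    (h : ¬ Parallel R (f a) (f b)) : a - b ≠ 0 :=
  sub_ne_zero.2 fun hab => h (hab ▸ Parallel.refl _)

theorem exists_linearMap_eq_one_eq_zero (hv : v ≠ 0) (h : ¬ Parallel R v w) :
    ∃ f : V →ₗ[R] R, f v = 1 ∧ f w = 0 := by
  have hvw : v ∉ R ∙ w := by
    rw [Submodule.mem_span_singleton]
    rintro ⟨c, rfl⟩
    exact h (parallel_smul (left_ne_zero_of_smul hv) w).symm
  obtain ⟨f, hfv, hf⟩ := Submodule.exists_le_ker_of_notMem hvw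
  refine ⟨(LinearMap.toSpanSingleton R R (f v)⁻¹).comp f, ?_, ?_⟩
  · simp [mul_inv_cancel₀ hfv]
  · simp [LinearMap.mem_ker.1 (hf (Submodule.mem_span_singleton_self w))]

end Parallel

variable {D E : Type*} [DivisionRing D] [DivisionRing E] {m n p q : Type*}

theorem smul_op_vecMulVec (c : E) (x : p → E) (y : q → E) : (op c • x) ⊠ y = x ⊠ (c • y) :=
  (vecMulVec_smul' x c y).symm

theorem vecMulVec_ne_zero_iff {x : p → E} {y : q → E} : x ⊠ y ≠ 0 ↔ x ≠ 0 ∧ y ≠ 0 := by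
  refine ⟨fun h => ⟨?_, ?_⟩, fun ⟨hx, hy⟩ h => ?_⟩
  · rintro rfl; exact h (zero_vecMulVec y)
  · rintro rfl; exact h (by ext; simp [vecMulVec_apply])
  · obtain ⟨i, hi⟩ := Function.ne_iff.1 hx
    obtain ⟨j, hj⟩ := Function.ne_iff.1 hy
    exact mul_ne_zero hi hj (congrFun (congrFun h i) j)

/-- A matrix of rank one, written as a nonzero column times a nonzero row. -/
def IsRankOne (M : Matrix p q E) : Prop := ∃ (x : p → E) (y : q → E), x ≠ 0 ∧ y ≠ 0 ∧ M = x ⊠ y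

theorem isRankOne_vecMulVec {x : p → E} {y : q → E} (hx : x ≠ 0) (hy : y ≠ 0) :
    IsRankOne (x ⊠ y) := ⟨x, y, hx, hy, rfl⟩

theorem isRankOne_vecMulVec_of_ne_zero {x : p → E} {y : q → E} (h : x ⊠ y ≠ 0) :
    IsRankOne (x ⊠ y) := by
  rw [vecMulVec_ne_zero_iff] at h
  exact isRankOne_vecMulVec h.1 h.2

theorem IsRankOne.ne_zero {M : Matrix p q E} (h : IsRankOne M) : M ≠ 0 := by
  obtain ⟨x, y, hx, hy, rfl⟩ := h
  exact vecMulVec_ne_zero_iff.2 ⟨hx, hy⟩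

/-- The column obtained by applying a linear functional to each row of a matrix. -/
def contractRows (f : (q → E) →ₗ[E] E) : Matrix p q E →+ (p → E) where
  toFun M i := f (M i)
  map_zero' := funext fun _ => map_zero f
  map_add' M N := funext fun i => map_add f (M i) (N i)

theorem contractRows_vecMulVec (f : (q → E) →ₗ[E] E) (x : p → E) (y : q → E) :
    contractRows f (x ⊠ y) = op (f y) • x := funext fun i => map_smul f (x i) y

/-- The row obtained by applying a linear functional to each column of a matrix. -/
def contractCols (f : (p → E) →ₗ[Eᵐᵒᵖ] Eᵐᵒᵖ) : Matrix p q E →+ (q → E) where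
  toFun M j := unop (f (M.col j))
  map_zero' := funext fun _ => congrArg unop (map_zero f)
  map_add' M N := funext fun j => congrArg unop (map_add f (M.col j) (N.col j))

theorem contractCols_vecMulVec (f : (p → E) →ₗ[Eᵐᵒᵖ] Eᵐᵒᵖ) (x : p → E) (y : q → E) :
    contractCols f (x ⊠ y) = unop (f x) • y :=
  funext fun j => congrArg unop (map_smul f (op (y j)) x)

section Dyads

variable {a c e : p → E} {b d f : q → E}

theorem colParallel_of_sub_eq (ha : a ≠ 0) (hb : b ≠ 0) (hbd : ¬ RowParallel b d)
    (h : a ⊠ b - c ⊠ d = e ⊠ f) : ColParallel e a := by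
  obtain ⟨φ, hφb, hφd⟩ := exists_linearMap_eq_one_eq_zero hb hbd
  have hae : a = op (φ f) • e := by
    simpa [contractRows_vecMulVec, hφb, hφd] using congrArg (contractRows φ) h
  exact ⟨op (φ f), left_ne_zero_of_smul (hae ▸ ha), hae⟩

theorem parallel_or_parallel_of_sub_eq (ha : a ≠ 0) (hb : b ≠ 0) (hc : c ≠ 0) (hd : d ≠ 0)
    (h : a ⊠ b - c ⊠ d = e ⊠ f) : ColParallel a c ∨ RowParallel b d := by
  refine or_iff_not_imp_right.2 fun hbd => ?_
  have hea : ColParallel e a := colParallel_of_sub_eq ha hb hbd h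
  have hec : ColParallel (-e) c := colParallel_of_sub_eq hc hd (fun hdb => hbd hdb.symm)
    (by rw [neg_vecMulVec e f, ← h, neg_sub])
  exact hea.symm.trans ((parallel_neg e).trans hec)

theorem parallel_or_parallel_of_isRankOne_sub (ha : a ≠ 0) (hb : b ≠ 0) (hc : c ≠ 0) (hd : d ≠ 0)
    (h : IsRankOne (a ⊠ b - c ⊠ d)) : ColParallel a c ∨ RowParallel b d := by
  obtain ⟨e, f, -, -, h⟩ := h
  exact parallel_or_parallel_of_sub_eq ha hb hc hd h

theorem colParallel_and_rowParallel_of_vecMulVec_eq (ha : a ≠ 0) (hb : b ≠ 0)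
    (h : a ⊠ b = c ⊠ d) : ColParallel a c ∧ RowParallel b d := by
  obtain ⟨i, hi⟩ := Function.ne_iff.1 ha
  obtain ⟨j, hj⟩ := Function.ne_iff.1 hb
  have hij : ∀ i j, a i * b j = c i * d j := fun i j => congrFun (congrFun h i) j
  have hcd : c i * d j ≠ 0 := hij i j ▸ mul_ne_zero hi hj
  have hci := left_ne_zero_of_mul hcd
  have hdj := right_ne_zero_of_mul hcd
  constructor
  · refine ⟨op (b j * (d j)⁻¹), (op_ne_zero_iff _).2 (mul_ne_zero hj (inv_ne_zero hdj)),
      funext fun k => ?_⟩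
    rw [Pi.smul_apply, op_smul_eq_mul, ← mul_assoc, hij, mul_assoc, mul_inv_cancel₀ hdj, mul_one]
  · refine ⟨(c i)⁻¹ * a i, mul_ne_zero (inv_ne_zero hci) hi, funext fun k => ?_⟩
    rw [Pi.smul_apply, smul_eq_mul, mul_assoc, hij, ← mul_assoc, inv_mul_cancel₀ hci, one_mul]

theorem not_parallel_of_sub_eq_sub {u u' : p → E} {w w' : q → E}
    (ha : a ≠ 0) (hb : b ≠ 0) (hc : c ≠ 0) (hd : d ≠ 0) (hac : ¬ ColParallel a c)
    (hbd : ¬ RowParallel b d) (h : u ⊠ w - u' ⊠ w' = a ⊠ b - c ⊠ d) :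
    ¬ ColParallel u u' ∧ ¬ RowParallel w w' := by
  constructor
  · rintro ⟨t, -, rfl⟩
    rw [← op_unop t, smul_op_vecMulVec, ← vecMulVec_sub] at h
    exact (parallel_or_parallel_of_sub_eq ha hb hc hd h.symm).elim hac hbd
  · rintro ⟨t, -, rfl⟩
    rw [vecMulVec_smul', ← sub_vecMulVec] at h
    exact (parallel_or_parallel_of_sub_eq ha hb hc hd h.symm).elim hac hbd

end Dyads

/-- The line joining `k ⊠ g` and `k ⊠ g'` passes through `0`, so it lies in exactly two maximal
cliques: all `k ⊠ b`, and all `a ⊠ g`. -/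
theorem mem_clique_of_adjacent {C : Matrix p q E} {k : p → E} {g g' : q → E}
    (hk : k ≠ 0) (hg : RowParallel g g') (hne : g ≠ g')
    (h : IsRankOne (C - k ⊠ g)) (h' : IsRankOne (C - k ⊠ g')) :
    (∃ b, C = k ⊠ b) ∨ (∃ a, C = a ⊠ g) := by
  obtain ⟨a, b, ha, hb, h⟩ := h
  obtain ⟨c, d, hc, hd, h'⟩ := h'
  have hsub : k ⊠ (g' - g) = a ⊠ b - c ⊠ d := by
    rw [← h, ← h', vecMulVec_sub]; abel
  have hg'g : g' - g ≠ 0 := sub_ne_zero.2 hne.symm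
  obtain ⟨s, -, rfl⟩ := hg
  have hg_par : RowParallel g (s • g - g) :=
    ⟨s - 1, fun hs => hne (by rw [sub_eq_zero.1 hs, one_smul]), by rw [sub_smul, one_smul]⟩
  rcases parallel_or_parallel_of_sub_eq ha hb hc hd hsub.symm with ⟨t, -, rfl⟩ | ⟨t, -, rfl⟩
  · left
    rw [← op_unop t, smul_op_vecMulVec, ← vecMulVec_sub] at hsub
    obtain ⟨r, -, rfl⟩ := (colParallel_and_rowParallel_of_vecMulVec_eq hk hg'g hsub).1
    rw [← op_unop r, smul_op_vecMulVec, sub_eq_iff_eq_add, ← vecMulVec_add] at h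
    exact ⟨_, h⟩
  · right
    rw [vecMulVec_smul', ← sub_vecMulVec] at hsub
    have hgb := (colParallel_and_rowParallel_of_vecMulVec_eq hk hg'g hsub).2
    obtain ⟨r, -, rfl⟩ := hg_par.trans hgb
    rw [vecMulVec_smul', sub_eq_iff_eq_add, ← add_vecMulVec] at h
    exact ⟨_, h⟩

/-! ### Transposition over the opposite ring -/

theorem op_comp_ne_zero_iff {w : q → E} : op ∘ w ≠ 0 ↔ w ≠ 0 := by
  simp [Function.ne_iff]

theorem unop_comp_ne_zero_iff {w : q → Eᵐᵒᵖ} : unop ∘ w ≠ 0 ↔ w ≠ 0 := by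
  simp [Function.ne_iff]

theorem colParallel_op_iff {w w' : q → E} : ColParallel (op ∘ w) (op ∘ w') ↔ RowParallel w w' := by
  constructor
  · rintro ⟨c, hc, h⟩
    exact ⟨unop (unop c), by simpa using hc, funext fun j => by
      simpa using congrArg unop (congrFun h j)⟩
  · rintro ⟨c, hc, rfl⟩
    exact ⟨op (op c), by simpa using hc, by ext; simp⟩

theorem rowParallel_op_iff {u u' : p → E} : RowParallel (op ∘ u) (op ∘ u') ↔ ColParallel u u' := by
  constructor
  · rintro ⟨c, hc, h⟩
    exact ⟨c, hc, funext fun j => by simpa using congrArg unop (congrFun h j)⟩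
  · rintro ⟨c, hc, rfl⟩
    exact ⟨c, hc, by ext; simp⟩

/-- The transpose of a matrix, taken over the opposite ring so that it reverses products. -/
def opTranspose : Matrix p q E ≃+ Matrix q p Eᵐᵒᵖ :=
  opAddEquiv.mapMatrix.trans (transposeAddEquiv p q Eᵐᵒᵖ)

@[simp] theorem opTranspose_apply (M : Matrix p q E) (i : p) (j : q) :
    opTranspose M j i = op (M i j) := rfl

theorem opTranspose_vecMulVec (x : p → E) (y : q → E) :
    opTranspose (x ⊠ y) = (op ∘ y) ⊠ (op ∘ x) := rfl

theorem opTranspose_symm_vecMulVec (x : q → Eᵐᵒᵖ) (y : p → Eᵐᵒᵖ) :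
    opTranspose.symm (x ⊠ y) = (unop ∘ y) ⊠ (unop ∘ x) := rfl

theorem IsRankOne.opTranspose {M : Matrix p q E} (h : IsRankOne M) :
    IsRankOne (opTranspose M) := by
  obtain ⟨x, y, hx, hy, rfl⟩ := h
  exact ⟨_, _, op_comp_ne_zero_iff.2 hy, op_comp_ne_zero_iff.2 hx, opTranspose_vecMulVec x y⟩

theorem IsRankOne.opTranspose_symm {M : Matrix q p Eᵐᵒᵖ} (h : IsRankOne M) :
    IsRankOne (HuaGeometry.opTranspose.symm M) := by
  obtain ⟨x, y, hx, hy, rfl⟩ := h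
  exact ⟨_, _, unop_comp_ne_zero_iff.2 hy, unop_comp_ne_zero_iff.2 hx,
    opTranspose_symm_vecMulVec x y⟩

/-- The map induced by `φ` on the transposed matrices over the opposite rings. It exchanges the
roles of rows and columns. -/
def dual (φ : Matrix m n D → Matrix p q E) (X : Matrix n m Dᵐᵒᵖ) : Matrix q p Eᵐᵒᵖ :=
  opTranspose (φ (opTranspose.symm X))

/-- `φ` preserves adjacency, in one direction. -/
def AdjacencyPreserving (φ : Matrix m n D → Matrix p q E) : Prop :=
  ∀ A B, IsRankOne (A - B) → IsRankOne (φ A - φ B)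

namespace AdjacencyPreserving

variable {φ : Matrix m n D → Matrix p q E}

theorem isRankOne_sub (hφ : AdjacencyPreserving φ) {A B : Matrix m n D} {x : m → D} {y : n → D}
    (hx : x ≠ 0) (hy : y ≠ 0) (h : A - B = x ⊠ y) : IsRankOne (φ A - φ B) :=
  hφ A B (h ▸ isRankOne_vecMulVec hx hy)

theorem dual (hφ : AdjacencyPreserving φ) : AdjacencyPreserving (dual φ) := fun A B hAB => by
  have hsub := hAB.opTranspose_symm
  rw [map_sub] at hsub
  have h := (hφ _ _ hsub).opTranspose
  rwa [map_sub] at h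

end AdjacencyPreserving

/-- `φ` maps the product of a column `x` by a row `y` into the line spanned by `h x ⊠ g y`, where
neither `h` nor `g` is projectively constant. -/
structure RegularAtZero (φ : Matrix m n D → Matrix p q E) (h : (m → D) → p → E)
    (g : (n → D) → q → E) : Prop where
  col_ne_zero : ∀ x, x ≠ 0 → h x ≠ 0
  row_ne_zero : ∀ y, y ≠ 0 → g y ≠ 0
  map_vecMulVec : ∀ x y, x ≠ 0 → y ≠ 0 → ∃ c : E, c ≠ 0 ∧ φ (x ⊠ y) = h x ⊠ (c • g y)
  exists_cols : ∃ x₁ x₂, x₁ ≠ 0 ∧ x₂ ≠ 0 ∧ ¬ ColParallel (h x₁) (h x₂)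
  exists_rows : ∃ y₁ y₂, y₁ ≠ 0 ∧ y₂ ≠ 0 ∧ ¬ RowParallel (g y₁) (g y₂)

namespace RegularAtZero

variable {φ : Matrix m n D → Matrix p q E} {h : (m → D) → p → E} {g : (n → D) → q → E}

theorem dual (H : RegularAtZero φ h g) :
    RegularAtZero (dual φ) (fun y => op ∘ g (unop ∘ y)) (fun x => op ∘ h (unop ∘ x)) where
  col_ne_zero y hy := op_comp_ne_zero_iff.2 (H.row_ne_zero _ (unop_comp_ne_zero_iff.2 hy))
  row_ne_zero x hx := op_comp_ne_zero_iff.2 (H.col_ne_zero _ (unop_comp_ne_zero_iff.2 hx))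
  map_vecMulVec y x hy hx := by
    obtain ⟨c, hc, h1⟩ :=
      H.map_vecMulVec _ _ (unop_comp_ne_zero_iff.2 hx) (unop_comp_ne_zero_iff.2 hy)
    refine ⟨op c, (op_ne_zero_iff c).2 hc, ?_⟩
    rw [HuaGeometry.dual, opTranspose_symm_vecMulVec, h1, opTranspose_vecMulVec]
    ext i j
    simp [vecMulVec_apply, mul_assoc]
  exists_cols := by
    obtain ⟨y₁, y₂, hy₁, hy₂, hg⟩ := H.exists_rows
    exact ⟨op ∘ y₁, op ∘ y₂, op_comp_ne_zero_iff.2 hy₁, op_comp_ne_zero_iff.2 hy₂,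
      fun hp => hg (colParallel_op_iff.1 hp)⟩
  exists_rows := by
    obtain ⟨x₁, x₂, hx₁, hx₂, hh⟩ := H.exists_cols
    exact ⟨op ∘ x₁, op ∘ x₂, op_comp_ne_zero_iff.2 hx₁, op_comp_ne_zero_iff.2 hx₂,
      fun hp => hh (rowParallel_op_iff.1 hp)⟩

theorem rowParallel_map (H : RegularAtZero φ h g) {y y' : n → D} (hy : y ≠ 0)
    (hp : RowParallel y y') : RowParallel (g y) (g y') := by
  obtain ⟨c, hc, rfl⟩ := hp
  obtain ⟨x, -, hx, -⟩ := H.exists_cols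
  have hcx : op c • x ≠ 0 := smul_ne_zero ((op_ne_zero_iff c).2 hc) hx
  obtain ⟨a, ha, h1⟩ := H.map_vecMulVec x (c • y) hx (smul_ne_zero hc hy)
  obtain ⟨b, hb, h2⟩ := H.map_vecMulVec (op c • x) y hcx hy
  rw [← smul_op_vecMulVec, h2] at h1
  have hbg : b • g y ≠ 0 := smul_ne_zero hb (H.row_ne_zero y hy)
  have hba := (colParallel_and_rowParallel_of_vecMulVec_eq (H.col_ne_zero _ hcx) hbg h1).2
  exact (parallel_smul_left_iff hb).1 ((parallel_smul_right_iff ha).1 hba)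

theorem colParallel_map (H : RegularAtZero φ h g) {x x' : m → D} (hx : x ≠ 0)
    (hp : ColParallel x x') : ColParallel (h x) (h x') :=
  rowParallel_op_iff.1 <|
    H.dual.rowParallel_map (op_comp_ne_zero_iff.2 hx) (rowParallel_op_iff.2 hp)

theorem map_vecMulVec_ne_zero (H : RegularAtZero φ h g) {x : m → D} {y : n → D} (hx : x ≠ 0)
    (hy : y ≠ 0) : φ (x ⊠ y) ≠ 0 := by
  obtain ⟨c, hc, h1⟩ := H.map_vecMulVec x y hx hy
  rw [h1, vecMulVec_ne_zero_iff]
  exact ⟨H.col_ne_zero x hx, smul_ne_zero hc (H.row_ne_zero y hy)⟩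

theorem parallel_or_parallel_of_adjacent (H : RegularAtZero φ h g) {x : m → D} {y : n → D}
    (hx : x ≠ 0) (hy : y ≠ 0) {a : p → E} {b : q → E} (ha : a ≠ 0) (hb : b ≠ 0)
    (hadj : IsRankOne (a ⊠ b - φ (x ⊠ y))) : ColParallel a (h x) ∨ RowParallel b (g y) := by
  obtain ⟨c, hc, h1⟩ := H.map_vecMulVec x y hx hy
  rw [h1] at hadj
  have hcg : c • g y ≠ 0 := smul_ne_zero hc (H.row_ne_zero y hy)
  exact (parallel_or_parallel_of_isRankOne_sub ha hb (H.col_ne_zero x hx) hcg hadj).imp_right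
    (parallel_smul_right_iff hc).1

theorem vecMulVec_eq_zero_of_adjacent (H : RegularAtZero φ h g) {x x' : m → D} {y y' : n → D}
    (hx : x ≠ 0) (hx' : x' ≠ 0) (hy : y ≠ 0) (hy' : y' ≠ 0) (hxx' : ¬ ColParallel (h x) (h x'))
    {a : p → E} {b : q → E} (hby : ¬ RowParallel b (g y)) (hby' : ¬ RowParallel b (g y'))
    (hadj : IsRankOne (a ⊠ b - φ (x ⊠ y))) (hadj' : IsRankOne (a ⊠ b - φ (x' ⊠ y'))) :
    a ⊠ b = 0 := by
  by_contra hab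
  obtain ⟨ha, hb⟩ := vecMulVec_ne_zero_iff.1 hab
  have hax := (H.parallel_or_parallel_of_adjacent hx hy ha hb hadj).resolve_right hby
  have hax' := (H.parallel_or_parallel_of_adjacent hx' hy' ha hb hadj').resolve_right hby'
  exact hxx' (hax.symm.trans hax')

theorem row_add_ne_zero (H : RegularAtZero φ h g) {y y' : n → D} (hy : y ≠ 0)
    (hp : ¬ RowParallel (g y) (g y')) : y + y' ≠ 0 := fun h0 =>
  hp (H.rowParallel_map hy (eq_neg_of_add_eq_zero_right h0 ▸ parallel_neg y))

theorem col_add_ne_zero (H : RegularAtZero φ h g) {x x' : m → D} (hx : x ≠ 0)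
    (hp : ¬ ColParallel (h x) (h x')) : x + x' ≠ 0 := fun h0 =>
  hp (H.colParallel_map hx (eq_neg_of_add_eq_zero_right h0 ▸ parallel_neg x))

theorem row_sub_ne_zero (H : RegularAtZero φ h g) {y₁ y₂ : n → D} (hy₁ : y₁ ≠ 0)
    (hy₁₂ : y₁ + y₂ ≠ 0) (hn : ¬ RowParallel (g y₁) (g (y₁ + y₂))) : y₁ - y₂ ≠ 0 := by
  intro h0
  obtain rfl := sub_eq_zero.1 h0
  rw [← two_smul D y₁] at hn hy₁₂
  exact hn (H.rowParallel_map hy₁ (parallel_smul (left_ne_zero_of_smul hy₁₂) y₁))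

theorem map_add_eq_zero (H : RegularAtZero φ h g) (hφ : AdjacencyPreserving φ) {x x' : m → D}
    (hx : x ≠ 0) (hx' : x' ≠ 0) (hxx' : ¬ ColParallel (h x) (h x')) {y₁ y₂ : n → D}
    (hy₁ : y₁ ≠ 0) (hy₂ : y₂ ≠ 0) (hy₁₂ : y₁ + y₂ ≠ 0) (hp : RowParallel (g y₁) (g y₂))
    (hn : ¬ RowParallel (g y₁) (g (y₁ + y₂))) : φ (x ⊠ y₁ + x' ⊠ y₂) = 0 := by
  have hy : y₁ - y₂ ≠ 0 := H.row_sub_ne_zero hy₁ hy₁₂ hn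
  have hs : x + x' ≠ 0 := H.col_add_ne_zero hx hxx'
  have hd : x - x' ≠ 0 := sub_ne_zero_of_not_parallel_map hxx'
  set C := φ (x ⊠ y₁ + x' ⊠ y₂)
  have row_case (a : p → E) (ha : C = a ⊠ g y₁) : C = 0 := by
    have h3 : IsRankOne (C - φ (x ⊠ (y₁ + y₂))) := hφ.isRankOne_sub (neg_ne_zero.2 hd) hy₂ (by
      simp only [neg_sub, sub_vecMulVec, vecMulVec_add]; abel)
    have h4 : IsRankOne (C - φ (x' ⊠ (y₁ + y₂))) := hφ.isRankOne_sub hd hy₁ (by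
      simp only [sub_vecMulVec, vecMulVec_add]; abel)
    rw [ha] at h3 h4 ⊢
    exact H.vecMulVec_eq_zero_of_adjacent hx hx' hy₁₂ hy₁₂ hxx' hn hn h3 h4
  have col_case (b : q → E) (hb : C = h (x + x') ⊠ b) : C = 0 := by
    by_cases hbg : RowParallel (g y₁) b
    · obtain ⟨t, -, rfl⟩ := hbg
      exact row_case (op t • h (x + x')) (by rw [hb, smul_op_vecMulVec])
    · have h5 : IsRankOne (C - φ (x ⊠ y₁)) := hφ.isRankOne_sub hx' hy₂ (by abel)
      have h6 : IsRankOne (C - φ (x' ⊠ y₂)) := hφ.isRankOne_sub hx hy₁ (by abel)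
      rw [hb] at h5 h6 ⊢
      exact H.vecMulVec_eq_zero_of_adjacent hx hx' hy₁ hy₂ hxx' (fun h => hbg h.symm)
        (fun h => hbg (hp.trans h.symm)) h5 h6
  obtain ⟨c₁, hc₁, e1⟩ := H.map_vecMulVec _ y₁ hs hy₁
  obtain ⟨c₂, hc₂, e2⟩ := H.map_vecMulVec _ y₂ hs hy₂
  have h1 : IsRankOne (C - φ ((x + x') ⊠ y₁)) := hφ.isRankOne_sub hx' (neg_ne_zero.2 hy) (by
    simp only [neg_sub, add_vecMulVec, vecMulVec_sub]; abel)
  have h2 : IsRankOne (C - φ ((x + x') ⊠ y₂)) := hφ.isRankOne_sub hx hy (by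
    simp only [add_vecMulVec, vecMulVec_sub]; abel)
  have h12 : IsRankOne (φ ((x + x') ⊠ y₁) - φ ((x + x') ⊠ y₂)) :=
    hφ.isRankOne_sub hs hy (vecMulVec_sub _ _ _).symm
  rw [e1] at h1 h12
  rw [e2] at h2 h12
  have hne : c₁ • g y₁ ≠ c₂ • g y₂ := fun h0 => h12.ne_zero (by rw [h0, sub_self])
  rcases mem_clique_of_adjacent (H.col_ne_zero _ hs)
    ((parallel_smul_left_iff hc₁).2 ((parallel_smul_right_iff hc₂).2 hp)) hne h1 h2 with
    ⟨b, hb⟩ | ⟨a, ha⟩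
  · exact col_case b hb
  · exact row_case (op c₁ • a) (by rw [ha, smul_op_vecMulVec])

/-- Otherwise two adjacent matrices `x ⊠ y₁ + x' ⊠ y₂` would both be mapped to zero. -/
theorem rowParallel_map_add (H : RegularAtZero φ h g) (hφ : AdjacencyPreserving φ)
    {y₁ y₂ : n → D} (hy₁ : y₁ ≠ 0) (hy₂ : y₂ ≠ 0) (hy₁₂ : y₁ + y₂ ≠ 0)
    (hp : RowParallel (g y₁) (g y₂)) : RowParallel (g y₁) (g (y₁ + y₂)) := by
  by_contra hn
  have hzero (x x' : m → D) (hx : x ≠ 0) (hx' : x' ≠ 0) (hxx' : ¬ ColParallel (h x) (h x')) :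
      φ (x ⊠ y₁ + x' ⊠ y₂) = 0 := H.map_add_eq_zero hφ hx hx' hxx' hy₁ hy₂ hy₁₂ hp hn
  obtain ⟨x, x', hx, hx', hxx'⟩ := H.exists_cols
  have hs : x + x' ≠ 0 := H.col_add_ne_zero hx hxx'
  have h0 := hzero x x' hx hx' hxx'
  by_cases hs' : ColParallel (h (x + x')) (h x')
  · have h1 := hzero x (x + x') hx hs fun h3 => hxx' (h3.trans hs')
    have hadj := hφ.isRankOne_sub (A := x ⊠ y₁ + (x + x') ⊠ y₂) (B := x ⊠ y₁ + x' ⊠ y₂) hx hy₂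
      (by rw [add_vecMulVec]; abel)
    exact hadj.ne_zero (by rw [h0, h1, sub_zero])
  · have h1 := hzero (x + x') x' hs hx' hs'
    have hadj := hφ.isRankOne_sub (A := (x + x') ⊠ y₁ + x' ⊠ y₂) (B := x ⊠ y₁ + x' ⊠ y₂) hx' hy₁
      (by rw [add_vecMulVec]; abel)
    exact hadj.ne_zero (by rw [h0, h1, sub_zero])

theorem not_rowParallel_map_add (H : RegularAtZero φ h g) (hφ : AdjacencyPreserving φ)
    {y₁ y₂ : n → D} (hy₁ : y₁ ≠ 0) (hy₂ : y₂ ≠ 0) (hp : ¬ RowParallel (g y₁) (g y₂)) :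
    ¬ RowParallel (g y₁) (g (y₁ + y₂)) := by
  intro h1
  have hneg : RowParallel (g y₁) (g (-y₁)) := H.rowParallel_map hy₁ (parallel_neg y₁)
  have hsum := H.rowParallel_map_add hφ (neg_ne_zero.2 hy₁) (H.row_add_ne_zero hy₁ hp)
    (by rwa [neg_add_cancel_left]) (hneg.symm.trans h1)
  rw [neg_add_cancel_left] at hsum
  exact hp (hneg.trans hsum)

theorem not_colParallel_map_add (H : RegularAtZero φ h g) (hφ : AdjacencyPreserving φ)
    {x₁ x₂ : m → D} (hx₁ : x₁ ≠ 0) (hx₂ : x₂ ≠ 0) (hp : ¬ ColParallel (h x₁) (h x₂)) :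
    ¬ ColParallel (h x₁) (h (x₁ + x₂)) := by
  have hop := H.dual.not_rowParallel_map_add hφ.dual (y₁ := op ∘ x₁) (y₂ := op ∘ x₂)
    (op_comp_ne_zero_iff.2 hx₁) (op_comp_ne_zero_iff.2 hx₂) fun h1 => hp (rowParallel_op_iff.1 h1)
  exact fun h1 => hop (rowParallel_op_iff.2 h1)

end RegularAtZero

/-! ### The trichotomy: degenerate, regular and transposed maps -/

section Grid

variable {X Y P Q : Type*}

theorem constant_or_constant {f : Y → P} {g : Y → Q} (h : ∀ y y', f y = f y' ∨ g y = g y') :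
    (∀ y y', f y = f y') ∨ ∀ y y', g y = g y' := by
  by_contra! hcon
  obtain ⟨⟨y₁, y₂, hf⟩, y₃, y₄, hg⟩ := hcon
  have hg₁₂ : g y₁ = g y₂ := (h y₁ y₂).resolve_left hf
  have hconst (y : Y) : g y = g y₁ := by
    by_contra hne
    have hf₁ : f y = f y₁ := (h y y₁).resolve_right hne
    have hf₂ : f y = f y₂ := (h y y₂).resolve_right (hg₁₂ ▸ hne)
    exact hf (hf₁.symm.trans hf₂)
  exact hg ((hconst y₃).trans (hconst y₄).symm)

variable {a : X → Y → P} {b : X → Y → Q}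

theorem grid_dichotomy [Nonempty P] [Nonempty Q]
    (hcol : ∀ x x' y, a x y = a x' y ∨ b x y = b x' y) (ha : ∀ x y y', a x y = a x y') :
    (∃ a₀ b₀, ∀ x y, a x y = a₀ ∨ b x y = b₀) ∨
    ∃ (h : X → P) (g : Y → Q), (∀ x y, a x y = h x ∧ b x y = g y) ∧
      (∃ x x', h x ≠ h x') ∧ ∃ y y', g y ≠ g y' := by
  refine or_iff_not_imp_left.2 fun hdeg => ?_
  push Not at hdeg
  obtain ⟨x₀, y₀, -, -⟩ := hdeg (Classical.arbitrary P) (Classical.arbitrary Q)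
  obtain ⟨x₁, y₁, hx₁, -⟩ := hdeg (a x₀ y₀) (Classical.arbitrary Q)
  have ha₁ (y : Y) : a x₁ y ≠ a x₀ y := by rwa [ha x₁ y y₁, ha x₀ y y₀]
  have hb (x : X) (y : Y) : b x y = b x₀ y := by
    by_contra hne
    have h₁ : b x₁ y = b x₀ y := (hcol x₁ x₀ y).resolve_left (ha₁ y)
    have h₂ : a x y = a x₀ y := (hcol x x₀ y).resolve_right hne
    have h₃ : a x y = a x₁ y := (hcol x x₁ y).resolve_right (h₁ ▸ hne)
    exact ha₁ y (h₃.symm.trans h₂)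
  refine ⟨fun x => a x y₀, fun y => b x₀ y, fun x y => ⟨ha x y y₀, hb x y⟩, ⟨x₁, x₀, ha₁ y₀⟩, ?_⟩
  obtain ⟨x, y, -, hy⟩ := hdeg (Classical.arbitrary P) (b x₀ y₀)
  exact ⟨y, y₀, by rwa [hb] at hy⟩

theorem eq_of_crossing (hcol : ∀ x x' y, a x y = a x' y ∨ b x y = b x' y) {x₁ x₂ : X}
    {y₁ y₁' : Y} (ha₁ : ∀ y y', a x₁ y = a x₁ y') (hb₁ : b x₁ y₁ ≠ b x₁ y₁')
    (hb₂ : ∀ y y', b x₂ y = b x₂ y') {x : X} (hx : ∀ y y', a x y = a x y') (y : Y) :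
    a x y = a x₁ y₁ := by
  by_contra hax
  have hne (y' : Y) : a x y' ≠ a x₁ y' := by rwa [hx y' y, ha₁ y' y₁]
  have hb (y' : Y) : b x y' = b x₁ y' := (hcol x x₁ y').resolve_left (hne y')
  have hb₁₂ (y' : Y) : b x₁ y' = b x₂ y' := by
    rcases hcol x x₂ y' with h | h
    · exact (hcol x₁ x₂ y').resolve_left fun h' => hne y' (h.trans h'.symm)
    · rw [← hb, h]
  exact hb₁ (by rw [hb₁₂, hb₁₂, hb₂])

/-- If moving along either coordinate never changes both of `a` and `b`, then the pair `(a, b)` is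
contained in a cross, or factors through the coordinates, possibly exchanged. -/
theorem grid_trichotomy [Nonempty P] [Nonempty Q]
    (hrow : ∀ x y y', a x y = a x y' ∨ b x y = b x y')
    (hcol : ∀ x x' y, a x y = a x' y ∨ b x y = b x' y) :
    (∃ a₀ b₀, ∀ x y, a x y = a₀ ∨ b x y = b₀) ∨
    (∃ (h : X → P) (g : Y → Q), (∀ x y, a x y = h x ∧ b x y = g y) ∧
      (∃ x x', h x ≠ h x') ∧ ∃ y y', g y ≠ g y') ∨
    ∃ (k : Y → P) (l : X → Q), (∀ x y, a x y = k y ∧ b x y = l x) ∧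
      (∃ y y', k y ≠ k y') ∧ ∃ x x', l x ≠ l x' := by
  have hcol' : ∀ x x' y, b x y = b x' y ∨ a x y = a x' y := fun x x' y => (hcol x x' y).symm
  by_cases ha : ∀ x y y', a x y = a x y'
  · exact (grid_dichotomy hcol ha).imp_right Or.inl
  by_cases hb : ∀ x y y', b x y = b x y'
  · rcases grid_dichotomy hcol' hb with ⟨b₀, a₀, h⟩ | ⟨l, k, h, hl, hk⟩
    · exact Or.inl ⟨a₀, b₀, fun x y => (h x y).symm⟩
    · exact Or.inr (Or.inr ⟨k, l, fun x y => (h x y).symm, hk, hl⟩)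
  push Not at ha hb
  obtain ⟨x₂, y₂, y₂', hx₂⟩ := ha
  obtain ⟨x₁, y₁, y₁', hx₁⟩ := hb
  have ha₁ := (constant_or_constant (hrow x₁)).resolve_right fun h => hx₁ (h _ _)
  have hb₂ := (constant_or_constant (hrow x₂)).resolve_left fun h => hx₂ (h _ _)
  exact Or.inl ⟨a x₁ y₁, b x₂ y₂, fun x y => (constant_or_constant (hrow x)).imp
    (fun hx => eq_of_crossing hcol ha₁ hx₁ hb₂ hx y)
    (fun hx => eq_of_crossing hcol' hb₂ hx₂ ha₁ hx y)⟩

end Grid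

theorem parallel_rep_iff {R V : Type*} [DivisionRing R] [AddCommGroup V] [Module R V]
    {v w : ℙ R V} : Parallel R v.rep w.rep ↔ v = w := by
  rw [← mk_eq_mk_iff_parallel v.rep_nonzero w.rep_nonzero, v.mk_rep, w.mk_rep]

theorem parallel_rep_mk {R V : Type*} [DivisionRing R] [AddCommGroup V] [Module R V] {v : V}
    (hv : v ≠ 0) : Parallel R (Projectivization.mk R v hv).rep v := by
  rw [← mk_eq_mk_iff_parallel (Projectivization.rep_nonzero _) hv, Projectivization.mk_rep]

theorem exists_regularAtZero {φ : Matrix m n D → Matrix p q E} {h : {x : m → D // x ≠ 0} → p → E}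
    {g : {y : n → D // y ≠ 0} → q → E} (hh : ∀ x, h x ≠ 0) (hg : ∀ y, g y ≠ 0)
    (hmap : ∀ x y, ∃ c : E, c ≠ 0 ∧ φ (x.1 ⊠ y.1) = h x ⊠ (c • g y))
    (hcols : ∃ x x', ¬ ColParallel (h x) (h x')) (hrows : ∃ y y', ¬ RowParallel (g y) (g y')) :
    ∃ h g, RegularAtZero φ h g := by
  let h' := Function.extend Subtype.val h 0
  let g' := Function.extend Subtype.val g 0
  have hh' (x) : h' x.1 = h x := Subtype.val_injective.extend_apply h 0 x
  have hg' (y) : g' y.1 = g y := Subtype.val_injective.extend_apply g 0 y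
  refine ⟨h', g', fun x hx => hh' ⟨x, hx⟩ ▸ hh _, fun y hy => hg' ⟨y, hy⟩ ▸ hg _, ?_, ?_, ?_⟩
  · intro x y hx hy
    simpa only [← hh', ← hg'] using hmap ⟨x, hx⟩ ⟨y, hy⟩
  · obtain ⟨x, x', hxx'⟩ := hcols
    exact ⟨x, x', x.2, x'.2, by rwa [hh', hh']⟩
  · obtain ⟨y, y', hyy'⟩ := hrows
    exact ⟨y, y', y.2, y'.2, by rwa [hg', hg']⟩

/-- The image under `φ` of the matrices of rank one is contained in the union of two maximal
cliques of different types through `0`. -/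
def DegenerateAtZero (φ : Matrix m n D → Matrix p q E) : Prop :=
  ∃ (a : p → E) (b : q → E), a ≠ 0 ∧ b ≠ 0 ∧ ∀ x y, x ≠ 0 → y ≠ 0 →
    (∃ r, φ (x ⊠ y) = a ⊠ r) ∨ (∃ r, φ (x ⊠ y) = r ⊠ b)

theorem AdjacencyPreserving.exists_projectivization_rep {φ : Matrix m n D → Matrix p q E}
    (hφ : AdjacencyPreserving φ) (h0 : φ 0 = 0) {x : m → D} {y : n → D} (hx : x ≠ 0)
    (hy : y ≠ 0) :
    ∃ (a : ℙ Eᵐᵒᵖ (p → E)) (b : ℙ E (q → E)) (c : E), c ≠ 0 ∧ φ (x ⊠ y) = a.rep ⊠ (c • b.rep) := by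
  obtain ⟨u, v, hu, hv, huv⟩ := hφ.isRankOne_sub (B := 0) hx hy (sub_zero _)
  obtain ⟨c, hc, huc⟩ := parallel_rep_mk (R := Eᵐᵒᵖ) hu
  obtain ⟨d, hd, hvd⟩ := parallel_rep_mk (R := E) hv
  refine ⟨.mk _ u hu, .mk _ v hv, unop c * d, mul_ne_zero ((unop_ne_zero_iff c).2 hc) hd, ?_⟩
  calc φ (x ⊠ y) = u ⊠ v := by rw [← huv, h0, sub_zero]
    _ = (op (unop c) • _) ⊠ (d • _) := congrArg₂ vecMulVec huc hvd
    _ = _ := by rw [smul_op_vecMulVec, mul_smul]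

theorem AdjacencyPreserving.exists_projective_points {φ : Matrix m n D → Matrix p q E}
    (hφ : AdjacencyPreserving φ) (h0 : φ 0 = 0) :
    ∃ (a : {x : m → D // x ≠ 0} → {y : n → D // y ≠ 0} → ℙ Eᵐᵒᵖ (p → E))
      (b : {x : m → D // x ≠ 0} → {y : n → D // y ≠ 0} → ℙ E (q → E))
      (c : {x : m → D // x ≠ 0} → {y : n → D // y ≠ 0} → E),
      (∀ x y, c x y ≠ 0) ∧ (∀ x y, φ (x.1 ⊠ y.1) = (a x y).rep ⊠ (c x y • (b x y).rep)) ∧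
        (∀ x y y', a x y = a x y' ∨ b x y = b x y') ∧
          ∀ x x' y, a x y = a x' y ∨ b x y = b x' y := by
  choose a b c hc hab using fun (x : {x : m → D // x ≠ 0}) (y : {y : n → D // y ≠ 0}) =>
    hφ.exists_projectivization_rep h0 x.2 y.2
  have eq_or_eq {x x' y y'} (hadj : IsRankOne (x.1 ⊠ y.1 - x'.1 ⊠ y'.1)) :
      a x y = a x' y' ∨ b x y = b x' y' := by
    have h := hφ _ _ hadj
    rw [hab, hab] at h
    refine (parallel_or_parallel_of_isRankOne_sub (a x y).rep_nonzero
      (smul_ne_zero (hc x y) (b x y).rep_nonzero) (a x' y').rep_nonzero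
      (smul_ne_zero (hc x' y') (b x' y').rep_nonzero) h).imp parallel_rep_iff.1 fun hb => ?_
    exact parallel_rep_iff.1 <|
      (parallel_smul_left_iff (hc x y)).1 ((parallel_smul_right_iff (hc x' y')).1 hb)
  refine ⟨a, b, c, hc, hab, fun x y y' => ?_, fun x x' y => ?_⟩
  · by_cases hy : y = y'
    · exact Or.inl (hy ▸ rfl)
    · exact eq_or_eq (vecMulVec_sub x.1 y.1 y'.1 ▸
        isRankOne_vecMulVec x.2 (sub_ne_zero.2 (Subtype.coe_ne_coe.2 hy)))
  · by_cases hx : x = x'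
    · exact Or.inl (hx ▸ rfl)
    · exact eq_or_eq (sub_vecMulVec x.1 x'.1 y.1 ▸
        isRankOne_vecMulVec (sub_ne_zero.2 (Subtype.coe_ne_coe.2 hx)) y.2)

theorem degenerate_or_regular_or_transposed [Nonempty p] [Nonempty q]
    {φ : Matrix m n D → Matrix p q E} (hφ : AdjacencyPreserving φ) (h0 : φ 0 = 0) :
    DegenerateAtZero φ ∨ (∃ h g, RegularAtZero φ h g) ∨
      ∃ h g, RegularAtZero (fun X => opTranspose (φ X)) h g := by
  obtain ⟨a, b, c, hc, hab, hrow, hcol⟩ := hφ.exists_projective_points h0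
  rcases grid_trichotomy hrow hcol with ⟨a₀, b₀, hdeg⟩ | ⟨h, g, hhg, ⟨x₁, x₂, hx⟩, y₁, y₂, hy⟩ |
    ⟨k, l, hkl, ⟨y₁, y₂, hy⟩, x₁, x₂, hx⟩
  · refine Or.inl ⟨a₀.rep, b₀.rep, a₀.rep_nonzero, b₀.rep_nonzero, fun x y hx hy => ?_⟩
    have hφxy := hab ⟨x, hx⟩ ⟨y, hy⟩
    rcases hdeg ⟨x, hx⟩ ⟨y, hy⟩ with h | h
    · exact Or.inl ⟨_, h ▸ hφxy⟩
    · exact Or.inr ⟨_, by rw [← h, smul_op_vecMulVec]; exact hφxy⟩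
  · refine Or.inr (Or.inl (exists_regularAtZero (h := fun x => (h x).rep) (g := fun y => (g y).rep)
      (fun x => (h x).rep_nonzero) (fun y => (g y).rep_nonzero) (fun x y => ⟨c x y, hc x y, ?_⟩)
      ⟨x₁, x₂, mt parallel_rep_iff.1 hx⟩ ⟨y₁, y₂, mt parallel_rep_iff.1 hy⟩))
    rw [hab, (hhg x y).1, (hhg x y).2]
  · refine Or.inr (Or.inr (exists_regularAtZero (h := fun x => op ∘ (l x).rep)
      (g := fun y => op ∘ (k y).rep) (fun x => op_comp_ne_zero_iff.2 (l x).rep_nonzero)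
      (fun y => op_comp_ne_zero_iff.2 (k y).rep_nonzero)
      (fun x y => ⟨op (c x y), (op_ne_zero_iff _).2 (hc x y), ?_⟩)
      ⟨x₁, x₂, fun h => hx (parallel_rep_iff.1 (colParallel_op_iff.1 h))⟩
      ⟨y₁, y₂, fun h => hy (parallel_rep_iff.1 (rowParallel_op_iff.1 h))⟩))
    rw [hab, (hkl x y).1, (hkl x y).2, opTranspose_vecMulVec]
    ext i j
    simp [vecMulVec_apply, mul_assoc]

/-! ### Regularity at matrices of rank two -/

/-- The map `φ` with the base point `A` moved to the origin. -/
def shift (φ : Matrix m n D → Matrix p q E) (A X : Matrix m n D) : Matrix p q E :=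
  φ (A + X) - φ A

@[simp] theorem shift_zero (φ : Matrix m n D → Matrix p q E) (A : Matrix m n D) :
    shift φ A 0 = 0 := by simp [shift]

theorem shift_shift (φ : Matrix m n D → Matrix p q E) (A B : Matrix m n D) :
    shift (shift φ A) B = shift φ (A + B) := by
  ext X; simp [shift, add_assoc]

theorem shift_of_add_eq (φ : Matrix m n D → Matrix p q E) {A B X : Matrix m n D}
    (h : A + X = B) : shift φ A X = φ B - φ A := by
  rw [shift, h]

theorem shift_at_zero {φ : Matrix m n D → Matrix p q E} (h0 : φ 0 = 0) : shift φ 0 = φ := by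
  ext X; simp [shift, h0]

theorem AdjacencyPreserving.shift {φ : Matrix m n D → Matrix p q E} (hφ : AdjacencyPreserving φ)
    (A : Matrix m n D) : AdjacencyPreserving (shift φ A) := fun X Y h => by
  simpa [HuaGeometry.shift] using hφ (A + X) (A + Y) (by simpa using h)

section NotProduct

variable {C : Matrix p q E} {u u' : p → E} {w w' : q → E}

theorem false_of_common_col {x₀ : p → E} {r r' : q → E} (hC : ∀ u w, C ≠ u ⊠ w) (hu : u ≠ 0)
    (hw : w ≠ w') (h : u ⊠ w - C = x₀ ⊠ r) (h' : u ⊠ w' - C = x₀ ⊠ r') : False := by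
  have hsub : u ⊠ (w - w') = x₀ ⊠ (r - r') := by
    rw [vecMulVec_sub, vecMulVec_sub, ← h, ← h']; abel
  obtain ⟨t, -, rfl⟩ :=
    (colParallel_and_rowParallel_of_vecMulVec_eq hu (sub_ne_zero.2 hw) hsub).1
  rw [← op_unop t, sub_eq_iff_eq_add, ← sub_eq_iff_eq_add', smul_op_vecMulVec,
    ← vecMulVec_sub] at h
  exact hC _ _ h.symm

theorem false_of_common_row {y₀ : q → E} {r r' : p → E} (hC : ∀ u w, C ≠ u ⊠ w) (hu : u ≠ 0)
    (hu' : u' ≠ 0) (hw : w ≠ 0) (hw' : w' ≠ 0) (huu' : ¬ ColParallel u u')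
    (h : u ⊠ w - C = r ⊠ y₀) (h' : u' ⊠ w' - C = r' ⊠ y₀) : False := by
  have hsub : u ⊠ w - u' ⊠ w' = (r - r') ⊠ y₀ := by
    rw [sub_vecMulVec, ← h, ← h']; abel
  obtain ⟨t, ht, rfl⟩ := (parallel_or_parallel_of_sub_eq hu hw hu' hw' hsub).resolve_left huu'
  rw [← smul_op_vecMulVec, ← sub_vecMulVec] at hsub
  have hne : u - op t • u' ≠ 0 := by
    rw [sub_ne_zero]
    rintro rfl
    exact huu' (parallel_smul ((op_ne_zero_iff t).2 ht) u').symm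
  obtain ⟨s, -, rfl⟩ := (colParallel_and_rowParallel_of_vecMulVec_eq hne hw hsub).2
  rw [sub_eq_iff_eq_add, ← sub_eq_iff_eq_add', vecMulVec_smul', ← sub_vecMulVec] at h
  exact hC _ _ h.symm

end NotProduct

namespace RegularAtZero

variable {φ : Matrix m n D → Matrix p q E} {h : (m → D) → p → E} {g : (n → D) → q → E}
  {x₁ x₂ : m → D} {y₁ y₂ : n → D}

theorem not_isRankOne_map_add (H : RegularAtZero φ h g) (hφ : AdjacencyPreserving φ)
    (hx₁ : x₁ ≠ 0) (hx₂ : x₂ ≠ 0) (hy₁ : y₁ ≠ 0) (hy₂ : y₂ ≠ 0)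
    (hx : ¬ ColParallel (h x₁) (h x₂)) (hy : ¬ RowParallel (g y₁) (g y₂)) :
    ¬ IsRankOne (φ (x₁ ⊠ y₁ + x₂ ⊠ y₂)) := by
  rintro ⟨a, b, ha, hb, hab⟩
  have hxd : x₂ - x₁ ≠ 0 := sub_ne_zero_of_not_parallel_map (mt Parallel.symm hx)
  have hyd : y₂ - y₁ ≠ 0 := sub_ne_zero_of_not_parallel_map (mt Parallel.symm hy)
  have par {u u' : m → D} {v v' : n → D} (hu : u ≠ 0) (hv : v ≠ 0) (hu' : u' ≠ 0) (hv' : v' ≠ 0)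
      (he : x₁ ⊠ y₁ + x₂ ⊠ y₂ - u ⊠ v = u' ⊠ v') : ColParallel a (h u) ∨ RowParallel b (g v) :=
    H.parallel_or_parallel_of_adjacent hu hv ha hb (hab ▸ hφ.isRankOne_sub hu' hv' he)
  have h₁₁ := par hx₁ hy₁ hx₂ hy₂ (by abel)
  have h₂₂ := par hx₂ hy₂ hx₁ hy₁ (by abel)
  have h₁₃ := par hx₁ (H.row_add_ne_zero hy₁ hy) hxd hy₂ (by
    simp only [sub_vecMulVec, vecMulVec_add]; abel)
  have h₃₁ := par (H.col_add_ne_zero hx₁ hx) hy₁ hx₂ hyd (by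
    simp only [add_vecMulVec, vecMulVec_sub]; abel)
  by_cases hc : ColParallel a (h x₁)
  · have hb₂ : RowParallel b (g y₂) := h₂₂.resolve_left fun h' => hx (hc.symm.trans h')
    have hb₁ : RowParallel b (g y₁) := h₃₁.resolve_left fun h' =>
      H.not_colParallel_map_add hφ hx₁ hx₂ hx (hc.symm.trans h')
    exact hy (hb₁.symm.trans hb₂)
  · exact H.not_rowParallel_map_add hφ hy₁ hy₂ hy
      ((h₁₁.resolve_left hc).symm.trans (h₁₃.resolve_left hc))

theorem map_add_ne_vecMulVec (H : RegularAtZero φ h g) (hφ : AdjacencyPreserving φ)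
    (hx₁ : x₁ ≠ 0) (hx₂ : x₂ ≠ 0) (hy₁ : y₁ ≠ 0) (hy₂ : y₂ ≠ 0)
    (hx : ¬ ColParallel (h x₁) (h x₂)) (hy : ¬ RowParallel (g y₁) (g y₂)) (u : p → E)
    (w : q → E) : φ (x₁ ⊠ y₁ + x₂ ⊠ y₂) ≠ u ⊠ w := by
  intro heq
  by_cases h0 : φ (x₁ ⊠ y₁ + x₂ ⊠ y₂) = 0
  · have hadj := hφ.isRankOne_sub (A := x₁ ⊠ y₁ + (x₁ + x₂) ⊠ y₂) (B := x₁ ⊠ y₁ + x₂ ⊠ y₂) hx₁ hy₂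
      (by rw [add_vecMulVec]; abel)
    rw [h0, sub_zero] at hadj
    exact H.not_isRankOne_map_add hφ hx₁ (H.col_add_ne_zero hx₁ hx) hy₁ hy₂
      (H.not_colParallel_map_add hφ hx₁ hx₂ hx) hy hadj
  · apply H.not_isRankOne_map_add hφ hx₁ hx₂ hy₁ hy₂ hx hy
    rw [heq] at h0 ⊢
    exact isRankOne_vecMulVec_of_ne_zero h0

theorem exists_map_add_eq (H : RegularAtZero φ h g) (hφ : AdjacencyPreserving φ)
    (hx₁ : x₁ ≠ 0) (hx₂ : x₂ ≠ 0) (hy₁ : y₁ ≠ 0) (hy₂ : y₂ ≠ 0)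
    (hx : ¬ ColParallel (h x₁) (h x₂)) (hy : ¬ RowParallel (g y₁) (g y₂)) :
    ∃ a b c d : E, φ (x₁ ⊠ y₁ + x₂ ⊠ y₂) =
      h x₁ ⊠ (a • g y₁ + b • g y₂) + h x₂ ⊠ (c • g y₁ + d • g y₂) := by
  obtain ⟨u, w, hu, hw, e1⟩ := hφ.isRankOne_sub (A := x₁ ⊠ y₁ + x₂ ⊠ y₂) (B := x₁ ⊠ y₁) hx₂ hy₂
    (by abel)
  obtain ⟨u', w', -, -, e2⟩ := hφ.isRankOne_sub (A := x₁ ⊠ y₁ + x₂ ⊠ y₂) (B := x₂ ⊠ y₂) hx₁ hy₁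
    (by abel)
  obtain ⟨s, hs, f1⟩ := H.map_vecMulVec x₁ y₁ hx₁ hy₁
  obtain ⟨t, ht, f2⟩ := H.map_vecMulVec x₂ y₂ hx₂ hy₂
  rw [f1] at e1
  rw [f2] at e2
  have hsub : u ⊠ w - u' ⊠ w' = h x₂ ⊠ (t • g y₂) - h x₁ ⊠ (s • g y₁) := by
    rw [← e1, ← e2]; abel
  obtain ⟨huu', hww'⟩ := not_parallel_of_sub_eq_sub (H.col_ne_zero _ hx₂)
    (smul_ne_zero ht (H.row_ne_zero _ hy₂)) (H.col_ne_zero _ hx₁)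
    (smul_ne_zero hs (H.row_ne_zero _ hy₁)) (mt Parallel.symm hx)
    (fun hp => hy ((parallel_smul_left_iff ht).1 ((parallel_smul_right_iff hs).1 hp)).symm) hsub
  obtain ⟨f, hfw, hfw'⟩ := exists_linearMap_eq_one_eq_zero hw hww'
  obtain ⟨k, hku, hku'⟩ := exists_linearMap_eq_one_eq_zero hu huu'
  have hu_eq : u = op (f (t • g y₂)) • h x₂ - op (f (s • g y₁)) • h x₁ := by
    simpa only [map_sub, contractRows_vecMulVec, hfw, hfw', op_one, one_smul, op_zero, zero_smul,
      sub_zero] using congrArg (contractRows f) hsub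
  have hw_eq : w = unop (k (h x₂)) • t • g y₂ - unop (k (h x₁)) • s • g y₁ := by
    simpa only [map_sub, contractCols_vecMulVec, hku, hku', unop_one, one_smul, unop_zero,
      zero_smul, sub_zero] using congrArg (contractCols k) hsub
  set α := f (t • g y₂)
  set β := f (s • g y₁)
  set γ := unop (k (h x₂))
  set δ := unop (k (h x₁))
  refine ⟨s + β * δ * s, -(β * γ * t), -(α * δ * s), α * γ * t, ?_⟩
  rw [sub_eq_iff_eq_add.1 e1, hu_eq, hw_eq]
  simp only [sub_vecMulVec, smul_op_vecMulVec, vecMulVec_add, vecMulVec_sub, add_smul, neg_smul,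
    mul_smul, vecMulVec_neg]
  abel

theorem false_of_map_sub_eq_common_col (H : RegularAtZero φ h g) {C : Matrix p q E}
    (hC : ∀ u w, C ≠ u ⊠ w) (hx₁ : x₁ ≠ 0) (hy₁ : y₁ ≠ 0) (hy₂ : y₂ ≠ 0)
    (hy : ¬ RowParallel (g y₁) (g y₂)) {x₀ : p → E} {r r' : q → E}
    (h₁ : φ (x₁ ⊠ y₁) - C = x₀ ⊠ r) (h₂ : φ (x₁ ⊠ y₂) - C = x₀ ⊠ r') : False := by
  obtain ⟨c, hc, hφc⟩ := H.map_vecMulVec _ _ hx₁ hy₁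
  obtain ⟨d, hd, hφd⟩ := H.map_vecMulVec _ _ hx₁ hy₂
  rw [hφc] at h₁
  rw [hφd] at h₂
  refine false_of_common_col hC (H.col_ne_zero _ hx₁) (fun hcd => hy ?_) h₁ h₂
  exact (parallel_smul_left_iff hc).1 (hcd ▸ (parallel_smul hd _).symm)

theorem exists_sub_eq_vecMulVec_row (H : RegularAtZero φ h g) {C : Matrix p q E}
    (hC : ∀ u w, C ≠ u ⊠ w) (hx₁ : x₁ ≠ 0) (hy₁ : y₁ ≠ 0) (hy₂ : y₂ ≠ 0)
    (hy : ¬ RowParallel (g y₁) (g y₂)) {x₀ : p → E} {y₀ : q → E}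
    (h₁ : (∃ r, φ (x₁ ⊠ y₁) - C = x₀ ⊠ r) ∨ ∃ r, φ (x₁ ⊠ y₁) - C = r ⊠ y₀)
    (h₂ : (∃ r, φ (x₁ ⊠ y₂) - C = x₀ ⊠ r) ∨ ∃ r, φ (x₁ ⊠ y₂) - C = r ⊠ y₀) :
    ∃ w r, w ≠ 0 ∧ h x₁ ⊠ w - C = r ⊠ y₀ := by
  have of_row {y : n → D} (hy : y ≠ 0) :
      (∃ r, φ (x₁ ⊠ y) - C = r ⊠ y₀) → ∃ w r, w ≠ 0 ∧ h x₁ ⊠ w - C = r ⊠ y₀ := by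
    rintro ⟨r, hr⟩
    obtain ⟨c, hc, hφc⟩ := H.map_vecMulVec _ _ hx₁ hy
    exact ⟨c • g y, r, smul_ne_zero hc (H.row_ne_zero _ hy), hφc ▸ hr⟩
  rcases h₁ with ⟨r, h₁⟩ | h₁
  · rcases h₂ with ⟨r', h₂⟩ | h₂
    · exact (H.false_of_map_sub_eq_common_col hC hx₁ hy₁ hy₂ hy h₁ h₂).elim
    · exact of_row hy₂ h₂
  · exact of_row hy₁ h₁

theorem not_degenerateAtZero_shift (H : RegularAtZero φ h g) (hφ : AdjacencyPreserving φ)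
    (hx₁ : x₁ ≠ 0) (hx₂ : x₂ ≠ 0) (hy₁ : y₁ ≠ 0) (hy₂ : y₂ ≠ 0)
    (hx : ¬ ColParallel (h x₁) (h x₂)) (hy : ¬ RowParallel (g y₁) (g y₂)) :
    ¬ DegenerateAtZero (shift φ (x₁ ⊠ y₁ + x₂ ⊠ y₂)) := by
  rintro ⟨x₀, y₀, -, -, hd⟩
  have hC := H.map_add_ne_vecMulVec hφ hx₁ hx₂ hy₁ hy₂ hx hy
  have hxd : x₁ - x₂ ≠ 0 := sub_ne_zero_of_not_parallel_map hx
  have hy₃ : y₁ + y₂ ≠ 0 := H.row_add_ne_zero hy₁ hy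
  have hy₁₃ : ¬ RowParallel (g y₁) (g (y₁ + y₂)) := H.not_rowParallel_map_add hφ hy₁ hy₂ hy
  have hy₂₃ : ¬ RowParallel (g y₂) (g (y₁ + y₂)) :=
    add_comm y₁ y₂ ▸ H.not_rowParallel_map_add hφ hy₂ hy₁ (mt Parallel.symm hy)
  have d₁₁ := hd _ _ (neg_ne_zero.2 hx₂) hy₂
  have d₁₃ := hd _ _ hxd hy₂
  have d₂₂ := hd _ _ (neg_ne_zero.2 hx₁) hy₁
  have d₂₃ := hd _ _ (neg_ne_zero.2 hxd) hy₁
  rw [shift_of_add_eq φ (B := x₁ ⊠ y₁) (by rw [neg_vecMulVec]; abel)] at d₁₁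
  rw [shift_of_add_eq φ (B := x₁ ⊠ (y₁ + y₂)) (by rw [sub_vecMulVec, vecMulVec_add]; abel)] at d₁₃
  rw [shift_of_add_eq φ (B := x₂ ⊠ y₂) (by rw [neg_vecMulVec]; abel)] at d₂₂
  rw [neg_sub, shift_of_add_eq φ (B := x₂ ⊠ (y₁ + y₂))
    (by rw [sub_vecMulVec, vecMulVec_add]; abel)] at d₂₃
  obtain ⟨w, r, hw, hr⟩ := H.exists_sub_eq_vecMulVec_row hC hx₁ hy₁ hy₃ hy₁₃ d₁₁ d₁₃
  obtain ⟨w', r', hw', hr'⟩ := H.exists_sub_eq_vecMulVec_row hC hx₂ hy₂ hy₃ hy₂₃ d₂₂ d₂₃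
  exact false_of_common_row hC (H.col_ne_zero _ hx₁) (H.col_ne_zero _ hx₂) hw hw' hx hr hr'

theorem not_regularAtZero_opTranspose_shift (H : RegularAtZero φ h g)
    (hφ : AdjacencyPreserving φ) (hx₁ : x₁ ≠ 0) (hx₂ : x₂ ≠ 0) (hy₁ : y₁ ≠ 0) (hy₂ : y₂ ≠ 0)
    (hx : ¬ ColParallel (h x₁) (h x₂)) (hy : ¬ RowParallel (g y₁) (g y₂))
    (k : (m → D) → q → Eᵐᵒᵖ) (l : (n → D) → p → Eᵐᵒᵖ) :
    ¬ RegularAtZero (fun X => opTranspose (shift φ (x₁ ⊠ y₁ + x₂ ⊠ y₂) X)) k l := by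
  intro K
  have common_col {x : m → D} (hx : x ≠ 0) :
      ∃ r, shift φ (x₁ ⊠ y₁ + x₂ ⊠ y₂) (x ⊠ y₂) = (unop ∘ l y₂) ⊠ r := by
    obtain ⟨c, -, hc⟩ := K.map_vecMulVec x y₂ hx hy₂
    rw [← AddEquiv.eq_symm_apply, opTranspose_symm_vecMulVec] at hc
    exact ⟨unop c • (unop ∘ k x), hc.trans (smul_op_vecMulVec (unop c) (unop ∘ l y₂) _)⟩
  obtain ⟨r, hr⟩ := common_col (neg_ne_zero.2 hx₂)
  obtain ⟨r', hr'⟩ := common_col (sub_ne_zero_of_not_parallel_map hx)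
  rw [shift_of_add_eq φ (B := x₁ ⊠ y₁) (by rw [neg_vecMulVec]; abel)] at hr
  rw [shift_of_add_eq φ (B := x₁ ⊠ (y₁ + y₂)) (by rw [sub_vecMulVec, vecMulVec_add]; abel)] at hr'
  exact H.false_of_map_sub_eq_common_col (H.map_add_ne_vecMulVec hφ hx₁ hx₂ hy₁ hy₂ hx hy) hx₁ hy₁
    (H.row_add_ne_zero hy₁ hy) (H.not_rowParallel_map_add hφ hy₁ hy₂ hy) hr hr'

theorem exists_regularAtZero_shift (H : RegularAtZero φ h g) (hφ : AdjacencyPreserving φ)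
    (hx₁ : x₁ ≠ 0) (hx₂ : x₂ ≠ 0) (hy₁ : y₁ ≠ 0) (hy₂ : y₂ ≠ 0)
    (hx : ¬ ColParallel (h x₁) (h x₂)) (hy : ¬ RowParallel (g y₁) (g y₂)) :
    ∃ h' g', RegularAtZero (shift φ (x₁ ⊠ y₁ + x₂ ⊠ y₂)) h' g' := by
  obtain ⟨i, -⟩ := Function.ne_iff.1 (H.col_ne_zero _ hx₁)
  obtain ⟨j, -⟩ := Function.ne_iff.1 (H.row_ne_zero _ hy₁)
  have : Nonempty p := ⟨i⟩
  have : Nonempty q := ⟨j⟩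
  rcases degenerate_or_regular_or_transposed (hφ.shift (x₁ ⊠ y₁ + x₂ ⊠ y₂)) (shift_zero φ _) with
    hdeg | hreg | ⟨k, l, htrans⟩
  · exact (H.not_degenerateAtZero_shift hφ hx₁ hx₂ hy₁ hy₂ hx hy hdeg).elim
  · exact hreg
  · exact (H.not_regularAtZero_opTranspose_shift hφ hx₁ hx₂ hy₁ hy₂ hx hy k l htrans).elim

end RegularAtZero

/-! ### Regular maps on two by two matrices -/

theorem linearIndependent_of_not_parallel {R V : Type*} [DivisionRing R] [AddCommGroup V]
    [Module R V] {v : Fin 2 → V} (hv : ∀ i, v i ≠ 0) (h : ¬ Parallel R (v 0) (v 1)) :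
    LinearIndependent R v := by
  rw [show v = ![v 0, v 1] by ext i; fin_cases i <;> rfl, LinearIndependent.pair_iff' (hv 0)]
  exact fun c hc => h ⟨c, left_ne_zero_of_smul (hc ▸ hv 1), hc.symm⟩

theorem not_parallel_sub {R V : Type*} [DivisionRing R] [AddCommGroup V] [Module R V] {v w : V}
    (hw : w ≠ 0) (h : ¬ Parallel R v w) : ¬ Parallel R v (v - w) := by
  rintro ⟨c, -, hc⟩
  have hwc : w = (1 - c) • v := by rw [sub_smul, one_smul, ← hc, sub_sub_cancel]
  exact h ⟨1 - c, left_ne_zero_of_smul (hwc ▸ hw), hwc⟩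

theorem exists_smul_add_smul_eq {y₁ y₂ : Fin 2 → D} (hy₁ : y₁ ≠ 0) (hy₂ : y₂ ≠ 0)
    (h : ¬ RowParallel y₁ y₂) (y : Fin 2 → D) : ∃ a b : D, a • y₁ + b • y₂ = y := by
  have hspan := (linearIndependent_of_not_parallel (v := ![y₁, y₂])
    (Fin.forall_fin_two.2 ⟨hy₁, hy₂⟩) h).span_eq_top_of_card_eq_finrank (by simp)
  rw [range_cons, range_cons, range_empty, Set.union_empty, Set.singleton_union] at hspan
  exact Submodule.mem_span_pair.1 (hspan ▸ Submodule.mem_top)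

theorem exists_not_rowParallel (y : Fin 2 → D) : ∃ y' : Fin 2 → D, y' ≠ 0 ∧ ¬ RowParallel y y' := by
  by_cases hy : y 0 = 0
  · refine ⟨Pi.single 0 1, by simp, ?_⟩
    rintro ⟨c, -, h⟩
    simpa [hy] using congrFun h 0
  · refine ⟨Pi.single 1 1, by simp, ?_⟩
    rintro ⟨c, hc, h⟩
    simpa [hy, hc, eq_comm] using congrFun h 0

theorem exists_not_colParallel (x : Fin 2 → D) :
    ∃ x' : Fin 2 → D, x' ≠ 0 ∧ ¬ ColParallel x x' := by
  obtain ⟨y, hy, h⟩ := exists_not_rowParallel (op ∘ x)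
  exact ⟨unop ∘ y, unop_comp_ne_zero_iff.2 hy, fun h1 => h (rowParallel_op_iff.2 h1)⟩

theorem not_rowParallel_single : ¬ RowParallel (Pi.single 0 1 : Fin 2 → D) (Pi.single 1 1) := by
  rintro ⟨c, hc, h⟩
  simpa [hc, eq_comm] using congrFun h 0

theorem not_colParallel_single : ¬ ColParallel (Pi.single 0 1 : Fin 2 → D) (Pi.single 1 1) := by
  rintro ⟨c, hc, h⟩
  simpa [hc, eq_comm] using congrFun h 0

theorem eq_single_vecMulVec_add (X : Matrix (Fin 2) n D) :
    X = Pi.single 0 1 ⊠ X 0 + Pi.single 1 1 ⊠ X 1 := by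
  ext i j
  rw [Matrix.add_apply, vecMulVec_apply, vecMulVec_apply]
  fin_cases i <;> simp

namespace RegularAtZero

section

variable {φ : Matrix m n D → Matrix p q E} {h : (m → D) → p → E} {g : (n → D) → q → E}
  {y₁ y₂ : n → D}

theorem exists_map_add_eq_add (H : RegularAtZero φ h g) (hφ : AdjacencyPreserving φ)
    {x₁ x₂ : m → D} (hx₁ : x₁ ≠ 0) (hx₂ : x₂ ≠ 0) (hy₁ : y₁ ≠ 0) (hy₂ : y₂ ≠ 0)
    (hx : ¬ ColParallel (h x₁) (h x₂)) (hy : ¬ RowParallel (g y₁) (g y₂)) :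
    ∃ u v : p → E, u ≠ 0 ∧ φ (x₁ ⊠ y₁ + x₂ ⊠ y₂) = u ⊠ g y₁ + v ⊠ g y₂ := by
  obtain ⟨a, b, c, d, e⟩ := H.exists_map_add_eq hφ hx₁ hx₂ hy₁ hy₂ hx hy
  have e' : φ (x₁ ⊠ y₁ + x₂ ⊠ y₂) =
      (op a • h x₁ + op c • h x₂) ⊠ g y₁ + (op b • h x₁ + op d • h x₂) ⊠ g y₂ := by
    simp only [e, add_vecMulVec, vecMulVec_add, smul_op_vecMulVec]
    abel
  refine ⟨_, _, fun h0 => ?_, e'⟩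
  rw [h0, zero_vecMulVec, zero_add] at e'
  exact H.map_add_ne_vecMulVec hφ hx₁ hx₂ hy₁ hy₂ hx hy _ _ e'

theorem row_add_mem_span (H : RegularAtZero φ h g) (hφ : AdjacencyPreserving φ)
    (hy₁ : y₁ ≠ 0) (hy₂ : y₂ ≠ 0) (hy : ¬ RowParallel (g y₁) (g y₂)) :
    g (y₁ + y₂) ∈ Submodule.span E {g y₁, g y₂} := by
  obtain ⟨x₁, x₂, hx₁, hx₂, hx⟩ := H.exists_cols
  have hy₁₂ : ¬ RowParallel (g (y₁ + y₂)) (g y₂) := fun h1 =>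
    H.not_rowParallel_map_add hφ hy₂ hy₁ (mt Parallel.symm hy) (add_comm y₁ y₂ ▸ h1.symm)
  obtain ⟨u, v, hu, e⟩ := H.exists_map_add_eq_add hφ hx₁ hx₂ (H.row_add_ne_zero hy₁ hy) hy₂ hx hy₁₂
  obtain ⟨u', v', -, e'⟩ := H.exists_map_add_eq_add hφ hx₁ (H.col_add_ne_zero hx₁ hx) hy₁ hy₂
    (H.not_colParallel_map_add hφ hx₁ hx₂ hx) hy
  rw [show x₁ ⊠ (y₁ + y₂) + x₂ ⊠ y₂ = x₁ ⊠ y₁ + (x₁ + x₂) ⊠ y₂ by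
    rw [vecMulVec_add, add_vecMulVec, add_assoc], e'] at e
  have hu0 : ¬ ColParallel u 0 := by
    rintro ⟨c, hc, h0⟩
    exact smul_ne_zero hc hu h0.symm
  obtain ⟨k, hku, -⟩ := exists_linearMap_eq_one_eq_zero hu hu0
  have hk := congrArg (contractCols k) e
  simp only [map_add, contractCols_vecMulVec, hku, unop_one, one_smul] at hk
  rw [eq_sub_of_add_eq hk.symm, Submodule.mem_span_pair]
  exact ⟨unop (k u'), unop (k v') - unop (k v), by rw [sub_smul, add_sub_assoc]⟩

end

section TwoByTwo

variable {φ : Matrix (Fin 2) (Fin 2) D → Matrix p q E} {h : (Fin 2 → D) → p → E}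
  {g : (Fin 2 → D) → q → E}

theorem not_rowParallel_map (H : RegularAtZero φ h g) (hφ : AdjacencyPreserving φ)
    {y₁ y₂ : Fin 2 → D} (hy₁ : y₁ ≠ 0) (hy₂ : y₂ ≠ 0) (hp : ¬ RowParallel y₁ y₂) :
    ¬ RowParallel (g y₁) (g y₂) := by
  intro h1
  have key (y : Fin 2 → D) (hy : y ≠ 0) : RowParallel (g y₁) (g y) := by
    obtain ⟨a, b, rfl⟩ := exists_smul_add_smul_eq hy₁ hy₂ hp y
    rcases eq_or_ne a 0 with rfl | ha
    · rw [zero_smul, zero_add] at hy ⊢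
      exact h1.trans (H.rowParallel_map hy₂ (parallel_smul (left_ne_zero_of_smul hy) y₂))
    have ha' := H.rowParallel_map hy₁ (parallel_smul ha y₁)
    rcases eq_or_ne b 0 with rfl | hb
    · rwa [zero_smul, add_zero]
    have hb' := H.rowParallel_map hy₂ (parallel_smul hb y₂)
    exact ha'.trans <| H.rowParallel_map_add hφ (smul_ne_zero ha hy₁) (smul_ne_zero hb hy₂) hy
      ((ha'.symm.trans h1).trans hb')
  obtain ⟨y, y', hy, hy', hn⟩ := H.exists_rows
  exact hn ((key y hy).symm.trans (key y' hy'))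

theorem not_colParallel_map (H : RegularAtZero φ h g) (hφ : AdjacencyPreserving φ)
    {x₁ x₂ : Fin 2 → D} (hx₁ : x₁ ≠ 0) (hx₂ : x₂ ≠ 0) (hp : ¬ ColParallel x₁ x₂) :
    ¬ ColParallel (h x₁) (h x₂) := fun h1 =>
  H.dual.not_rowParallel_map hφ.dual (op_comp_ne_zero_iff.2 hx₁) (op_comp_ne_zero_iff.2 hx₂)
    (fun h2 => hp (rowParallel_op_iff.1 h2)) (rowParallel_op_iff.2 h1)

theorem row_mem_span (H : RegularAtZero φ h g) (hφ : AdjacencyPreserving φ) {y : Fin 2 → D}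
    (hy : y ≠ 0) : g y ∈ Submodule.span E (Set.range fun j => g (Pi.single j 1)) := by
  have hj (j : Fin 2) {c : D} (hc : c ≠ 0) : g (c • Pi.single j 1) ∈
      Submodule.span E (Set.range fun j => g (Pi.single j 1)) := by
    obtain ⟨d, -, hd⟩ := H.rowParallel_map (by simp) (parallel_smul hc (Pi.single j 1))
    exact hd ▸ Submodule.smul_mem _ d (Submodule.subset_span ⟨j, rfl⟩)
  obtain ⟨a, b, rfl⟩ := exists_smul_add_smul_eq (by simp) (by simp) not_rowParallel_single y
  rcases eq_or_ne a 0 with rfl | ha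
  · rw [zero_smul, zero_add] at hy ⊢
    exact hj 1 (left_ne_zero_of_smul hy)
  rcases eq_or_ne b 0 with rfl | hb
  · rw [zero_smul, add_zero] at hy ⊢
    exact hj 0 ha
  have hab : ¬ RowParallel (a • Pi.single 0 1 : Fin 2 → D) (b • Pi.single 1 1) := fun h1 =>
    not_rowParallel_single ((parallel_smul_left_iff ha).1 ((parallel_smul_right_iff hb).1 h1))
  have ha0 : a • (Pi.single 0 1 : Fin 2 → D) ≠ 0 := smul_ne_zero ha (by simp)
  have hb0 : b • (Pi.single 1 1 : Fin 2 → D) ≠ 0 := smul_ne_zero hb (by simp)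
  refine Submodule.span_le.2 ?_
    (H.row_add_mem_span hφ ha0 hb0 (H.not_rowParallel_map hφ ha0 hb0 hab))
  rintro - (rfl | rfl)
  exacts [hj 0 ha, hj 1 hb]

theorem exists_eq_vecMul (H : RegularAtZero φ h g) (hφ : AdjacencyPreserving φ) {y : Fin 2 → D}
    (hy : y ≠ 0) : ∃ t, g y = t ᵥ* of fun j => g (Pi.single j 1) := by
  obtain ⟨t, ht⟩ := Submodule.mem_span_range_iff_exists_fun E |>.1 (H.row_mem_span hφ hy)
  exact ⟨t, by rw [vecMul_eq_sum, ← ht]; rfl⟩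

theorem exists_eq_mulVec (H : RegularAtZero φ h g) (hφ : AdjacencyPreserving φ) {x : Fin 2 → D}
    (hx : x ≠ 0) : ∃ s, h x = (of fun i j => h (Pi.single j 1) i) *ᵥ s := by
  obtain ⟨t, ht⟩ := H.dual.exists_eq_vecMul hφ.dual (op_comp_ne_zero_iff.2 hx)
  refine ⟨unop ∘ t, funext fun i => ?_⟩
  have hi := congrArg unop (congrFun ht i)
  have hs (j : Fin 2) : unop ∘ (Pi.single j 1 : Fin 2 → Dᵐᵒᵖ) = Pi.single j 1 := by
    ext k; by_cases hk : k = j <;> simp [hk]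
  simp only [vecMul, dotProduct, of_apply, Function.comp_apply, hs, Fin.sum_univ_two] at hi
  exact hi.trans (by simp [mulVec, dotProduct])

end TwoByTwo

end RegularAtZero

theorem exists_regularAtZero_shift_two {φ : Matrix (Fin 2) (Fin 2) D → Matrix p q E}
    (hφ : AdjacencyPreserving φ) (A₀ A : Matrix (Fin 2) (Fin 2) D)
    (H : ∃ h g, RegularAtZero (shift φ A₀) h g) : ∃ h g, RegularAtZero (shift φ A) h g := by
  have add_two {A : Matrix (Fin 2) (Fin 2) D} {x₁ x₂ y₁ y₂ : Fin 2 → D} (hx₁ : x₁ ≠ 0)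
      (hx₂ : x₂ ≠ 0) (hy₁ : y₁ ≠ 0) (hy₂ : y₂ ≠ 0) (hx : ¬ ColParallel x₁ x₂)
      (hy : ¬ RowParallel y₁ y₂) : (∃ h g, RegularAtZero (shift φ A) h g) →
      ∃ h g, RegularAtZero (shift φ (A + (x₁ ⊠ y₁ + x₂ ⊠ y₂))) h g := by
    rintro ⟨h, g, H⟩
    rw [← shift_shift]
    exact H.exists_regularAtZero_shift (hφ.shift A) hx₁ hx₂ hy₁ hy₂
      (H.not_colParallel_map (hφ.shift A) hx₁ hx₂ hx)
      (H.not_rowParallel_map (hφ.shift A) hy₁ hy₂ hy)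
  have add_one {A : Matrix (Fin 2) (Fin 2) D} {x : Fin 2 → D} (y : Fin 2 → D) (hx : x ≠ 0)
      (hA : ∃ h g, RegularAtZero (shift φ A) h g) :
      ∃ h g, RegularAtZero (shift φ (A + x ⊠ y)) h g := by
    rcases eq_or_ne y 0 with rfl | hy
    · simpa using hA
    obtain ⟨x', hx', hxx'⟩ := exists_not_colParallel x
    obtain ⟨y', hy', hyy'⟩ := exists_not_rowParallel y
    have hyd : y - y' ≠ 0 := sub_ne_zero.2 fun h0 => hyy' (h0 ▸ Parallel.refl y)
    rw [show A + x ⊠ y = A + (x ⊠ y' + x' ⊠ y) + (x ⊠ (y - y') + (-x') ⊠ y) by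
      rw [vecMulVec_sub, neg_vecMulVec]; abel]
    exact add_two hx (neg_ne_zero.2 hx') hyd hy (fun h1 => hxx' (h1.trans (parallel_neg x').symm))
      (fun h1 => not_parallel_sub hy' hyy' h1.symm)
      (add_two hx hx' hy' hy hxx' (fun h1 => hyy' h1.symm) hA)
  have hA := add_one ((A - A₀) 1) (x := Pi.single 1 1) (by simp)
    (add_one ((A - A₀) 0) (x := Pi.single 0 1) (by simp) H)
  rwa [add_assoc, ← eq_single_vecMulVec_add, add_sub_cancel] at hA

section OneSidedInverses

theorem opTranspose_mul [Fintype n] (M : Matrix m n E) (N : Matrix n q E) :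
    opTranspose (M * N) = opTranspose N * opTranspose M := by
  ext i j
  simp only [opTranspose_apply, mul_apply, Finset.op_sum, op_mul]

theorem exists_mul_eq_one_of_linearIndependent [Finite p] [DecidableEq p] [Fintype q]
    {M : Matrix p q E} (h : LinearIndependent E M.row) : ∃ N : Matrix q p E, M * N = 1 := by
  cases nonempty_fintype p
  classical
  obtain ⟨f, hf⟩ := M.toLinearMapRight'.exists_leftInverse_of_injective
    (LinearMap.ker_eq_bot.2 (Matrix.vecMul_injective_iff.2 h))
  refine ⟨toLinearMapRight'.symm f, toLinearMapRight'.injective ?_⟩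
  rw [Matrix.toLinearMapRight'_mul, LinearEquiv.apply_symm_apply, hf, Matrix.toLinearMapRight'_one]

theorem linearIndependent_row_opTranspose_iff {M : Matrix p q E} :
    LinearIndependent Eᵐᵒᵖ (opTranspose M).row ↔ LinearIndependent Eᵐᵒᵖ M.col := by
  let f : (p → E) ≃ₗ[Eᵐᵒᵖ] (p → Eᵐᵒᵖ) := .piCongrRight fun _ => opLinearEquiv Eᵐᵒᵖ
  exact f.toLinearMap.linearIndependent_iff (v := M.col) f.ker

theorem exists_mul_eq_one_of_linearIndependent_col [Fintype p] [Finite q] [DecidableEq q]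
    {M : Matrix p q E} (h : LinearIndependent Eᵐᵒᵖ M.col) : ∃ N : Matrix q p E, N * M = 1 := by
  obtain ⟨N, hN⟩ :=
    exists_mul_eq_one_of_linearIndependent (linearIndependent_row_opTranspose_iff.2 h)
  refine ⟨opTranspose.symm N, opTranspose.injective ?_⟩
  rw [opTranspose_mul, AddEquiv.apply_symm_apply, hN]
  ext i j
  simp [one_apply, eq_comm, apply_ite op]

end OneSidedInverses

section Compression

variable [Fintype p] [Fintype q] {k l : Type*} {φ : Matrix m n D → Matrix p q E}
  {h : (m → D) → p → E} {g : (n → D) → q → E}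

theorem AdjacencyPreserving.compress [Fintype k] [Fintype l] {U : Matrix p k E}
    {U' : Matrix k p E} {V : Matrix l q E} {V' : Matrix q l E} (hφ : AdjacencyPreserving φ)
    (hUV : ∀ X, φ X = U * (U' * φ X * V') * V) :
    AdjacencyPreserving fun X => U' * φ X * V' := fun A B hAB => by
  obtain ⟨u, w, -, -, e⟩ := hφ A B hAB
  have e' : U' * φ A * V' - U' * φ B * V' = (U' *ᵥ u) ⊠ (w ᵥ* V') := by
    rw [← Matrix.sub_mul, ← Matrix.mul_sub, e, mul_vecMulVec, vecMulVec_mul]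
  change IsRankOne (U' * φ A * V' - U' * φ B * V')
  rw [e']
  refine isRankOne_vecMulVec_of_ne_zero fun h0 => (hφ A B hAB).ne_zero ?_
  rw [hUV A, hUV B, sub_eq_zero.1 (e'.trans h0), sub_self]

theorem RegularAtZero.compress [Fintype k] [Fintype l] {U : Matrix p k E} {U' : Matrix k p E}
    {V : Matrix l q E} {V' : Matrix q l E}
    (H : RegularAtZero φ h g) (hU : ∀ x, x ≠ 0 → U *ᵥ (U' *ᵥ h x) = h x)
    (hV : ∀ y, y ≠ 0 → (g y ᵥ* V') ᵥ* V = g y) :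
    RegularAtZero (fun X => U' * φ X * V') (fun x => U' *ᵥ h x) (fun y => g y ᵥ* V') where
  col_ne_zero x hx h0 := H.col_ne_zero x hx (by rw [← hU x hx, h0, mulVec_zero])
  row_ne_zero y hy h0 := H.row_ne_zero y hy (by rw [← hV y hy, h0, zero_vecMul])
  map_vecMulVec x y hx hy := by
    obtain ⟨c, hc, e⟩ := H.map_vecMulVec x y hx hy
    exact ⟨c, hc, by rw [e, mul_vecMulVec, vecMulVec_mul, smul_vecMul]⟩
  exists_cols := by
    obtain ⟨x₁, x₂, hx₁, hx₂, hx⟩ := H.exists_cols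
    refine ⟨x₁, x₂, hx₁, hx₂, fun ⟨c, hc, e⟩ => hx ⟨c, hc, ?_⟩⟩
    rw [← hU x₁ hx₁, ← hU x₂ hx₂, e, mulVec_smul]
  exists_rows := by
    obtain ⟨y₁, y₂, hy₁, hy₂, hy⟩ := H.exists_rows
    refine ⟨y₁, y₂, hy₁, hy₂, fun ⟨c, hc, e⟩ => hy ⟨c, hc, ?_⟩⟩
    rw [← hV y₁ hy₁, ← hV y₂ hy₂, e, smul_vecMul]

theorem RegularAtZero.mul_map_mul {φ : Matrix (Fin 2) (Fin 2) D → Matrix p q E}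
    {h : (Fin 2 → D) → p → E} {g : (Fin 2 → D) → q → E} {P : Matrix p p E} {Q : Matrix q q E}
    (H : RegularAtZero φ h g) (hφ : AdjacencyPreserving φ) (h0 : φ 0 = 0)
    (hP : ∀ x, x ≠ 0 → P *ᵥ h x = h x) (hQ : ∀ y, y ≠ 0 → g y ᵥ* Q = g y)
    (X : Matrix (Fin 2) (Fin 2) D) : P * φ X * Q = φ X := by
  have hone {x y : Fin 2 → D} (hx : x ≠ 0) : P * φ (x ⊠ y) * Q = φ (x ⊠ y) := by
    rcases eq_or_ne y 0 with rfl | hy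
    · rw [vecMulVec_zero, h0, Matrix.mul_zero, Matrix.zero_mul]
    obtain ⟨c, -, e⟩ := H.map_vecMulVec x y hx hy
    rw [e, mul_vecMulVec, vecMulVec_mul, smul_vecMul, hP x hx, hQ y hy]
  have he (i : Fin 2) : (Pi.single i 1 : Fin 2 → D) ≠ 0 := by simp
  rw [eq_single_vecMulVec_add X]
  rcases eq_or_ne (X 0) 0 with hX₀ | hX₀
  · rw [hX₀, vecMulVec_zero, zero_add]
    exact hone (he 1)
  rcases eq_or_ne (X 1) 0 with hX₁ | hX₁
  · rw [hX₁, vecMulVec_zero, add_zero]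
    exact hone (he 0)
  by_cases hX : RowParallel (X 0) (X 1)
  · obtain ⟨c, -, hc⟩ := hX
    rw [hc, ← smul_op_vecMulVec, ← add_vecMulVec]
    exact hone fun h1 => by simpa using congrFun h1 0
  obtain ⟨a, b, c, d, e⟩ := H.exists_map_add_eq hφ (he 0) (he 1) hX₀ hX₁
    (H.not_colParallel_map hφ (he 0) (he 1) not_colParallel_single)
    (H.not_rowParallel_map hφ hX₀ hX₁ hX)
  simp only [e, Matrix.mul_add, Matrix.add_mul, mul_vecMulVec, vecMulVec_mul, add_vecMul,
    smul_vecMul, hP _ (he _), hQ _ hX₀, hQ _ hX₁]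

end Compression

theorem exists_two_by_two [Finite p] [Finite q] {φ : Matrix (Fin 2) (Fin 2) D → Matrix p q E}
    (hφ : AdjacencyPreserving φ) (h0 : φ 0 = 0) (H : ∃ h g, RegularAtZero φ h g) :
    ∃ (U : Matrix p (Fin 2) E) (V : Matrix (Fin 2) q E)
      (ψ : Matrix (Fin 2) (Fin 2) D → Matrix (Fin 2) (Fin 2) E),
      (∀ X, φ X = U * ψ X * V) ∧ ψ 0 = 0 ∧ AdjacencyPreserving ψ ∧
        ∃ h g, RegularAtZero ψ h g := by
  cases nonempty_fintype p
  cases nonempty_fintype q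
  obtain ⟨h, g, H⟩ := H
  have he (i : Fin 2) : (Pi.single i 1 : Fin 2 → D) ≠ 0 := by simp
  obtain ⟨U', hU'⟩ := exists_mul_eq_one_of_linearIndependent_col
    (M := of fun i j => h (Pi.single j 1) i) (linearIndependent_of_not_parallel
      (fun i => H.col_ne_zero _ (he i))
      (H.not_colParallel_map hφ (he 0) (he 1) not_colParallel_single))
  obtain ⟨V', hV'⟩ := exists_mul_eq_one_of_linearIndependent
    (M := of fun j => g (Pi.single j 1)) (linearIndependent_of_not_parallel
      (fun i => H.row_ne_zero _ (he i))
      (H.not_rowParallel_map hφ (he 0) (he 1) not_rowParallel_single))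
  set U : Matrix p (Fin 2) E := of fun i j => h (Pi.single j 1) i
  set V : Matrix (Fin 2) q E := of fun j => g (Pi.single j 1)
  have hU (x : Fin 2 → D) (hx : x ≠ 0) : U *ᵥ (U' *ᵥ h x) = h x := by
    obtain ⟨s, hs⟩ := H.exists_eq_mulVec hφ hx
    rw [hs, mulVec_mulVec s, hU', one_mulVec]
  have hV (y : Fin 2 → D) (hy : y ≠ 0) : (g y ᵥ* V') ᵥ* V = g y := by
    obtain ⟨t, ht⟩ := H.exists_eq_vecMul hφ hy
    rw [ht, vecMul_vecMul t, hV', vecMul_one]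
  have hUV (X : Matrix (Fin 2) (Fin 2) D) : φ X = U * (U' * φ X * V') * V := by
    have hX := H.mul_map_mul (P := U * U') (Q := V' * V) hφ h0
      (fun x hx => by rw [← mulVec_mulVec, hU x hx]) (fun y hy => by rw [← vecMul_vecMul, hV y hy])
      X
    simpa only [Matrix.mul_assoc] using hX.symm
  exact ⟨U, V, fun X => U' * φ X * V', hUV, by simp [h0], hφ.compress hUV, _, _, H.compress hU hV⟩

/-! ### Row points and the fundamental theorem for two by two matrices -/

section LineParallel

variable {V : Type*} [AddCommGroup V] [Module E V]

variable (E) in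
/-- `R` maps each line of `D²` into a line, and the direction of the image depends only on the
direction `y` of the given line: it is the one of `S y`. -/
def LineParallel (S R : (Fin 2 → D) → V) : Prop :=
  ∀ w y (s : D), y ≠ 0 → s ≠ 0 → Parallel E (S y) (R (w + s • y) - R w)

variable {S R T : (Fin 2 → D) → V}

theorem LineParallel.exists_coordinates (hR : LineParallel E S R) (hR₀ : R 0 = 0)
    (hli : LinearIndependent E ![S (Pi.single 0 1), S (Pi.single 1 1)]) :
    ∃ ρ : Fin 2 → D → E,
      ∀ w, R w = ρ 0 (w 0) • S (Pi.single 0 1) + ρ 1 (w 1) • S (Pi.single 1 1) := by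
  have step (w : Fin 2 → D) (i : Fin 2) (t : D) :
      ∃ c : E, R (w + t • Pi.single i 1) = R w + c • S (Pi.single i 1) := by
    rcases eq_or_ne t 0 with rfl | ht
    · exact ⟨0, by simp⟩
    · obtain ⟨c, -, hc⟩ := hR w (Pi.single i 1) t (by simp) ht
      exact ⟨c, by rw [← hc, add_sub_cancel]⟩
  choose ρ hρ using step 0
  simp only [zero_add, hR₀] at hρ
  refine ⟨ρ, fun w => ?_⟩
  obtain ⟨c, hc⟩ := step (w 0 • Pi.single 0 1) 1 (w 1)
  obtain ⟨c', hc'⟩ := step (w 1 • Pi.single 1 1) 0 (w 0)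
  have hw : w 0 • Pi.single 0 1 + w 1 • Pi.single 1 1 = w := by
    ext i; fin_cases i <;> simp
  rw [hρ, hw] at hc
  rw [hρ, add_comm, hw, add_comm] at hc'
  rw [hc, (hli.eq_of_pair (hc.symm.trans hc')).2]

theorem LineParallel.exists_ringHom_self (hS : LineParallel E S S) (hS₀ : S 0 = 0)
    (hli : LinearIndependent E ![S (Pi.single 0 1), S (Pi.single 1 1)]) :
    ∃ τ : D →+* E, ∀ w, S w = τ (w 0) • S (Pi.single 0 1) + τ (w 1) • S (Pi.single 1 1) := by
  obtain ⟨ρ, hρ⟩ := hS.exists_coordinates hS₀ hli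
  have h0 : ρ 0 1 = 1 ∧ ρ 1 0 = 0 := hli.eq_of_pair <| by
    simpa using (hρ (Pi.single 0 1)).symm
  have h1 : ρ 0 0 = 0 ∧ ρ 1 1 = 1 := hli.eq_of_pair <| by
    simpa using (hρ (Pi.single 1 1)).symm
  have hmul (t a : D) : ρ 1 (t * a) = ρ 0 t * ρ 1 a := by
    rcases eq_or_ne t 0 with rfl | ht
    · simp [h0, h1]
    obtain ⟨c, -, hc⟩ := hS 0 ![1, a] t (fun h => by simpa using congrFun h 0) ht
    rw [zero_add, hS₀, sub_zero, hρ, hρ ![1, a], smul_add, smul_smul, smul_smul] at hc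
    have hcc := hli.eq_of_pair hc
    simp only [Pi.smul_apply, cons_val_zero, cons_val_one, smul_eq_mul, mul_one, h0.1] at hcc
    rw [hcc.2, hcc.1]
  have hρ₁ : ρ 1 = ρ 0 := funext fun t => by simpa [h1.2] using hmul t 1
  have hadd (a t : D) : ρ 0 (a + t) = ρ 0 a + ρ 0 t := by
    rcases eq_or_ne t 0 with rfl | ht
    · simp [h1]
    obtain ⟨c, -, hc⟩ := hS ![a, 0] ![1, 1] t (fun h => by simpa using congrFun h 0) ht
    rw [hρ, hρ ![1, 1], hρ ![a, 0], smul_add, smul_smul, smul_smul, add_sub_add_comm, ← sub_smul,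
      ← sub_smul] at hc
    have hcc := hli.eq_of_pair hc
    simp only [Pi.add_apply, Pi.smul_apply, cons_val_zero, cons_val_one, smul_eq_mul, mul_one,
      zero_add, hρ₁, h0.1, h1.1, sub_zero] at hcc
    rw [hcc.2, ← hcc.1, add_sub_cancel]
  rw [hρ₁] at hρ
  refine ⟨⟨⟨⟨ρ 0, h0.1⟩, fun s t => ?_⟩, h1.1, hadd⟩, hρ⟩
  simpa [hρ₁] using hmul s t

theorem LineParallel.exists_ringHom (hS : LineParallel E S S) (hT : LineParallel E S T)
    (hS₀ : S 0 = 0) (hT₀ : T 0 = 0)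
    (hli : LinearIndependent E ![S (Pi.single 0 1), S (Pi.single 1 1)]) :
    ∃ (τ : D →+* E) (μ : E), μ ≠ 0 ∧
      (∀ w, S w = τ (w 0) • S (Pi.single 0 1) + τ (w 1) • S (Pi.single 1 1)) ∧
      ∀ w, T w = μ • S w := by
  obtain ⟨τ, hτ⟩ := hS.exists_ringHom_self hS₀ hli
  obtain ⟨ρ, hρ⟩ := hT.exists_coordinates hT₀ hli
  have hcoord (w : Fin 2 → D) (hw : w ≠ 0) :
      ∃ c : E, c ≠ 0 ∧ ρ 0 (w 0) = c * τ (w 0) ∧ ρ 1 (w 1) = c * τ (w 1) := by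
    obtain ⟨c, hc, h⟩ := hT 0 w 1 hw one_ne_zero
    rw [one_smul, zero_add, hT₀, sub_zero, hρ, hτ w, smul_add, smul_smul, smul_smul] at h
    exact ⟨c, hc, hli.eq_of_pair h⟩
  obtain ⟨μ, hμ, h0, h1⟩ := hcoord ![1, 1] fun h => by simpa using congrFun h 0
  simp only [cons_val_zero, cons_val_one, map_one, mul_one] at h0 h1
  have hρ₀ (t : D) : ρ 0 t = μ * τ t := by
    obtain ⟨c, -, hc₀, hc₁⟩ := hcoord ![t, 1] fun h => by simpa using congrFun h 1
    simp only [cons_val_zero, cons_val_one, map_one, mul_one, h1] at hc₀ hc₁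
    rw [hc₀, hc₁]
  have hρ₁ (t : D) : ρ 1 t = μ * τ t := by
    obtain ⟨c, -, hc₀, hc₁⟩ := hcoord ![1, t] fun h => by simpa using congrFun h 0
    simp only [cons_val_zero, cons_val_one, map_one, mul_one, h0] at hc₀ hc₁
    rw [hc₁, hc₀]
  refine ⟨τ, μ, hμ, hτ, fun w => ?_⟩
  rw [hρ, hρ₀, hρ₁, hτ w, smul_add, smul_smul, smul_smul]

end LineParallel

theorem exists_dotProduct_eq_one_eq_zero [Fintype n] {l l' : n → D} (hl : l ≠ 0)
    (h : ¬ RowParallel l l') : ∃ x : n → D, l ⬝ᵥ x = 1 ∧ l' ⬝ᵥ x = 0 := by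
  classical
  obtain ⟨f, hf, hf'⟩ := exists_linearMap_eq_one_eq_zero hl h
  have hdot (v : n → D) : v ⬝ᵥ (fun i => f (Pi.single i 1)) = f v := by
    conv_rhs => rw [pi_eq_sum_univ' v, map_sum]
    exact Finset.sum_congr rfl fun i _ => by rw [map_smul, smul_eq_mul]
  exact ⟨fun i => f (Pi.single i 1), (hdot l).trans hf, (hdot l').trans hf'⟩

theorem exists_dotProduct_eq_one [Fintype n] {l : n → D} (hl : l ≠ 0) :
    ∃ x : n → D, l ⬝ᵥ x = 1 := by
  obtain ⟨x, hx, -⟩ := exists_dotProduct_eq_one_eq_zero (l' := 0) hl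
    fun ⟨c, hc, h⟩ => smul_ne_zero hc hl h.symm
  exact ⟨x, hx⟩

theorem exists_ne_zero_dotProduct_eq_zero (u : Fin 2 → E) :
    ∃ v : Fin 2 → E, v ≠ 0 ∧ v ⬝ᵥ u = 0 := by
  by_cases hu : u 0 = 0
  · exact ⟨Pi.single 0 1, by simp, by simp [hu]⟩
  · refine ⟨![-u 1 * (u 0)⁻¹, 1], fun h => by simpa using congrFun h 1, ?_⟩
    simp [dotProduct, Fin.sum_univ_two, mul_assoc, inv_mul_cancel₀ hu]

theorem eq_zero_of_dotProduct_eq_zero {u u' v : Fin 2 → E} (hu : u ≠ 0) (hu' : u' ≠ 0)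
    (huu' : ¬ ColParallel u u') (h : v ⬝ᵥ u = 0) (h' : v ⬝ᵥ u' = 0) : v = 0 := by
  obtain ⟨N, hN⟩ := exists_mul_eq_one_of_linearIndependent_col (M := of fun i j => ![u, u'] j i)
    (linearIndependent_of_not_parallel (v := ![u, u']) (Fin.forall_fin_two.2 ⟨hu, hu'⟩) huu')
  have hv : v ᵥ* (of fun i j => ![u, u'] j i) = 0 := by
    ext j; fin_cases j; exacts [h, h']
  rw [← vecMul_one v, ← mul_eq_one_comm.1 hN, ← vecMul_vecMul, hv, zero_vecMul]

theorem eq_vecMulVec_of_vecMul_eq_zero {l l' x : Fin 2 → D} {X : Matrix (Fin 2) n D}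
    (hl : l ≠ 0) (hl' : l' ≠ 0) (hll' : ¬ RowParallel l l') (hx : l ⬝ᵥ x = 0) (hx' : l' ⬝ᵥ x = 1)
    (hX : l ᵥ* X = 0) : X = x ⊠ (l' ᵥ* X) := by
  ext i j
  obtain ⟨a, b, hab⟩ := exists_smul_add_smul_eq hl hl' hll' (Pi.single i 1)
  have hb : b = x i := by simpa [add_dotProduct, hx, hx'] using congrArg (· ⬝ᵥ x) hab
  have hi := congrFun (congrArg (· ᵥ* X) hab) j
  simp only [add_vecMul, smul_vecMul, hX, smul_zero, zero_add, single_one_vecMul] at hi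
  rw [vecMulVec_apply, ← hb]
  exact hi.symm

section Pencil

/-- The three-dimensional space of all `(v, w) ∈ E² × E²` with `w ∈ v M + E r`. It contains the
graph of every matrix that differs from `M` by a matrix with rows in `E r`. -/
def pencil (M : Matrix (Fin 2) (Fin 2) E) (r : Fin 2 → E) :
    Submodule E ((Fin 2 → E) × (Fin 2 → E)) :=
  LinearMap.range ((LinearMap.id.prod M.vecMulLinear).coprod
    (LinearMap.toSpanSingleton E ((Fin 2 → E) × (Fin 2 → E)) (0, r)))

theorem mem_pencil {M : Matrix (Fin 2) (Fin 2) E} {r : Fin 2 → E}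
    {z : (Fin 2 → E) × (Fin 2 → E)} : z ∈ pencil M r ↔ ∃ s : E, z.2 = z.1 ᵥ* M + s • r := by
  constructor
  · rintro ⟨⟨v, s⟩, rfl⟩
    exact ⟨s, by simp⟩
  · rintro ⟨s, hs⟩
    exact ⟨(z.1, s), Prod.ext (by simp) (by simp [hs])⟩

theorem finrank_pencil_le (M : Matrix (Fin 2) (Fin 2) E) (r : Fin 2 → E) :
    Module.finrank E (pencil M r) ≤ 3 :=
  (LinearMap.finrank_range_le _).trans (by simp)

end Pencil

section RowPoints

variable {φ : Matrix (Fin 2) (Fin 2) D → Matrix (Fin 2) (Fin 2) E}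
  {h g : Matrix (Fin 2) (Fin 2) D → (Fin 2 → D) → Fin 2 → E}

/-- `P a` is a point with nonzero first component which lies on the graphs of all the matrices
`φ A`, where `A` runs through the matrices with `l A = a`. -/
structure IsRowPoint (φ : Matrix (Fin 2) (Fin 2) D → Matrix (Fin 2) (Fin 2) E) (l : Fin 2 → D)
    (P : (Fin 2 → D) → (Fin 2 → E) × (Fin 2 → E)) : Prop where
  fst_ne_zero : ∀ a, (P a).1 ≠ 0
  fst_vecMul : ∀ A, (P (l ᵥ* A)).1 ᵥ* φ A = (P (l ᵥ* A)).2

theorem exists_map_add_vecMulVec_eq (H : ∀ A, RegularAtZero (shift φ A) (h A) (g A))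
    (A : Matrix (Fin 2) (Fin 2) D) {x z : Fin 2 → D} (hx : x ≠ 0) (hz : z ≠ 0) :
    ∃ c : E, c ≠ 0 ∧ ∀ v, v ᵥ* φ (A + x ⊠ z) = v ᵥ* φ A + ((v ⬝ᵥ h A x) * c) • g A z := by
  obtain ⟨c, hc, e⟩ := (H A).map_vecMulVec x z hx hz
  refine ⟨c, hc, fun v => ?_⟩
  rw [sub_eq_iff_eq_add'.1 e, vecMul_add, vecMul_vecMulVec, smul_smul]

theorem exists_isRowPoint (H : ∀ A, RegularAtZero (shift φ A) (h A) (g A)) {l : Fin 2 → D}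
    (hl : l ≠ 0) : ∃ P, IsRowPoint φ l P := by
  obtain ⟨l', hl', hll'⟩ := exists_not_rowParallel l
  obtain ⟨x, hx⟩ := exists_dotProduct_eq_one hl
  obtain ⟨x', hx', hx'₀⟩ := exists_dotProduct_eq_one_eq_zero hl' fun h1 => hll' h1.symm
  have hx'ne : x' ≠ 0 := by rintro rfl; simp at hx'
  choose v hv hvu using fun a => exists_ne_zero_dotProduct_eq_zero (h (x ⊠ a) x')
  refine ⟨fun a => (v a, v a ᵥ* φ (x ⊠ a)), hv, fun A => ?_⟩
  have hA : A = x ⊠ (l ᵥ* A) + x' ⊠ (l' ᵥ* (A - x ⊠ (l ᵥ* A))) := by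
    rw [← eq_vecMulVec_of_vecMul_eq_zero hl hl' hll' hx'₀ hx', add_sub_cancel]
    rw [vecMul_sub, vecMul_vecMulVec, hx, one_smul, sub_self]
  rcases eq_or_ne (l' ᵥ* (A - x ⊠ (l ᵥ* A))) 0 with hz | hz
  · rw [hz, vecMulVec_zero, add_zero] at hA
    rw [← hA]
  · obtain ⟨c, -, e⟩ := exists_map_add_vecMulVec_eq H (x ⊠ (l ᵥ* A)) hx'ne hz
    have hv' := e (v (l ᵥ* A))
    rwa [← hA, hvu, zero_mul, zero_smul, add_zero] at hv'

namespace IsRowPoint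

variable {l l' x : Fin 2 → D} {P P' : (Fin 2 → D) → (Fin 2 → E) × (Fin 2 → E)}

theorem smul (hP : IsRowPoint φ l P) {c : (Fin 2 → D) → E} (hc : ∀ a, c a ≠ 0) :
    IsRowPoint φ l fun a => c a • P a where
  fst_ne_zero a := smul_ne_zero (hc a) (hP.fst_ne_zero a)
  fst_vecMul A := by
    rw [Prod.smul_fst, Prod.smul_snd, smul_vecMul, hP.fst_vecMul]

theorem fst_dotProduct_eq_zero (hP : IsRowPoint φ l P)
    (H : ∀ A, RegularAtZero (shift φ A) (h A) (g A)) (A : Matrix (Fin 2) (Fin 2) D) (hx : x ≠ 0)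
    (hlx : l ⬝ᵥ x = 0) : (P (l ᵥ* A)).1 ⬝ᵥ h A x = 0 := by
  have hy : (Pi.single 0 1 : Fin 2 → D) ≠ 0 := by simp
  obtain ⟨c, hc, e⟩ := exists_map_add_vecMulVec_eq H A hx hy
  have hA := hP.fst_vecMul (A + x ⊠ Pi.single 0 1)
  rw [vecMul_add, vecMul_vecMulVec, hlx, zero_smul, add_zero, e, hP.fst_vecMul, add_eq_left,
    smul_eq_zero_iff_left ((H A).row_ne_zero _ hy)] at hA
  exact (mul_eq_zero_iff_right hc).1 hA

theorem fst_dotProduct_ne_zero (hP : IsRowPoint φ l P) (hφ : AdjacencyPreserving φ)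
    (H : ∀ A, RegularAtZero (shift φ A) (h A) (g A)) (A : Matrix (Fin 2) (Fin 2) D)
    (hlx : l ⬝ᵥ x ≠ 0) : (P (l ᵥ* A)).1 ⬝ᵥ h A x ≠ 0 := by
  intro h0
  have hx : x ≠ 0 := by rintro rfl; simp at hlx
  obtain ⟨l', hl', hll'⟩ := exists_not_rowParallel l
  obtain ⟨x', hx', hx'₀⟩ := exists_dotProduct_eq_one_eq_zero hl' fun h1 => hll' h1.symm
  have hx'ne : x' ≠ 0 := by rintro rfl; simp at hx'
  have hxx' : ¬ ColParallel x x' := by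
    rintro ⟨c, hc, rfl⟩
    rw [dotProduct_smul] at hx'₀
    exact smul_ne_zero hc hlx hx'₀
  exact hP.fst_ne_zero _ <| eq_zero_of_dotProduct_eq_zero ((H A).col_ne_zero x hx)
    ((H A).col_ne_zero x' hx'ne) ((H A).not_colParallel_map (hφ.shift A) hx hx'ne hxx') h0
    (hP.fst_dotProduct_eq_zero H A hx'ne hx'₀)

theorem exists_fst_vecMul_eq (hP : IsRowPoint φ l P) (hφ : AdjacencyPreserving φ)
    (H : ∀ A, RegularAtZero (shift φ A) (h A) (g A)) (hl : l ≠ 0)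
    (A : Matrix (Fin 2) (Fin 2) D) {z : Fin 2 → D} (hz : z ≠ 0) :
    ∃ t : E, t ≠ 0 ∧ (P (l ᵥ* A + z)).1 ᵥ* φ A = (P (l ᵥ* A + z)).2 + t • g A z := by
  obtain ⟨x, hlx⟩ := exists_dotProduct_eq_one hl
  have hx : x ≠ 0 := by rintro rfl; simp at hlx
  set B := A + x ⊠ z with hB
  have hlB : l ᵥ* A + z = l ᵥ* B := by rw [hB, vecMul_add, vecMul_vecMulVec, hlx, one_smul]
  have hA : A = B + x ⊠ (-z) := by rw [hB, vecMulVec_neg, add_neg_cancel_right]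
  obtain ⟨c, -, e⟩ := exists_map_add_vecMulVec_eq H A hx hz
  obtain ⟨c', hc', e'⟩ := exists_map_add_vecMulVec_eq H B hx (neg_ne_zero.2 hz)
  have eA := e (P (l ᵥ* B)).1
  have eB := e' (P (l ᵥ* B)).1
  rw [← hB, hP.fst_vecMul] at eA
  rw [← hA, hP.fst_vecMul] at eB
  have hne : (P (l ᵥ* B)).1 ᵥ* φ A ≠ (P (l ᵥ* B)).2 := by
    rw [eB, Ne, add_eq_left]
    exact smul_ne_zero (mul_ne_zero (hP.fst_dotProduct_ne_zero hφ H B (by simp [hlx])) hc')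
      ((H B).row_ne_zero _ (neg_ne_zero.2 hz))
  refine ⟨-((P (l ᵥ* B)).1 ⬝ᵥ h A x * c), fun h0 => hne ?_, ?_⟩
  · rw [neg_eq_zero.1 h0, zero_smul, add_zero] at eA
    exact eA.symm
  · rw [hlB, neg_smul, ← sub_eq_add_neg, eA, add_sub_cancel_right]

theorem mem_pencil (hP : IsRowPoint φ l P) (hφ : AdjacencyPreserving φ)
    (H : ∀ A, RegularAtZero (shift φ A) (h A) (g A)) (hl : l ≠ 0) (A : Matrix (Fin 2) (Fin 2) D)
    {y : Fin 2 → D} (hy : y ≠ 0) (s : D) : P (l ᵥ* A + s • y) ∈ pencil (φ A) (g A y) := by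
  rw [HuaGeometry.mem_pencil]
  rcases eq_or_ne s 0 with rfl | hs
  · exact ⟨0, by simp [hP.fst_vecMul]⟩
  · obtain ⟨t, -, ht⟩ := hP.exists_fst_vecMul_eq hφ H hl A (smul_ne_zero hs hy)
    obtain ⟨c, -, hc⟩ := (H A).rowParallel_map hy (parallel_smul hs y)
    exact ⟨-(t * c), by rw [ht, hc, neg_smul, mul_smul, add_neg_cancel_right]⟩

theorem notMem_pencil (hP : IsRowPoint φ l P) (hφ : AdjacencyPreserving φ)
    (H : ∀ A, RegularAtZero (shift φ A) (h A) (g A)) (hl : l ≠ 0) (A : Matrix (Fin 2) (Fin 2) D)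
    {y z : Fin 2 → D} (hy : y ≠ 0) (hz : z ≠ 0) (hyz : ¬ RowParallel y z) :
    P (l ᵥ* A + z) ∉ pencil (φ A) (g A y) := by
  rw [HuaGeometry.mem_pencil]
  rintro ⟨s, hs⟩
  obtain ⟨t, ht, e⟩ := hP.exists_fst_vecMul_eq hφ H hl A hz
  have hst : s • g A y = (-t) • g A z := by
    rw [hs, add_assoc, left_eq_add] at e
    rw [neg_smul]
    exact eq_neg_of_add_eq_zero_left e
  have hli := linearIndependent_of_not_parallel (v := ![g A y, g A z])
    (Fin.forall_fin_two.2 ⟨(H A).row_ne_zero y hy, (H A).row_ne_zero z hz⟩)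
    ((H A).not_rowParallel_map (hφ.shift A) hy hz hyz)
  exact ht (neg_eq_zero.1 (hli.eq_zero_of_pair' hst).2)

theorem not_parallel (hP : IsRowPoint φ l P) (hφ : AdjacencyPreserving φ)
    (H : ∀ A, RegularAtZero (shift φ A) (h A) (g A)) (hl : l ≠ 0) (w : Fin 2 → D)
    {y : Fin 2 → D} (hy : y ≠ 0) : ¬ Parallel E (P w) (P (w + y)) := by
  rintro ⟨c, -, hc⟩
  obtain ⟨x, hlx⟩ := exists_dotProduct_eq_one hl
  have hw : l ᵥ* (x ⊠ w) = w := by rw [vecMul_vecMulVec, hlx, one_smul]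
  have hPw := hP.fst_vecMul (x ⊠ w)
  obtain ⟨t, ht, e⟩ := hP.exists_fst_vecMul_eq hφ H hl (x ⊠ w) hy
  rw [hw] at hPw e
  rw [hc, Prod.smul_fst, Prod.smul_snd, smul_vecMul, hPw, left_eq_add] at e
  exact smul_ne_zero ht ((H _).row_ne_zero y hy) e

theorem not_rowParallel_fst (hP : IsRowPoint φ l P) (hP' : IsRowPoint φ l' P')
    (hφ : AdjacencyPreserving φ) (H : ∀ A, RegularAtZero (shift φ A) (h A) (g A)) (hl : l ≠ 0)
    (hl' : l' ≠ 0) (hll' : ¬ RowParallel l l') (a b : Fin 2 → D) :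
    ¬ RowParallel (P a).1 (P' b).1 := by
  obtain ⟨x, hlx, hlx'⟩ := exists_dotProduct_eq_one_eq_zero hl hll'
  obtain ⟨x', hl'x', hl'x⟩ := exists_dotProduct_eq_one_eq_zero hl' fun h1 => hll' h1.symm
  have hx' : x' ≠ 0 := by rintro rfl; simp at hl'x'
  have ha : l ᵥ* (x ⊠ a + x' ⊠ b) = a := by simp [vecMul_add, vecMul_vecMulVec, hlx, hl'x]
  have hb : l' ᵥ* (x ⊠ a + x' ⊠ b) = b := by simp [vecMul_add, vecMul_vecMulVec, hlx', hl'x']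
  have h0 := hP.fst_dotProduct_eq_zero H (x ⊠ a + x' ⊠ b) hx' hl'x
  have h1 := hP'.fst_dotProduct_ne_zero hφ H (x ⊠ a + x' ⊠ b) (x := x') (by simp [hl'x'])
  rw [ha] at h0
  rw [hb] at h1
  rintro ⟨c, -, hc⟩
  rw [hc, smul_dotProduct, h0, smul_zero] at h1
  exact h1 rfl

end IsRowPoint

end RowPoints

section Core

theorem eq_univ_of_lines_subset {K : Set (Fin 2 → D)} (h0 : 0 ∈ K) (he₀ : Pi.single 0 1 ∈ K)
    (he₁ : Pi.single 1 1 ∈ K) (hK : ∀ w y : Fin 2 → D, w ∈ K → w + y ∈ K → ∀ s : D, w + s • y ∈ K)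
    {d : D} (hd₀ : d ≠ 0) (hd₁ : d ≠ 1) (w : Fin 2 → D) : w ∈ K := by
  have line {v w : Fin 2 → D} (hv : v ∈ K) (hw : w ∈ K) (s : D) : v + s • (w - v) ∈ K :=
    hK v (w - v) hv (by rwa [add_sub_cancel]) s
  have horiz (a : D) : ![a, 0] ∈ K := by
    convert line h0 he₀ a using 1; ext i; fin_cases i <;> simp
  have vert (b : D) : ![0, b] ∈ K := by
    convert line h0 he₁ b using 1; ext i; fin_cases i <;> simp
  have diag (a : D) : ![a, 1 - a] ∈ K := by
    convert line he₁ he₀ a using 1; ext i; fin_cases i <;> simp [sub_eq_add_neg]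
  have of_fst_ne_one {a : D} (ha : a ≠ 1) (b : D) : ![a, b] ∈ K := by
    convert line (horiz a) (diag a) (b * (1 - a)⁻¹) using 1
    ext i; fin_cases i <;> simp [sub_ne_zero.2 ha.symm]
  have of_snd_ne_one {b : D} (hb : b ≠ 1) (a : D) : ![a, b] ∈ K := by
    convert line (vert b) (diag (1 - b)) (a * (1 - b)⁻¹) using 1
    ext i; fin_cases i <;> simp [sub_ne_zero.2 hb.symm]
  rw [← List.ofFn_inj.1 (by simp : List.ofFn ![w 0, w 1] = List.ofFn w)]
  rcases ne_or_eq (w 0) 1 with ha | ha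
  · exact of_fst_ne_one ha _
  rcases ne_or_eq (w 1) 1 with hb | hb
  · exact of_snd_ne_one hb _
  rw [ha, hb]
  convert line (vert 1) (of_fst_ne_one hd₁ 1) d⁻¹ using 1
  ext i; fin_cases i <;> simp [hd₀]

variable {φ : Matrix (Fin 2) (Fin 2) D → Matrix (Fin 2) (Fin 2) E}
  {h g : Matrix (Fin 2) (Fin 2) D → (Fin 2 → D) → Fin 2 → E}
  {l l' : Fin 2 → D} {P P' : (Fin 2 → D) → (Fin 2 → E) × (Fin 2 → E)}

theorem exists_dual_vectors (hl : l ≠ 0) (hl' : l' ≠ 0) (hll' : ¬ RowParallel l l') :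
    ∃ x x' : Fin 2 → D, ∀ a b : n → D,
      l ᵥ* (x ⊠ a + x' ⊠ b) = a ∧ l' ᵥ* (x ⊠ a + x' ⊠ b) = b := by
  obtain ⟨x, hlx, hlx'⟩ := exists_dotProduct_eq_one_eq_zero hl hll'
  obtain ⟨x', hl'x', hl'x⟩ := exists_dotProduct_eq_one_eq_zero hl' fun h1 => hll' h1.symm
  exact ⟨x, x', fun a b => by
    simp [vecMul_add, vecMul_vecMulVec, hlx, hlx', hl'x, hl'x']⟩

namespace IsRowPoint

theorem finrank_span_pair (hP : IsRowPoint φ l P) (hφ : AdjacencyPreserving φ)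
    (H : ∀ A, RegularAtZero (shift φ A) (h A) (g A)) (hl : l ≠ 0) (w : Fin 2 → D) {y : Fin 2 → D}
    (hy : y ≠ 0) : Module.finrank E (Submodule.span E {P w, P (w + y)}) = 2 := by
  have hne (a : Fin 2 → D) : P a ≠ 0 := fun h0 => hP.fst_ne_zero a (congrArg Prod.fst h0)
  have := finrank_span_eq_card (linearIndependent_of_not_parallel (v := ![P w, P (w + y)])
    (Fin.forall_fin_two.2 ⟨hne _, hne _⟩) (hP.not_parallel hφ H hl w hy))
  rwa [range_cons_cons_empty, Fintype.card_fin] at this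

theorem mem_span_pair (hP : IsRowPoint φ l P) (hφ : AdjacencyPreserving φ)
    (H : ∀ A, RegularAtZero (shift φ A) (h A) (g A)) (hl : l ≠ 0) (w y : Fin 2 → D) (s : D) :
    P (w + s • y) ∈ Submodule.span E {P w, P (w + y)} := by
  rcases eq_or_ne y 0 with rfl | hy
  · rw [smul_zero, add_zero]
    exact Submodule.subset_span (Set.mem_insert _ _)
  obtain ⟨l', hl', hll'⟩ := exists_not_rowParallel l
  obtain ⟨z, hz, hyz⟩ := exists_not_rowParallel y
  obtain ⟨P', hP'⟩ := exists_isRowPoint H hl'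
  obtain ⟨x, x', hxx'⟩ := exists_dual_vectors (n := Fin 2) hl hl' hll'
  set Q : (Fin 2 → D) → Submodule E ((Fin 2 → E) × (Fin 2 → E)) := fun b =>
    pencil (φ (x ⊠ w + x' ⊠ b)) (g (x ⊠ w + x' ⊠ b) y)
  have hmem (b : Fin 2 → D) (s : D) : P (w + s • y) ∈ Q b := by
    simpa [hxx'] using hP.mem_pencil hφ H hl (x ⊠ w + x' ⊠ b) hy s
  have hle (b : Fin 2 → D) : Submodule.span E {P w, P (w + y)} ≤ Q b :=
    Submodule.span_le.2 <| Set.pair_subset (by simpa using hmem b 0) (by simpa using hmem b 1)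
  have hlt : Q 0 ⊓ Q z < Q 0 := by
    have h0 : P' 0 ∈ Q 0 := by
      have := hP'.mem_pencil hφ H hl' (x ⊠ w + x' ⊠ 0) hy 0
      rwa [(hxx' w 0).2, zero_smul, add_zero] at this
    have hz : P' 0 ∉ Q z := by
      simpa [hxx'] using hP'.notMem_pencil hφ H hl' (x ⊠ w + x' ⊠ z) hy (neg_ne_zero.2 hz)
        fun h1 => hyz (by simpa using h1.trans (parallel_neg _))
    exact inf_lt_left.2 fun h1 => hz (h1 h0)
  have hrank : Module.finrank E (Q 0 ⊓ Q z : Submodule E _) ≤ 2 :=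
    Nat.lt_succ_iff.1 ((Submodule.finrank_lt_finrank_of_lt hlt).trans_le (finrank_pencil_le _ _))
  rw [Submodule.eq_of_le_of_finrank_le (le_inf (hle 0) (hle z))
    (hrank.trans_eq (hP.finrank_span_pair hφ H hl w hy).symm)]
  exact ⟨hmem 0 s, hmem z s⟩

theorem range_subset_span (hP : IsRowPoint φ l P) (hφ : AdjacencyPreserving φ)
    (H : ∀ A, RegularAtZero (shift φ A) (h A) (g A)) (hl : l ≠ 0) {d : D} (hd₀ : d ≠ 0)
    (hd₁ : d ≠ 1) (w : Fin 2 → D) :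
    P w ∈ Submodule.span E (Set.range ![P 0, P (Pi.single 0 1), P (Pi.single 1 1)]) := by
  have hgen (i : Fin 3) := Submodule.subset_span (R := E)
    (Set.mem_range_self (f := ![P 0, P (Pi.single 0 1), P (Pi.single 1 1)]) i)
  refine eq_univ_of_lines_subset (K := P ⁻¹' _) (hgen 0) (hgen 1) (hgen 2)
    (fun w y hw hwy s => ?_) hd₀ hd₁ w
  exact Submodule.span_le.2 (Set.pair_subset hw hwy) (hP.mem_span_pair hφ H hl w y s)

theorem eq_top_of_mem (hP : IsRowPoint φ l P) (hP' : IsRowPoint φ l' P')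
    (hφ : AdjacencyPreserving φ) (H : ∀ A, RegularAtZero (shift φ A) (h A) (g A)) (hl : l ≠ 0)
    (hl' : l' ≠ 0) (hll' : ¬ RowParallel l l') {L : Submodule E ((Fin 2 → E) × (Fin 2 → E))}
    {w : Fin 2 → D} (hw : P w ∈ L) (hL : ∀ b, P' b ∈ L) : L = ⊤ := by
  obtain ⟨x, x', hxx'⟩ := exists_dual_vectors (n := Fin 2) hl hl' hll'
  set A := x ⊠ w + x' ⊠ 0
  have hlA : l ᵥ* A = w := (hxx' w 0).1
  have hl'A : l' ᵥ* A = 0 := (hxx' w 0).2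
  have hgraph (v : Fin 2 → E) : (v, v ᵥ* φ A) ∈ L := by
    obtain ⟨a, b, rfl⟩ := exists_smul_add_smul_eq (hP.fst_ne_zero w) (hP'.fst_ne_zero 0)
      (hP.not_rowParallel_fst hP' hφ H hl hl' hll' w 0) v
    have hPA := hP.fst_vecMul A
    have hPA' := hP'.fst_vecMul A
    rw [hlA] at hPA
    rw [hl'A] at hPA'
    have := L.add_mem (L.smul_mem a hw) (L.smul_mem b (hL 0))
    rwa [← Prod.mk.eta (p := P w), ← Prod.mk.eta (p := P' 0), ← hPA, ← hPA', Prod.smul_mk,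
      Prod.smul_mk, Prod.mk_add_mk, ← smul_vecMul, ← smul_vecMul, ← add_vecMul] at this
  have hrow {z : Fin 2 → D} (hz : z ≠ 0) (c : E) : (0, c • g A z) ∈ L := by
    obtain ⟨t, ht, e⟩ := hP'.exists_fst_vecMul_eq hφ H hl' A hz
    have := L.smul_mem (c * t⁻¹) (L.sub_mem (hgraph (P' (l' ᵥ* A + z)).1) (hL (l' ᵥ* A + z)))
    rwa [e, ← Prod.mk.eta (p := P' _), Prod.mk_sub_mk, sub_self, add_sub_cancel_left,
      Prod.smul_mk, smul_zero, smul_smul, inv_mul_cancel_right₀ ht] at this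
  refine eq_top_iff.2 fun ⟨v, u⟩ _ => ?_
  have h0 : (Pi.single 0 1 : Fin 2 → D) ≠ 0 := by simp
  have h1 : (Pi.single 1 1 : Fin 2 → D) ≠ 0 := by simp
  obtain ⟨a, b, hab⟩ := exists_smul_add_smul_eq ((H A).row_ne_zero _ h0) ((H A).row_ne_zero _ h1)
    ((H A).not_rowParallel_map (hφ.shift A) h0 h1 not_rowParallel_single) (u - v ᵥ* φ A)
  have := L.add_mem (hgraph v) (L.add_mem (hrow h0 a) (hrow h1 b))
  rwa [Prod.mk_add_mk, Prod.mk_add_mk, hab, add_zero, add_zero, add_sub_cancel] at this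

theorem exists_linearMap (hP : IsRowPoint φ l P) (hP' : IsRowPoint φ l' P')
    (hφ : AdjacencyPreserving φ) (H : ∀ A, RegularAtZero (shift φ A) (h A) (g A)) (hl : l ≠ 0)
    (hl' : l' ≠ 0) (hll' : ¬ RowParallel l l') {d : D} (hd₀ : d ≠ 0) (hd₁ : d ≠ 1) :
    ∃ f : (Fin 2 → E) × (Fin 2 → E) →ₗ[E] E, (∀ w, f (P w) ≠ 0) ∧ ∀ w, f (P' w) = 0 := by
  have hlt := (finrank_range_le_card (R := E)
    ![P' 0, P' (Pi.single 0 1), P' (Pi.single 1 1)]).trans_lt (by simp : _ <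
      Module.finrank E ((Fin 2 → E) × (Fin 2 → E)))
  obtain ⟨f, hf, hfP'⟩ := Submodule.exists_le_ker_of_lt_top _
    (Submodule.lt_top_of_finrank_lt_finrank hlt)
  have hfP' (w : Fin 2 → D) : f (P' w) = 0 := hfP' (hP'.range_subset_span hφ H hl' hd₀ hd₁ w)
  refine ⟨f, fun w hw => hf ?_, hfP'⟩
  exact LinearMap.ker_eq_top.1 (hP.eq_top_of_mem hP' hφ H hl hl' hll' hw hfP')

theorem parallel_sub_sub (hP : IsRowPoint φ l P) (hP' : IsRowPoint φ l' P')
    (hφ : AdjacencyPreserving φ) (H : ∀ A, RegularAtZero (shift φ A) (h A) (g A)) (hl : l ≠ 0)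
    (hl' : l' ≠ 0) (hll' : ¬ RowParallel l l') {f f' : (Fin 2 → E) × (Fin 2 → E) →ₗ[E] E}
    (hf : ∀ w, f (P w) = 1) (hf' : ∀ w, f (P' w) = 0) (hf'₀ : ∀ w, f' (P w) = 0)
    (hf'₁ : ∀ w, f' (P' w) = 1) (a b : Fin 2 → D) {y : Fin 2 → D} (hy : y ≠ 0) :
    Parallel E (P (a + y) - P a) (P' (b + y) - P' b) := by
  obtain ⟨x, x', hxx'⟩ := exists_dual_vectors (n := Fin 2) hl hl' hll'
  set A := x ⊠ a + x' ⊠ b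
  have hmem (s : D) : P (a + s • y) ∈ pencil (φ A) (g A y) := by
    simpa only [A, hxx'] using hP.mem_pencil hφ H hl A hy s
  have hmem' (s : D) : P' (b + s • y) ∈ pencil (φ A) (g A y) := by
    simpa only [A, hxx'] using hP'.mem_pencil hφ H hl' A hy s
  have hle : Submodule.span E {P a, P (a + y)} ⊔ Submodule.span E {P' b, P' (b + y)} ≤
      pencil (φ A) (g A y) :=
    sup_le (Submodule.span_le.2 <| Set.pair_subset (by simpa using hmem 0) (by simpa using hmem 1))
      (Submodule.span_le.2 <| Set.pair_subset (by simpa using hmem' 0) (by simpa using hmem' 1))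
  have hrank := Submodule.finrank_sup_add_finrank_inf_eq
    (Submodule.span E {P a, P (a + y)}) (Submodule.span E {P' b, P' (b + y)})
  rw [hP.finrank_span_pair hφ H hl a hy, hP'.finrank_span_pair hφ H hl' b hy] at hrank
  have hpos := (Submodule.finrank_mono hle).trans (finrank_pencil_le _ _)
  obtain ⟨z, hz, hz₀⟩ := Submodule.exists_mem_ne_zero_of_ne_bot
    (Submodule.one_le_finrank_iff.1 (by omega) :
      Submodule.span E {P a, P (a + y)} ⊓ Submodule.span E {P' b, P' (b + y)} ≠ ⊥)
  obtain ⟨⟨α, β, hz₁⟩, α', β', hz₂⟩ := hz.imp Submodule.mem_span_pair.1 Submodule.mem_span_pair.1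
  have hαβ : α + β = 0 := by
    simpa [hf, hf'] using congrArg f (hz₁.trans hz₂.symm)
  have hαβ' : α' + β' = 0 := by
    simpa [hf'₀, hf'₁] using congrArg f' (hz₂.trans hz₁.symm)
  rw [eq_neg_of_add_eq_zero_left hαβ, neg_smul, neg_add_eq_sub, ← smul_sub] at hz₁
  rw [eq_neg_of_add_eq_zero_left hαβ', neg_smul, neg_add_eq_sub, ← smul_sub] at hz₂
  have hβ : β ≠ 0 := left_ne_zero_of_smul (hz₁ ▸ hz₀)
  have hβ' : β' ≠ 0 := left_ne_zero_of_smul (hz₂ ▸ hz₀)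
  exact (parallel_smul hβ _).trans <| (hz₁.trans hz₂.symm) ▸ (parallel_smul hβ' _).symm

theorem parallel_sub_smul (hP : IsRowPoint φ l P) (hφ : AdjacencyPreserving φ)
    (H : ∀ A, RegularAtZero (shift φ A) (h A) (g A)) (hl : l ≠ 0)
    {f : (Fin 2 → E) × (Fin 2 → E) →ₗ[E] E} (hf : ∀ w, f (P w) = 1) (a : Fin 2 → D)
    {y : Fin 2 → D} (hy : y ≠ 0) {s : D} (hs : s ≠ 0) :
    Parallel E (P (a + y) - P a) (P (a + s • y) - P a) := by
  obtain ⟨α, β, hαβ⟩ := Submodule.mem_span_pair.1 (hP.mem_span_pair hφ H hl a y s)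
  have hsum : α + β = 1 := by simpa [hf] using congrArg f hαβ
  have hsub : P (a + s • y) - P a = β • (P (a + y) - P a) := by
    rw [← hαβ, eq_sub_of_add_eq hsum, sub_smul, one_smul, smul_sub]
    abel
  refine ⟨β, ?_, hsub⟩
  rintro rfl
  rw [zero_smul, sub_eq_zero] at hsub
  exact hP.not_parallel hφ H hl a (smul_ne_zero hs hy) (hsub ▸ .refl _)

end IsRowPoint

end Core

section StandardTwo

variable {φ : Matrix (Fin 2) (Fin 2) D → Matrix (Fin 2) (Fin 2) E}
  {h g : Matrix (Fin 2) (Fin 2) D → (Fin 2 → D) → Fin 2 → E}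
  {l l' : Fin 2 → D} {P P' : (Fin 2 → D) → (Fin 2 → E) × (Fin 2 → E)}

theorem exists_eq_mul_map_mul_of_vecMul {φ : Matrix (Fin 2) n D → Matrix (Fin 2) q E}
    {τ : D →+* E} {M : Fin 2 → Fin 2 → E} {Y : Matrix n q E} [Fintype n] (hM : ∀ i, M i ≠ 0)
    (hMM : ¬ RowParallel (M 0) (M 1)) (hφ : ∀ A i, M i ᵥ* φ A = (τ ∘ A i) ᵥ* Y) :
    ∃ X : Matrix (Fin 2) (Fin 2) E, ∀ A, φ A = X * A.map τ * Y := by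
  obtain ⟨X, hX⟩ := exists_mul_eq_one_of_linearIndependent (M := of M)
    (linearIndependent_of_not_parallel hM hMM)
  refine ⟨X, fun A => ?_⟩
  have hA : of M * φ A = A.map τ * Y := funext (hφ A)
  rw [Matrix.mul_assoc, ← hA, ← Matrix.mul_assoc, mul_eq_one_comm.1 hX, Matrix.one_mul]

theorem eq_zero_of_not_rowParallel_add_smul {x₁ x₂ d : Fin 2 → E} (h₁ : ∀ c : E, x₁ + c • d ≠ 0)
    (h₂ : ∀ c : E, x₂ + c • d ≠ 0)
    (h₁₂ : ∀ c c' : E, ¬ RowParallel (x₁ + c • d) (x₂ + c' • d)) : d = 0 := by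
  by_contra hd
  have hx₁ : x₁ ≠ 0 := by simpa using h₁ 0
  have hx₂ : x₂ ≠ 0 := by simpa using h₂ 0
  obtain ⟨a, b, rfl⟩ := exists_smul_add_smul_eq hx₁ hx₂ (by simpa using h₁₂ 0 0) d
  rcases eq_or_ne a 0 with rfl | ha
  · rw [zero_smul, zero_add] at hd
    exact h₂ (-b⁻¹) (by simp [smul_smul, inv_mul_cancel₀ (left_ne_zero_of_smul hd)])
  · have hx : x₁ + (-a⁻¹) • (a • x₁ + b • x₂) = (-a⁻¹ * b) • x₂ := by
      rw [smul_add, smul_smul, smul_smul, neg_mul, inv_mul_cancel₀ ha, neg_smul, one_smul,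
        add_neg_cancel_left]
    have hb : -a⁻¹ * b ≠ 0 := left_ne_zero_of_smul (hx ▸ h₁ (-a⁻¹))
    refine h₁₂ (-a⁻¹) 0 ?_
    rw [hx, zero_smul, add_zero]
    exact (parallel_smul hb x₂).symm

namespace IsRowPoint

theorem linearIndependent_sub (hP : IsRowPoint φ l P) (hφ : AdjacencyPreserving φ)
    (H : ∀ A, RegularAtZero (shift φ A) (h A) (g A)) (hl : l ≠ 0) :
    LinearIndependent E ![P (Pi.single 0 1) - P 0, P (Pi.single 1 1) - P 0] := by
  have he (i : Fin 2) : (Pi.single i 1 : Fin 2 → D) ≠ 0 := by simp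
  have hne (i : Fin 2) : P (Pi.single i 1) - P 0 ≠ 0 := fun h0 =>
    hP.not_parallel hφ H hl 0 (he i) (by rw [zero_add, sub_eq_zero.1 h0]; exact .refl _)
  refine linearIndependent_of_not_parallel (Fin.forall_fin_two.2 ⟨hne 0, hne 1⟩) ?_
  rintro ⟨c, -, hc : P (Pi.single 1 1) - P 0 = c • (P (Pi.single 0 1) - P 0)⟩
  have hmem (s : D) := hP.mem_pencil hφ H hl 0 (he 0) s
  have hnot := hP.notMem_pencil hφ H hl 0 (he 0) (he 1) not_rowParallel_single
  simp only [vecMul_zero, zero_add] at hmem hnot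
  have h0 := hmem 0
  have h1 := hmem 1
  rw [zero_smul] at h0
  rw [one_smul] at h1
  rw [← sub_add_cancel (P (Pi.single 1 1)) (P 0)] at hnot
  exact hnot (Submodule.add_mem _ (hc ▸ Submodule.smul_mem _ c (Submodule.sub_mem _ h1 h0)) h0)

theorem exists_normalized (hφ : AdjacencyPreserving φ)
    (H : ∀ A, RegularAtZero (shift φ A) (h A) (g A)) (hl : l ≠ 0) (hl' : l' ≠ 0)
    (hll' : ¬ RowParallel l l') {d : D} (hd₀ : d ≠ 0) (hd₁ : d ≠ 1) :
    ∃ P P' : (Fin 2 → D) → (Fin 2 → E) × (Fin 2 → E), IsRowPoint φ l P ∧ IsRowPoint φ l' P' ∧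
      ∃ f f' : (Fin 2 → E) × (Fin 2 → E) →ₗ[E] E, (∀ w, f (P w) = 1) ∧ (∀ w, f (P' w) = 0) ∧
        (∀ w, f' (P w) = 0) ∧ ∀ w, f' (P' w) = 1 := by
  obtain ⟨P, hP⟩ := exists_isRowPoint H hl
  obtain ⟨P', hP'⟩ := exists_isRowPoint H hl'
  obtain ⟨f, hfP, hfP'⟩ := hP.exists_linearMap hP' hφ H hl hl' hll' hd₀ hd₁
  obtain ⟨f', hf'P', hf'P⟩ :=
    hP'.exists_linearMap hP hφ H hl' hl (fun h1 => hll' h1.symm) hd₀ hd₁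
  exact ⟨_, _, hP.smul fun w => inv_ne_zero (hfP w), hP'.smul fun w => inv_ne_zero (hf'P' w), f, f',
    by simp [hfP], by simp [hfP'], by simp [hf'P], by simp [hf'P']⟩

theorem exists_ringHom (hφ : AdjacencyPreserving φ)
    (H : ∀ A, RegularAtZero (shift φ A) (h A) (g A)) (hl : l ≠ 0) (hl' : l' ≠ 0)
    (hll' : ¬ RowParallel l l') {d : D} (hd₀ : d ≠ 0) (hd₁ : d ≠ 1) :
    ∃ P P' : (Fin 2 → D) → (Fin 2 → E) × (Fin 2 → E), IsRowPoint φ l P ∧ IsRowPoint φ l' P' ∧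
      ∃ (τ : D →+* E) (μ : E) (S : Fin 2 → (Fin 2 → E) × (Fin 2 → E)), μ ≠ 0 ∧
        (∀ w, P w = P 0 + (τ (w 0) • S 0 + τ (w 1) • S 1)) ∧
        ∀ w, P' w = P' 0 + μ • (τ (w 0) • S 0 + τ (w 1) • S 1) := by
  obtain ⟨P, P', hP, hP', f, f', hf, hf', hf'₀, hf'₁⟩ :=
    exists_normalized hφ H hl hl' hll' hd₀ hd₁
  have hPP' (a b y : Fin 2 → D) (hy : y ≠ 0) :=
    hP.parallel_sub_sub hP' hφ H hl hl' hll' hf hf' hf'₀ hf'₁ a b hy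
  have hS : LineParallel E (fun w => P w - P 0) fun w => P w - P 0 := fun w y s hy hs => by
    have h0 := (hPP' 0 0 y hy).trans (hPP' w 0 y hy).symm
    rw [zero_add] at h0
    rw [sub_sub_sub_cancel_right]
    exact h0.trans (hP.parallel_sub_smul hφ H hl hf w hy hs)
  have hT : LineParallel E (fun w => P w - P 0) fun w => P' w - P' 0 := fun w y s hy hs => by
    have h0 := hPP' 0 w y hy
    rw [zero_add] at h0
    rw [sub_sub_sub_cancel_right]
    exact h0.trans (hP'.parallel_sub_smul hφ H hl' hf'₁ w hy hs)
  obtain ⟨τ, μ, hμ, hτ, hτ'⟩ := hS.exists_ringHom hT (sub_self _) (sub_self _)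
    (hP.linearIndependent_sub hφ H hl)
  refine ⟨P, P', hP, hP', τ, μ, fun i => P (Pi.single i 1) - P 0, hμ, fun w => ?_, fun w => ?_⟩
  · exact (hτ w) ▸ (add_sub_cancel _ _).symm
  · exact (hτ w) ▸ (hτ' w) ▸ (add_sub_cancel _ _).symm

end IsRowPoint

theorem eq_zero_of_forall_not_rowParallel {f f' : (Fin 2 → D) → Fin 2 → E} {τ : D →+* E}
    (hτ : Function.Surjective τ) {μ : E} (hμ : μ ≠ 0) {s : Fin 2 → Fin 2 → E}
    (hf : ∀ w, f w = f 0 + (τ (w 0) • s 0 + τ (w 1) • s 1))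
    (hf' : ∀ w, f' w = f' 0 + μ • (τ (w 0) • s 0 + τ (w 1) • s 1)) (hf₀ : ∀ w, f w ≠ 0)
    (hf'₀ : ∀ w, f' w ≠ 0) (hff' : ∀ w w', ¬ RowParallel (f w) (f' w')) (i : Fin 2) :
    s i = 0 := by
  have hx (c : E) : ∃ w, f w = f 0 + c • s i := by
    obtain ⟨t, rfl⟩ := hτ c
    exact ⟨t • Pi.single i 1, by rw [hf]; fin_cases i <;> simp⟩
  have hx' (c : E) : ∃ w, f' w = f' 0 + c • s i := by
    obtain ⟨t, ht⟩ := hτ (μ⁻¹ * c)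
    obtain rfl : μ * τ t = c := by rw [ht, mul_inv_cancel_left₀ hμ]
    exact ⟨t • Pi.single i 1, by rw [hf']; fin_cases i <;> simp [smul_smul]⟩
  choose w hw using hx
  choose w' hw' using hx'
  exact eq_zero_of_not_rowParallel_add_smul (fun c => hw c ▸ hf₀ _) (fun c => hw' c ▸ hf'₀ _)
    fun c c' => hw c ▸ hw' c' ▸ hff' _ _

theorem exists_eq_mul_map_mul_of_ne_one (hDE : ∀ τ : D →+* E, Function.Surjective τ) {d : D}
    (hd₀ : d ≠ 0) (hd₁ : d ≠ 1) (hφ : AdjacencyPreserving φ) (hφ₀ : φ 0 = 0)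
    (H : ∀ A, RegularAtZero (shift φ A) (h A) (g A)) :
    ∃ (τ : D →+* E) (X Y : Matrix (Fin 2) (Fin 2) E), ∀ A, φ A = X * A.map τ * Y := by
  have he (i : Fin 2) : (Pi.single i 1 : Fin 2 → D) ≠ 0 := by simp
  obtain ⟨P, P', hP, hP', τ, μ, S, hμ, hτ, hτ'⟩ :=
    IsRowPoint.exists_ringHom hφ H (he 0) (he 1) not_rowParallel_single hd₀ hd₁
  have hnot := hP.not_rowParallel_fst hP' hφ H (he 0) (he 1) not_rowParallel_single
  have hS : ∀ i, (S i).1 = 0 :=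
    eq_zero_of_forall_not_rowParallel (s := fun i => (S i).1) (hDE τ) hμ
      (fun w => congrArg Prod.fst (hτ w)) (fun w => congrArg Prod.fst (hτ' w)) hP.fst_ne_zero
      hP'.fst_ne_zero hnot
  have hP₀ := hP.fst_vecMul 0
  have hP'₀ := hP'.fst_vecMul 0
  simp only [hφ₀, vecMul_zero] at hP₀ hP'₀
  refine ⟨τ, ?_⟩
  suffices hrow : ∀ A i, ![(P 0).1, μ⁻¹ • (P' 0).1] i ᵥ* φ A =
      (τ ∘ A i) ᵥ* (of fun i => (S i).2 : Matrix (Fin 2) (Fin 2) E) by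
    obtain ⟨X, hX⟩ := exists_eq_mul_map_mul_of_vecMul (Fin.forall_fin_two.2
      ⟨hP.fst_ne_zero 0, smul_ne_zero (inv_ne_zero hμ) (hP'.fst_ne_zero 0)⟩)
      (fun h1 => hnot 0 0 (h1.trans (parallel_smul (inv_ne_zero hμ) _).symm)) hrow
    exact ⟨X, _, hX⟩
  have hY (w : Fin 2 → D) : (τ ∘ w) ᵥ* (of fun i => (S i).2 : Matrix (Fin 2) (Fin 2) E) =
      τ (w 0) • (S 0).2 + τ (w 1) • (S 1).2 := by
    ext j; simp [vecMul, dotProduct, Fin.sum_univ_two]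
  intro A i
  have hA := hP.fst_vecMul A
  have hA' := hP'.fst_vecMul A
  rw [single_one_vecMul, hτ] at hA
  rw [single_one_vecMul, hτ'] at hA'
  simp only [Prod.fst_add, Prod.snd_add, Prod.smul_fst, Prod.smul_snd, hS, smul_zero, add_zero,
    ← hP₀, ← hP'₀, zero_add] at hA hA'
  fin_cases i
  · exact hA.trans (hY _).symm
  · exact (smul_vecMul _ _ _).trans (by rw [hA', inv_smul_smul₀ hμ]; exact (hY _).symm)

theorem one_add_one_eq_zero_of_eq_zero_or_one (hD : ∀ d : D, d = 0 ∨ d = 1) : (1 : D) + 1 = 0 :=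
  (hD (1 + 1)).resolve_right fun h => one_ne_zero (add_eq_left.1 h)

theorem nonempty_ringHom_of_eq_zero_or_one (hD : ∀ d : D, d = 0 ∨ d = 1)
    (hE : ∀ e : E, e = 0 ∨ e = 1) : Nonempty (D →+* E) := by
  classical
  have hD₂ := one_add_one_eq_zero_of_eq_zero_or_one hD
  have hE₂ := one_add_one_eq_zero_of_eq_zero_or_one hE
  refine ⟨{ toFun d := if d = 0 then 0 else 1, map_one' := by simp, map_zero' := by simp,
            map_mul' := ?_, map_add' := ?_ }⟩ <;>
  · intro a b
    rcases hD a with rfl | rfl <;> rcases hD b with rfl | rfl <;> simp [hD₂, hE₂]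

theorem eq_add_of_eq_zero_or_one (hE : ∀ e : E, e = 0 ∨ e = 1) {x y z : Fin 2 → E} (hx : x ≠ 0)
    (hy : y ≠ 0) (hz : z ≠ 0) (hxy : ¬ RowParallel x y) (hxz : ¬ RowParallel x z)
    (hyz : ¬ RowParallel y z) : z = x + y := by
  obtain ⟨a, b, rfl⟩ := exists_smul_add_smul_eq hx hy hxy z
  rcases hE a with rfl | rfl <;> rcases hE b with rfl | rfl <;> simp [Parallel.refl] at *

theorem exists_rowPoints_of_eq_zero_or_one (hE : ∀ e : E, e = 0 ∨ e = 1)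
    (hφ : AdjacencyPreserving φ) (H : ∀ A, RegularAtZero (shift φ A) (h A) (g A)) :
    ∃ (M : Fin 2 → Fin 2 → E) (W W' W'' : (Fin 2 → D) → Fin 2 → E), (∀ i, M i ≠ 0) ∧
      ¬ RowParallel (M 0) (M 1) ∧ (∀ A, M 0 ᵥ* φ A = W (A 0)) ∧ (∀ A, M 1 ᵥ* φ A = W' (A 1)) ∧
      ∀ A, (M 0 + M 1) ᵥ* φ A = W'' (A 0 + A 1) := by
  have he (i : Fin 2) : (Pi.single i 1 : Fin 2 → D) ≠ 0 := by simp
  have h01 : (Pi.single 0 1 : Fin 2 → D) + Pi.single 1 1 ≠ 0 := fun h0 => by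
    simpa using congrFun h0 0
  have hn01 : ¬ RowParallel (Pi.single 0 1 : Fin 2 → D) (Pi.single 0 1 + Pi.single 1 1) := by
    rintro ⟨c, -, hc⟩; simpa using congrFun hc 1
  have hn11 : ¬ RowParallel (Pi.single 1 1 : Fin 2 → D) (Pi.single 0 1 + Pi.single 1 1) := by
    rintro ⟨c, -, hc⟩; simpa using congrFun hc 0
  obtain ⟨P, hP⟩ := exists_isRowPoint H (he 0)
  obtain ⟨P', hP'⟩ := exists_isRowPoint H (he 1)
  obtain ⟨P'', hP''⟩ := exists_isRowPoint H h01
  have hnot := hP.not_rowParallel_fst hP' hφ H (he 0) (he 1) not_rowParallel_single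
  have hsum (a b c : Fin 2 → D) : (P'' c).1 = (P a).1 + (P' b).1 :=
    eq_add_of_eq_zero_or_one hE (hP.fst_ne_zero a) (hP'.fst_ne_zero b) (hP''.fst_ne_zero c)
      (hnot a b)
      (hP.not_rowParallel_fst hP'' hφ H (he 0) h01 hn01 a c)
      (hP'.not_rowParallel_fst hP'' hφ H (he 1) h01 hn11 b c)
  have hconst (a : Fin 2 → D) : (P a).1 = (P 0).1 :=
    add_right_cancel ((hsum a 0 0).symm.trans (hsum 0 0 0))
  have hconst' (b : Fin 2 → D) : (P' b).1 = (P' 0).1 :=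
    add_left_cancel ((hsum 0 b 0).symm.trans (hsum 0 0 0))
  refine ⟨![(P 0).1, (P' 0).1], fun w => (P w).2, fun w => (P' w).2, fun w => (P'' w).2,
    Fin.forall_fin_two.2 ⟨hP.fst_ne_zero 0, hP'.fst_ne_zero 0⟩, hnot 0 0, fun A => ?_, fun A => ?_,
    fun A => ?_⟩
  · have := hP.fst_vecMul A
    rwa [hconst, single_one_vecMul] at this
  · have := hP'.fst_vecMul A
    rwa [hconst', single_one_vecMul] at this
  · have := hP''.fst_vecMul A
    rwa [hsum 0 0, add_vecMul A, single_one_vecMul, single_one_vecMul] at this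

theorem exists_eq_mul_map_mul_of_eq_zero_or_one (hD : ∀ d : D, d = 0 ∨ d = 1)
    (hE : ∀ e : E, e = 0 ∨ e = 1) (hφ : AdjacencyPreserving φ) (hφ₀ : φ 0 = 0)
    (H : ∀ A, RegularAtZero (shift φ A) (h A) (g A)) :
    ∃ (τ : D →+* E) (X Y : Matrix (Fin 2) (Fin 2) E), ∀ A, φ A = X * A.map τ * Y := by
  obtain ⟨M, W, W', W'', hM, hMM, hW, hW', hW''⟩ := exists_rowPoints_of_eq_zero_or_one hE hφ H
  have hsum (a b : Fin 2 → D) : W a + W' b = W'' (a + b) := by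
    have h0 := hW'' (of ![a, b])
    rwa [add_vecMul, hW, hW'] at h0
  have hW₀ : W 0 = 0 := (hW 0).symm.trans (by rw [hφ₀, vecMul_zero])
  have hW'₀ : W' 0 = 0 := (hW' 0).symm.trans (by rw [hφ₀, vecMul_zero])
  have hWW'' (a : Fin 2 → D) : W'' a = W a := by simpa [hW'₀] using (hsum a 0).symm
  have hWW' (a : Fin 2 → D) : W' a = W a := by simpa [hW₀, hWW''] using hsum 0 a
  have hadd (a b : Fin 2 → D) : W (a + b) = W a + W b := by rw [← hWW'', ← hsum, hWW']
  obtain ⟨τ⟩ := nonempty_ringHom_of_eq_zero_or_one hD hE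
  have hsmul (d : D) (w : Fin 2 → D) : W (d • w) = τ d • W w := by
    rcases hD d with rfl | rfl <;> simp [hW₀]
  have hY (w : Fin 2 → D) :
      (τ ∘ w) ᵥ* (of fun i => W (Pi.single i 1) : Matrix (Fin 2) (Fin 2) E) = W w := by
    have hw : w = w 0 • Pi.single 0 1 + w 1 • Pi.single 1 1 := by
      ext i; fin_cases i <;> simp
    conv_rhs => rw [hw, hadd, hsmul, hsmul]
    ext j; simp [vecMul, dotProduct, Fin.sum_univ_two]
  obtain ⟨X, hX⟩ := exists_eq_mul_map_mul_of_vecMul (φ := φ) hM hMM fun A i => by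
    rw [hY]
    fin_cases i
    exacts [hW A, (hW' A).trans (hWW' _)]
  exact ⟨τ, X, _, hX⟩

end StandardTwo

theorem exists_eq_mul_map_mul_two [Finite p] [Finite q]
    {φ : Matrix (Fin 2) (Fin 2) D → Matrix p q E}
    (hDE : ∀ τ : D →+* E, Function.Surjective τ)
    (hD : (∀ d : D, d = 0 ∨ d = 1) → ∀ e : E, e = 0 ∨ e = 1) (hφ : AdjacencyPreserving φ)
    (hφ₀ : φ 0 = 0) (H : ∃ h g, RegularAtZero φ h g) :
    ∃ (τ : D →+* E) (U : Matrix p (Fin 2) E) (V : Matrix (Fin 2) q E),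
      ∀ A, φ A = U * A.map τ * V := by
  obtain ⟨U, V, ψ, hφψ, hψ₀, hψ, Hψ⟩ := exists_two_by_two hφ hφ₀ H
  have Hψ (A : Matrix (Fin 2) (Fin 2) D) : ∃ h g, RegularAtZero (shift ψ A) h g :=
    exists_regularAtZero_shift_two hψ 0 A (by rwa [shift_at_zero hψ₀])
  choose h g Hψ using Hψ
  obtain ⟨τ, X, Y, hXY⟩ : ∃ (τ : D →+* E) (X Y : Matrix (Fin 2) (Fin 2) E),
      ∀ A, ψ A = X * A.map τ * Y := by
    by_cases hD₂ : ∀ d : D, d = 0 ∨ d = 1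
    · exact exists_eq_mul_map_mul_of_eq_zero_or_one hD₂ (hD hD₂) hψ hψ₀ Hψ
    · push Not at hD₂
      obtain ⟨d, hd₀, hd₁⟩ := hD₂
      exact exists_eq_mul_map_mul_of_ne_one hDE hd₀ hd₁ hψ hψ₀ Hψ
  exact ⟨τ, U * X, Y * V, fun A => by rw [hφψ, hXY]; simp only [Matrix.mul_assoc]⟩

/-! ### Restriction to two-dimensional blocks -/

/-- The assumption on a pair of division rings under which regular maps are standard: every
homomorphism from the first one to the second one is onto, and the second one has two elements if
the first one has. -/
structure OntoHoms (D E : Type*) [DivisionRing D] [DivisionRing E] : Prop where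
  surjective : ∀ τ : D →+* E, Function.Surjective τ
  binary : (∀ d : D, d = 0 ∨ d = 1) → ∀ e : E, e = 0 ∨ e = 1

theorem OntoHoms.op (hDE : OntoHoms D E) : OntoHoms Dᵐᵒᵖ Eᵐᵒᵖ where
  surjective τ e := by
    obtain ⟨d, hd⟩ := hDE.surjective (RingHom.unop τ) (unop e)
    exact ⟨MulOpposite.op d, congrArg MulOpposite.op hd⟩
  binary hD e :=
    (hDE.binary (fun d => (hD (MulOpposite.op d)).imp (congrArg unop) (congrArg unop))
      (unop e)).imp (congrArg MulOpposite.op) (congrArg MulOpposite.op)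

theorem not_parallel_of_linearIndependent {R V : Type*} [DivisionRing R] [AddCommGroup V]
    [Module R V] {v : Fin 2 → V} (hv : LinearIndependent R v) : ¬ Parallel R (v 0) (v 1) := by
  rintro ⟨c, -, hc⟩
  have := Fintype.linearIndependent_iff.1 hv ![-c, 1] (by simp [Fin.sum_univ_two, hc]) 1
  simp at this

theorem linearIndependent_row_iff [Fintype m] {Q : Matrix m n D} :
    LinearIndependent D Q.row ↔ ∀ t, t ≠ 0 → t ᵥ* Q ≠ 0 := by
  rw [← Matrix.vecMul_injective_iff, ← coe_vecMulLinear, injective_iff_map_eq_zero]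
  exact forall_congr' fun t => not_imp_not.symm

theorem linearIndependent_col_iff [Fintype n] {P : Matrix m n D} :
    LinearIndependent Dᵐᵒᵖ P.col ↔ ∀ s, s ≠ 0 → P *ᵥ s ≠ 0 := by
  rw [Fintype.linearIndependent_iff,
    (Equiv.piCongrRight fun _ : n => opEquiv).symm.forall_congr_left]
  refine forall_congr' fun s => ?_
  rw [not_imp_not, mulVec_eq_sum, funext_iff (f := s)]
  simp [Matrix.col]

theorem mul_vecMulVec_mul [Fintype m] [Fintype n] (P : Matrix p m D) (x : m → D) (y : n → D)
    (Q : Matrix n q D) : P * (x ⊠ y) * Q = (P *ᵥ x) ⊠ (y ᵥ* Q) := by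
  rw [mul_vecMulVec, vecMulVec_mul]

theorem map_ringHom_vecMulVec (τ : D →+* E) (x : m → D) (y : n → D) :
    (x ⊠ y).map τ = (τ ∘ x) ⊠ (τ ∘ y) := by
  ext i j; simp [vecMulVec_apply]

theorem vec_two_vecMul (a b : D) (y₁ y₂ : n → D) : ![a, b] ᵥ* of ![y₁, y₂] = a • y₁ + b • y₂ := by
  simp

section Comp

variable {k l : Type*} [Fintype k] [Fintype l] {φ : Matrix m n D → Matrix p q E}
  {h : (m → D) → p → E} {g : (n → D) → q → E} {P : Matrix m k D} {Q : Matrix l n D}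

theorem AdjacencyPreserving.comp (hφ : AdjacencyPreserving φ)
    (hP : LinearIndependent Dᵐᵒᵖ P.col) (hQ : LinearIndependent D Q.row) :
    AdjacencyPreserving fun B : Matrix k l D => φ (P * B * Q) := by
  rintro A B ⟨x, y, hx, hy, e⟩
  refine hφ.isRankOne_sub (linearIndependent_col_iff.1 hP x hx)
    (linearIndependent_row_iff.1 hQ y hy) ?_
  rw [← mul_vecMulVec_mul, ← e, Matrix.mul_sub, Matrix.sub_mul]

theorem RegularAtZero.comp (H : RegularAtZero φ h g)
    (hP : LinearIndependent Dᵐᵒᵖ P.col) (hQ : LinearIndependent D Q.row) {i i' : k} {j j' : l}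
    (hi : ¬ ColParallel (h (P.col i)) (h (P.col i')))
    (hj : ¬ RowParallel (g (Q.row j)) (g (Q.row j'))) :
    RegularAtZero (fun B => φ (P * B * Q)) (fun s => h (P *ᵥ s)) (fun t => g (t ᵥ* Q)) where
  col_ne_zero _ hs := H.col_ne_zero _ (linearIndependent_col_iff.1 hP _ hs)
  row_ne_zero _ ht := H.row_ne_zero _ (linearIndependent_row_iff.1 hQ _ ht)
  map_vecMulVec s t hs ht := by
    simpa only [mul_vecMulVec_mul] using
      H.map_vecMulVec _ _ (linearIndependent_col_iff.1 hP _ hs)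
        (linearIndependent_row_iff.1 hQ _ ht)
  exists_cols := by
    classical
    exact ⟨Pi.single i 1, Pi.single i' 1, by simp, by simp, by simpa only [mulVec_single_one]⟩
  exists_rows := by
    classical
    exact ⟨Pi.single j 1, Pi.single j' 1, by simp, by simp, by simpa only [single_one_vecMul]⟩

end Comp

namespace RegularAtZero

section

variable {φ : Matrix m n D → Matrix p q E} {h : (m → D) → p → E} {g : (n → D) → q → E}

theorem exists_not_rowParallel (H : RegularAtZero φ h g) (y : n → D) :
    ∃ z, z ≠ 0 ∧ ¬ RowParallel (g y) (g z) := by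
  obtain ⟨y₁, y₂, hy₁, hy₂, hy⟩ := H.exists_rows
  by_cases h1 : RowParallel (g y) (g y₁)
  · exact ⟨y₂, hy₂, fun h2 => hy (h1.symm.trans h2)⟩
  · exact ⟨y₁, hy₁, h1⟩

theorem rowParallel_map_add_smul (H : RegularAtZero φ h g) (hφ : AdjacencyPreserving φ)
    {y z : n → D} (hy : y ≠ 0) (hz : z ≠ 0) (hp : RowParallel (g y) (g z)) {r : D}
    (hyz : y + r • z ≠ 0) : RowParallel (g y) (g (y + r • z)) := by
  rcases eq_or_ne r 0 with rfl | hr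
  · simpa using Parallel.refl (g y)
  · exact H.rowParallel_map_add hφ hy (smul_ne_zero hr hz) hyz
      (hp.trans (H.rowParallel_map hz (parallel_smul hr z)))

variable [Finite p] [Finite q]

theorem exists_comp_eq_mul_map_mul (H : RegularAtZero φ h g) (hφ : AdjacencyPreserving φ)
    (h0 : φ 0 = 0) (hDE : OntoHoms D E) {P : Matrix m (Fin 2) D} {Q : Matrix (Fin 2) n D}
    (hP : LinearIndependent Dᵐᵒᵖ P.col) (hQ : LinearIndependent D Q.row)
    (hPh : ¬ ColParallel (h (P.col 0)) (h (P.col 1)))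
    (hQg : ¬ RowParallel (g (Q.row 0)) (g (Q.row 1))) :
    ∃ (τ : D →+* E) (U : Matrix p (Fin 2) E) (V : Matrix (Fin 2) q E),
      ∀ B : Matrix (Fin 2) (Fin 2) D, φ (P * B * Q) = U * B.map τ * V :=
  exists_eq_mul_map_mul_two hDE.surjective hDE.binary (hφ.comp hP hQ) (by simpa using h0)
    ⟨_, _, H.comp hP hQ hPh hQg⟩

theorem exists_ringHom_row (H : RegularAtZero φ h g) (hφ : AdjacencyPreserving φ)
    (h0 : φ 0 = 0) (hDE : OntoHoms D E) {y₁ y₂ : n → D} (hy₁ : y₁ ≠ 0) (hy₂ : y₂ ≠ 0)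
    (hy : ¬ RowParallel (g y₁) (g y₂)) :
    ∃ (τ : D →+* E) (v₁ v₂ : q → E), ∀ a b, a • y₁ + b • y₂ ≠ 0 →
      RowParallel (g (a • y₁ + b • y₂)) (τ a • v₁ + τ b • v₂) := by
  obtain ⟨x₁, x₂, hx₁, hx₂, hx⟩ := H.exists_cols
  obtain ⟨τ, U, V, e⟩ := H.exists_comp_eq_mul_map_mul (P := (of ![x₁, x₂])ᵀ) (Q := of ![y₁, y₂])
    hφ h0 hDE
    (linearIndependent_of_not_parallel (v := ![x₁, x₂]) (Fin.forall_fin_two.2 ⟨hx₁, hx₂⟩)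
      (mt (H.colParallel_map hx₁) hx))
    (linearIndependent_of_not_parallel (v := ![y₁, y₂]) (Fin.forall_fin_two.2 ⟨hy₁, hy₂⟩)
      (mt (H.rowParallel_map hy₁) hy)) hx hy
  refine ⟨τ, V 0, V 1, fun a b hab => ?_⟩
  have hblock := e (Pi.single 0 1 ⊠ ![a, b])
  obtain ⟨c, hc, hmap⟩ := H.map_vecMulVec x₁ _ hx₁ hab
  have hτ : (τ ∘ ![a, b]) ᵥ* V = τ a • V 0 + τ b • V 1 := by
    ext j; simp [vecMul, dotProduct, Fin.sum_univ_two]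
  have hcol : (of ![x₁, x₂])ᵀ *ᵥ Pi.single 0 1 = x₁ := mulVec_single_one _ _
  rw [map_ringHom_vecMulVec, mul_vecMulVec_mul, mul_vecMulVec_mul, vec_two_vecMul, hcol, hmap,
    hτ] at hblock
  exact (parallel_smul_left_iff hc).1 (colParallel_and_rowParallel_of_vecMulVec_eq
    (H.col_ne_zero _ hx₁) (smul_ne_zero hc (H.row_ne_zero _ hab)) hblock).2

theorem exists_rowParallel_of_mem_span (H : RegularAtZero φ h g) (hφ : AdjacencyPreserving φ)
    (h0 : φ 0 = 0) (hDE : OntoHoms D E) {y₁ y₂ : n → D} (hy₁ : y₁ ≠ 0) (hy₂ : y₂ ≠ 0)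
    (hy : ¬ RowParallel (g y₁) (g y₂)) {w : q → E} (hw : w ≠ 0)
    (hspan : w ∈ Submodule.span E {g y₁, g y₂}) :
    ∃ a b : D, a • y₁ + b • y₂ ≠ 0 ∧ RowParallel (g (a • y₁ + b • y₂)) w := by
  obtain ⟨τ, v₁, v₂, hτ⟩ := H.exists_ringHom_row hφ h0 hDE hy₁ hy₂ hy
  obtain ⟨α, β, rfl⟩ := Submodule.mem_span_pair.1 hspan
  obtain ⟨c₁, -, hv₁⟩ : RowParallel v₁ (g y₁) := by
    simpa using (hτ 1 0 (by simpa using hy₁)).symm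
  obtain ⟨c₂, -, hv₂⟩ : RowParallel v₂ (g y₂) := by
    simpa using (hτ 0 1 (by simpa using hy₂)).symm
  obtain ⟨a, ha⟩ := hDE.surjective τ (α * c₁)
  obtain ⟨b, hb⟩ := hDE.surjective τ (β * c₂)
  have hab : α • g y₁ + β • g y₂ = τ a • v₁ + τ b • v₂ := by
    rw [ha, hb, hv₁, hv₂, mul_smul, mul_smul]
  have hne : a • y₁ + b • y₂ ≠ 0 := fun h1 => hw <| by
    obtain ⟨rfl, rfl⟩ := LinearIndependent.pair_iff.1 (linearIndependent_of_not_parallel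
      (v := ![y₁, y₂]) (Fin.forall_fin_two.2 ⟨hy₁, hy₂⟩) (mt (H.rowParallel_map hy₁) hy)) a b h1
    simp [hab]
  exact ⟨a, b, hne, hab ▸ hτ a b hne⟩

/-- If `g y₁` and `g y₂` were parallel, then for `g z` not parallel to them, `g (z + y₁)` would be
parallel to some `g (a • z + b • y₂)`. The fibres of `g` are closed under combinations, so that
of `z + y₁` would contain a combination of `y₁` and `y₂`, which lies in the fibre of `y₁`. -/
theorem not_rowParallel_map_of_not_rowParallel (H : RegularAtZero φ h g)
    (hφ : AdjacencyPreserving φ) (h0 : φ 0 = 0) (hDE : OntoHoms D E) {y₁ y₂ : n → D}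
    (hy₁ : y₁ ≠ 0) (hy₂ : y₂ ≠ 0) (hy : ¬ RowParallel y₁ y₂) : ¬ RowParallel (g y₁) (g y₂) := by
  intro hp
  obtain ⟨z, hz, hy₁z⟩ := H.exists_not_rowParallel y₁
  have hy₁y₁z : ¬ RowParallel (g y₁) (g (y₁ + z)) := H.not_rowParallel_map_add hφ hy₁ hz hy₁z
  have hne : y₁ + z ≠ 0 := H.row_add_ne_zero hy₁ hy₁z
  obtain ⟨c, -, hgy₂⟩ := hp.symm
  have hmem : g (y₁ + z) ∈ Submodule.span E {g y₂, g z} := by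
    have hsub : Submodule.span E {g y₁, g z} ≤ Submodule.span E {g y₂, g z} := by
      rw [Submodule.span_le, hgy₂]
      rintro - (rfl | rfl)
      · exact Submodule.smul_mem _ c (Submodule.subset_span (by simp))
      · exact Submodule.subset_span (by simp)
    exact hsub (H.row_add_mem_span hφ hy₁ hz hy₁z)
  obtain ⟨b, a, hab, hpar⟩ := H.exists_rowParallel_of_mem_span hφ h0 hDE hy₂ hz
    (fun h1 => hy₁z (hp.trans h1)) (H.row_ne_zero _ hne) hmem
  have ha : a ≠ 0 := by
    rintro rfl
    rw [zero_smul, add_zero] at hab hpar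
    exact hy₁y₁z
      (hp.trans ((H.rowParallel_map hy₂ (parallel_smul (left_ne_zero_of_smul hab) y₂)).trans hpar))
  have hcomb : y₁ + z + (-a⁻¹) • (b • y₂ + a • z) = y₁ + (-a⁻¹ * b) • y₂ := by
    rw [smul_add, smul_smul, smul_smul, neg_mul a⁻¹ a, inv_mul_cancel₀ ha, neg_smul, one_smul]
    abel
  have hcomb0 : y₁ + (-a⁻¹ * b) • y₂ ≠ 0 := by
    have hli := LinearIndependent.pair_iff.1 (linearIndependent_of_not_parallel
      (v := ![y₁, y₂]) (Fin.forall_fin_two.2 ⟨hy₁, hy₂⟩) hy)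
    exact fun h1 => one_ne_zero (hli 1 _ (by rwa [one_smul])).1
  refine hy₁y₁z ((H.rowParallel_map_add_smul hφ hy₁ hy₂ hp hcomb0).trans ?_)
  rw [← hcomb] at hcomb0 ⊢
  exact (H.rowParallel_map_add_smul hφ hne hab hpar.symm hcomb0).symm

theorem not_colParallel_map_of_not_colParallel (H : RegularAtZero φ h g)
    (hφ : AdjacencyPreserving φ) (h0 : φ 0 = 0) (hDE : OntoHoms D E) {x₁ x₂ : m → D}
    (hx₁ : x₁ ≠ 0) (hx₂ : x₂ ≠ 0) (hx : ¬ ColParallel x₁ x₂) : ¬ ColParallel (h x₁) (h x₂) :=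
  fun hp => H.dual.not_rowParallel_map_of_not_rowParallel hφ.dual
    (by simp [HuaGeometry.dual, h0]) hDE.op (op_comp_ne_zero_iff.2 hx₁)
    (op_comp_ne_zero_iff.2 hx₂) (mt rowParallel_op_iff.1 hx) (rowParallel_op_iff.2 hp)

theorem exists_comp_eq_mul_map_mul_of_linearIndependent (H : RegularAtZero φ h g)
    (hφ : AdjacencyPreserving φ) (h0 : φ 0 = 0) (hDE : OntoHoms D E) {P : Matrix m (Fin 2) D}
    {Q : Matrix (Fin 2) n D} (hP : LinearIndependent Dᵐᵒᵖ P.col)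
    (hQ : LinearIndependent D Q.row) :
    ∃ (τ : D →+* E) (U : Matrix p (Fin 2) E) (V : Matrix (Fin 2) q E),
      ∀ B : Matrix (Fin 2) (Fin 2) D, φ (P * B * Q) = U * B.map τ * V := by
  refine H.exists_comp_eq_mul_map_mul hφ h0 hDE hP hQ
    (H.not_colParallel_map_of_not_colParallel hφ h0 hDE (hP.ne_zero 0) (hP.ne_zero 1) ?_)
    (H.not_rowParallel_map_of_not_rowParallel hφ h0 hDE (hQ.ne_zero 0) (hQ.ne_zero 1) ?_)
  · exact not_parallel_of_linearIndependent hP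
  · exact not_parallel_of_linearIndependent hQ

end

end RegularAtZero

/-! ### Regular maps are standard -/

theorem exists_linearIndependent_pair_mem_span {R V : Type*} [DivisionRing R] [AddCommGroup V]
    [Module R V] {v₀ z : V} (hv₀ : v₀ ≠ 0) (hz : z ≠ 0) (h : ¬ Parallel R v₀ z) (w : V) :
    ∃ v₁, LinearIndependent R ![v₀, v₁] ∧ w ∈ Submodule.span R {v₀, v₁} := by
  by_cases hw : w ∈ Submodule.span R {v₀}
  · exact ⟨z, linearIndependent_of_not_parallel (v := ![v₀, z])
      (Fin.forall_fin_two.2 ⟨hv₀, hz⟩) h, Submodule.span_mono (by simp) hw⟩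
  · refine ⟨w, (LinearIndependent.pair_iff' hv₀).2 fun a ha => hw ?_, ?_⟩
    · exact Submodule.mem_span_singleton.2 ⟨a, ha⟩
    · exact Submodule.subset_span (by simp)

theorem exists_matrix_rows {y : Fin 2 → n → D} {z : n → D} (hy : y 0 ≠ 0) (hz : z ≠ 0)
    (h : ¬ RowParallel (y 0) z) :
    ∃ Q : Matrix (Fin 2) n D, LinearIndependent D Q.row ∧ ∀ i, ∃ t, t ᵥ* Q = y i := by
  obtain ⟨y', hli, hspan⟩ := exists_linearIndependent_pair_mem_span hy hz h (y 1)
  obtain ⟨a, b, hab⟩ := Submodule.mem_span_pair.1 hspan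
  refine ⟨of ![y 0, y'], hli, Fin.forall_fin_two.2 ⟨⟨![1, 0], ?_⟩, ![a, b], ?_⟩⟩
  · rw [vec_two_vecMul, one_smul, zero_smul, add_zero]
  · rw [vec_two_vecMul, hab]

theorem exists_matrix_cols {x : Fin 2 → m → D} {z : m → D} (hx : x 0 ≠ 0) (hz : z ≠ 0)
    (h : ¬ ColParallel (x 0) z) :
    ∃ P : Matrix m (Fin 2) D, LinearIndependent Dᵐᵒᵖ P.col ∧ ∀ i, ∃ s, P *ᵥ s = x i := by
  obtain ⟨x', hli, hspan⟩ := exists_linearIndependent_pair_mem_span hx hz h (x 1)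
  obtain ⟨a, b, hab⟩ := Submodule.mem_span_pair.1 hspan
  refine ⟨(of ![x 0, x'])ᵀ, hli, Fin.forall_fin_two.2 ⟨⟨![1, 0], ?_⟩, ![unop a, unop b], ?_⟩⟩
  · rw [mulVec_eq_sum, Fin.sum_univ_two]
    change (1 : Dᵐᵒᵖ) • x 0 + (0 : Dᵐᵒᵖ) • x' = x 0
    rw [one_smul, zero_smul, add_zero]
  · rw [mulVec_eq_sum, Fin.sum_univ_two]
    exact hab

theorem vecMulVec_right_injective {u : p → E} (hu : u ≠ 0) :
    Function.Injective fun v : q → E => u ⊠ v := fun v v' h => by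
  obtain ⟨i, hi⟩ := Function.ne_iff.1 hu
  exact funext fun j => mul_left_cancel₀ hi (congrFun (congrFun h i) j)

theorem vecMulVec_left_injective {v : q → E} (hv : v ≠ 0) :
    Function.Injective fun u : p → E => u ⊠ v := fun u u' h => by
  obtain ⟨j, hj⟩ := Function.ne_iff.1 hv
  exact funext fun i => mul_right_cancel₀ hj (congrFun (congrFun h i) j)

theorem exists_conj_of_vecMulVec_smul_eq {τ τ' : D →+* E} {u u' : p → E} {v v' : q → E}
    (hu : u ≠ 0) (hv : v ≠ 0) (h : ∀ d, u ⊠ (τ d • v) = u' ⊠ (τ' d • v')) :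
    ∃ c, c ≠ 0 ∧ u' = op c • u ∧ v = c • v' ∧ ∀ d, c * τ' d = τ d * c := by
  have h₁ : u ⊠ v = u' ⊠ v' := by simpa only [_root_.map_one, one_smul] using h 1
  obtain ⟨c, hc, rfl⟩ := (colParallel_and_rowParallel_of_vecMulVec_eq hu hv h₁).1
  rw [← op_unop c, smul_op_vecMulVec] at h₁
  obtain rfl : v = unop c • v' := vecMulVec_right_injective hu h₁
  refine ⟨unop c, (unop_ne_zero_iff c).2 hc, rfl, rfl, fun d => ?_⟩
  have hd := h d
  rw [← op_unop c, smul_op_vecMulVec, smul_smul, smul_smul] at hd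
  exact (smul_left_injective E (right_ne_zero_of_smul hv) (vecMulVec_right_injective hu hd)).symm

theorem single_eq_vecMulVec [DecidableEq m] [DecidableEq n] (i : m) (j : n) (d : D) :
    Matrix.single i j d = Pi.single i 1 ⊠ (d • Pi.single j 1) := by
  ext
  simp [Matrix.single_apply, vecMulVec_apply, Pi.single_apply, ← ite_and, eq_comm, and_comm]

theorem induction_add_vecMulVec [Finite m] {motive : Matrix m n D → Prop} (zero : motive 0)
    (add_vecMulVec : ∀ A x y, motive A → motive (A + x ⊠ y)) (A : Matrix m n D) : motive A := by
  classical
  cases nonempty_fintype m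
  have hA : A = ∑ i, Pi.single i 1 ⊠ A i := by
    ext i j
    simp [Matrix.sum_apply, vecMulVec_apply, Pi.single_apply]
  rw [hA]
  induction (Finset.univ : Finset m) using Finset.induction_on with
  | empty => simpa
  | insert i s hi ih =>
    rw [Finset.sum_insert hi, add_comm]
    exact add_vecMulVec _ _ _ ih

namespace RegularAtZero

variable {φ : Matrix m n D → Matrix p q E} {h : (m → D) → p → E} {g : (n → D) → q → E}

theorem ne_zero_of_map_vecMulVec_eq (H : RegularAtZero φ h g) {x : m → D} {y : n → D}
    (hx : x ≠ 0) (hy : y ≠ 0) {τ : D →+* E} {u : p → E} {v : q → E}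
    (huv : ∀ d, φ (x ⊠ (d • y)) = u ⊠ (τ d • v)) : u ≠ 0 ∧ v ≠ 0 := by
  have huv₁ := huv 1
  rw [one_smul, _root_.map_one, one_smul] at huv₁
  exact vecMulVec_ne_zero_iff.1 (huv₁ ▸ H.map_vecMulVec_ne_zero hx hy)

theorem linearIndependent_of_eq_mul_map_mul [Fintype m] [Fintype n] (H : RegularAtZero φ h g)
    {τ : D →+* E} (hτ : Function.Surjective τ) {U : Matrix p m E} {V : Matrix n q E}
    (hφ : ∀ X : Matrix m n D, φ X = U * X.map τ * V) :
    LinearIndependent Eᵐᵒᵖ U.col ∧ LinearIndependent E V.row := by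
  have hUV (x : m → E) (y : n → E) (hx : x ≠ 0) (hy : y ≠ 0) : U *ᵥ x ≠ 0 ∧ y ᵥ* V ≠ 0 := by
    obtain ⟨x, rfl⟩ := hτ.comp_left x
    obtain ⟨y, rfl⟩ := hτ.comp_left y
    rw [← vecMulVec_ne_zero_iff, ← mul_vecMulVec_mul, ← map_ringHom_vecMulVec, ← hφ]
    refine H.map_vecMulVec_ne_zero ?_ ?_
    · rintro rfl; exact hx (funext fun _ => map_zero τ)
    · rintro rfl; exact hy (funext fun _ => map_zero τ)
  obtain ⟨x₁, -, hx₁, -⟩ := H.exists_cols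
  obtain ⟨y₁, -, hy₁, -⟩ := H.exists_rows
  have : Nonempty m := (Function.ne_iff.1 hx₁).nonempty
  have : Nonempty n := (Function.ne_iff.1 hy₁).nonempty
  obtain ⟨x, hx⟩ := exists_ne (0 : m → E)
  obtain ⟨y, hy⟩ := exists_ne (0 : n → E)
  exact ⟨linearIndependent_col_iff.2 fun x hx => (hUV x y hx hy).1,
    linearIndependent_row_iff.2 fun y hy => (hUV x y hx hy).2⟩

variable [Finite p] [Finite q]

theorem exists_block (H : RegularAtZero φ h g) (hφ : AdjacencyPreserving φ) (h0 : φ 0 = 0)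
    (hDE : OntoHoms D E) {x : Fin 2 → m → D} {y : Fin 2 → n → D} (hx : x 0 ≠ 0) (hy : y 0 ≠ 0) :
    ∃ (τ : D →+* E) (U : Matrix p (Fin 2) E) (V : Matrix (Fin 2) q E) (P : Matrix m (Fin 2) D)
      (Q : Matrix (Fin 2) n D), (∀ i, ∃ s, P *ᵥ s = x i) ∧ (∀ j, ∃ t, t ᵥ* Q = y j) ∧
      ∀ B : Matrix (Fin 2) (Fin 2) D, φ (P * B * Q) = U * B.map τ * V := by
  obtain ⟨z, hz, hyz⟩ := H.exists_not_rowParallel (y 0)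
  obtain ⟨w, hw, hxw⟩ := H.dual.exists_not_rowParallel (op ∘ x 0)
  obtain ⟨P, hP, hPx⟩ := exists_matrix_cols (z := unop ∘ w) hx (unop_comp_ne_zero_iff.2 hw)
    fun hp => hxw (H.dual.rowParallel_map (op_comp_ne_zero_iff.2 hx) (rowParallel_op_iff.2 hp))
  obtain ⟨Q, hQ, hQy⟩ := exists_matrix_rows hy hz (mt (H.rowParallel_map hy) hyz)
  obtain ⟨τ, U, V, hblock⟩ := H.exists_comp_eq_mul_map_mul_of_linearIndependent hφ h0 hDE hP hQ
  exact ⟨τ, U, V, P, Q, hPx, hQy, hblock⟩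

theorem map_add_vecMulVec (H : RegularAtZero φ h g) (hφ : AdjacencyPreserving φ) (h0 : φ 0 = 0)
    (hDE : OntoHoms D E) (x x' : m → D) (y y' : n → D) :
    φ (x ⊠ y + x' ⊠ y') = φ (x ⊠ y) + φ (x' ⊠ y') := by
  by_cases hxy : x ⊠ y = 0
  · rw [hxy, zero_add, h0, zero_add]
  obtain ⟨hx, hy⟩ := vecMulVec_ne_zero_iff.1 hxy
  obtain ⟨τ, U, V, P, Q, hP, hQ, hblock⟩ :=
    H.exists_block (x := ![x, x']) (y := ![y, y']) hφ h0 hDE hx hy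
  obtain ⟨⟨s, rfl⟩, s', rfl⟩ : (∃ s, P *ᵥ s = x) ∧ ∃ s', P *ᵥ s' = x' := ⟨hP 0, hP 1⟩
  obtain ⟨⟨t, rfl⟩, t', rfl⟩ : (∃ t, t ᵥ* Q = y) ∧ ∃ t', t' ᵥ* Q = y' := ⟨hQ 0, hQ 1⟩
  rw [← mul_vecMulVec_mul, ← mul_vecMulVec_mul, ← Matrix.add_mul, ← Matrix.mul_add, hblock,
    hblock, hblock, Matrix.map_add _ (map_add τ), Matrix.mul_add, Matrix.add_mul]

theorem shift_vecMulVec [Finite m] (H : RegularAtZero φ h g) (hφ : AdjacencyPreserving φ)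
    (h0 : φ 0 = 0) (hDE : OntoHoms D E) (A : Matrix m n D) (x : m → D) (y : n → D) :
    shift φ A (x ⊠ y) = φ (x ⊠ y) := by
  induction A using induction_add_vecMulVec generalizing x y with
  | zero => rw [shift_at_zero h0]
  | add_vecMulVec A x₀ y₀ hA =>
    have HA : RegularAtZero (shift φ A) h g :=
      ⟨H.col_ne_zero, H.row_ne_zero, fun x y hx hy => hA x y ▸ H.map_vecMulVec x y hx hy,
        H.exists_cols, H.exists_rows⟩
    rw [← shift_shift, shift, HA.map_add_vecMulVec (hφ.shift A) (shift_zero φ A) hDE,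
      add_sub_cancel_left, hA]

theorem map_add [Finite m] (H : RegularAtZero φ h g) (hφ : AdjacencyPreserving φ) (h0 : φ 0 = 0)
    (hDE : OntoHoms D E) (A B : Matrix m n D) : φ (A + B) = φ A + φ B := by
  have map_add_dyad (A : Matrix m n D) (x y) : φ (A + x ⊠ y) = φ A + φ (x ⊠ y) := by
    rw [← H.shift_vecMulVec hφ h0 hDE A, shift, add_sub_cancel]
  induction B using induction_add_vecMulVec with
  | zero => rw [h0, add_zero, add_zero]
  | add_vecMulVec B x y hB => rw [← add_assoc, map_add_dyad, hB, map_add_dyad, add_assoc]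

theorem exists_map_vecMulVec_eq (H : RegularAtZero φ h g) (hφ : AdjacencyPreserving φ)
    (h0 : φ 0 = 0) (hDE : OntoHoms D E) {x : Fin 2 → m → D} {y : Fin 2 → n → D} (hx : x 0 ≠ 0)
    (hy : y 0 ≠ 0) : ∃ (τ : D →+* E) (u : Fin 2 → p → E) (v : Fin 2 → q → E),
      ∀ i j d, φ (x i ⊠ (d • y j)) = u i ⊠ (τ d • v j) := by
  obtain ⟨τ, U, V, P, Q, hP, hQ, hblock⟩ := H.exists_block hφ h0 hDE hx hy
  choose s hs using hP
  choose t ht using hQ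
  refine ⟨τ, fun i => U *ᵥ (τ ∘ s i), fun j => (τ ∘ t j) ᵥ* V, fun i j d => ?_⟩
  have hτ : τ ∘ (d • t j) = τ d • (τ ∘ t j) := by
    ext; simp
  rw [← hs, ← ht, ← smul_vecMul, ← mul_vecMulVec_mul, hblock, map_ringHom_vecMulVec,
    mul_vecMulVec_mul, hτ, smul_vecMul]

/-- The representation on one block can be rescaled to agree with a given one at the first
column and the first row, which determine it up to a scalar. -/
theorem exists_map_vecMulVec_eq_of_eq (H : RegularAtZero φ h g) (hφ : AdjacencyPreserving φ)
    (h0 : φ 0 = 0) (hDE : OntoHoms D E) {x : Fin 2 → m → D} {y : Fin 2 → n → D} (hx : x 0 ≠ 0)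
    (hy : y 0 ≠ 0) {τ : D →+* E} {u₀ : p → E} {v₀ : q → E}
    (h₀ : ∀ d, φ (x 0 ⊠ (d • y 0)) = u₀ ⊠ (τ d • v₀)) :
    ∃ (u : Fin 2 → p → E) (v : Fin 2 → q → E), u 0 = u₀ ∧ v 0 = v₀ ∧
      ∀ i j d, φ (x i ⊠ (d • y j)) = u i ⊠ (τ d • v j) := by
  obtain ⟨τ', u, v, huv⟩ := H.exists_map_vecMulVec_eq hφ h0 hDE hx hy
  obtain ⟨hu₀, hv₀⟩ := H.ne_zero_of_map_vecMulVec_eq hx hy h₀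
  obtain ⟨c, hc, hcu, hcv, hcτ⟩ :=
    exists_conj_of_vecMulVec_smul_eq hu₀ hv₀ fun d => (h₀ d).symm.trans (huv 0 0 d)
  refine ⟨fun i => op c⁻¹ • u i, fun j => c • v j, ?_, hcv.symm, fun i j d => ?_⟩
  · change op c⁻¹ • u 0 = u₀
    rw [hcu, op_inv, inv_smul_smul₀ ((op_ne_zero_iff c).2 hc)]
  · rw [huv, smul_op_vecMulVec, smul_smul, smul_smul, mul_assoc, ← hcτ, inv_mul_cancel_left₀ hc]

theorem exists_map_vecMulVec_eq_forall (H : RegularAtZero φ h g) (hφ : AdjacencyPreserving φ)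
    (h0 : φ 0 = 0) (hDE : OntoHoms D E) :
    ∃ (τ : D →+* E) (u : (m → D) → p → E) (v : (n → D) → q → E),
      ∀ x y d, φ (x ⊠ (d • y)) = u x ⊠ (τ d • v y) := by
  obtain ⟨x₀, -, hx₀, -⟩ := H.exists_cols
  obtain ⟨y₀, -, hy₀, -⟩ := H.exists_rows
  obtain ⟨τ, u₀, v₀, h₀⟩ :=
    H.exists_map_vecMulVec_eq (x := fun _ => x₀) (y := fun _ => y₀) hφ h0 hDE hx₀ hy₀
  replace h₀ := h₀ 0 0
  obtain ⟨hu₀, hv₀⟩ := H.ne_zero_of_map_vecMulVec_eq hx₀ hy₀ h₀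
  have hblock (x y) := H.exists_map_vecMulVec_eq_of_eq (x := ![x₀, x]) (y := ![y₀, y]) hφ h0 hDE
    hx₀ hy₀ h₀
  choose u v hu hv huv using hblock
  refine ⟨τ, fun x => u x 0 1, fun y => v 0 y 1, fun x y d => ?_⟩
  have hux : u x y 1 = u x 0 1 := vecMulVec_left_injective hv₀ <| by
    have := (huv x y 1 0 1).symm.trans (huv x 0 1 0 1)
    simpa only [hv, _root_.map_one, one_smul] using this
  have hvy : v x y 1 = v 0 y 1 := vecMulVec_right_injective hu₀ <| by
    have := (huv x y 0 1 1).symm.trans (huv 0 y 0 1 1)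
    simpa only [hu, _root_.map_one, one_smul] using this
  change _ = u x 0 1 ⊠ (τ d • v 0 y 1)
  rw [← hux, ← hvy]
  exact huv x y 1 1 d

theorem exists_eq_mul_map_mul [Fintype m] [Fintype n] (H : RegularAtZero φ h g)
    (hφ : AdjacencyPreserving φ) (h0 : φ 0 = 0) (hDE : OntoHoms D E) :
    ∃ (τ : D →+* E) (U : Matrix p m E) (V : Matrix n q E),
      ∀ X : Matrix m n D, φ X = U * X.map τ * V := by
  classical
  obtain ⟨τ, u, v, huv⟩ := H.exists_map_vecMulVec_eq_forall hφ h0 hDE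
  refine ⟨τ, of fun k i => u (Pi.single i 1) k, of fun j => v (Pi.single j 1), fun X => ?_⟩
  induction X using Matrix.induction_on' with
  | h_zero => simp [h0]
  | h_add X Y hX hY =>
    rw [H.map_add hφ h0 hDE, hX, hY, Matrix.map_add _ (_root_.map_add τ), Matrix.mul_add,
      Matrix.add_mul]
  | h_std_basis i j d =>
    rw [single_eq_vecMulVec, huv, ← single_eq_vecMulVec, Matrix.map_single, single_eq_vecMulVec,
      mul_vecMulVec_mul, mulVec_single_one, smul_vecMul, single_one_vecMul]
    rfl

end RegularAtZero

/-! ### Standard embeddings -/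

/-- `φ X = U * X^τ * V + R` with `τ` an isomorphism and `U`, `V` having independent columns and
rows respectively, so that they complete to invertible matrices when the index types are finite.
The transposed form of a standard map is this form for `opTranspose ∘ φ`. -/
def IsStandardEmbedding [Fintype m] [Fintype n] (φ : Matrix m n D → Matrix p q E) : Prop :=
  ∃ (τ : D ≃+* E) (U : Matrix p m E) (V : Matrix n q E) (R : Matrix p q E),
    LinearIndependent Eᵐᵒᵖ U.col ∧ LinearIndependent E V.row ∧
      ∀ X : Matrix m n D, φ X = U * X.map τ * V + R

theorem IsStandardEmbedding.of_shift [Fintype m] [Fintype n] {φ : Matrix m n D → Matrix p q E}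
    {A : Matrix m n D} (h : IsStandardEmbedding (shift φ A)) : IsStandardEmbedding φ := by
  obtain ⟨τ, U, V, R, hU, hV, hshift⟩ := h
  refine ⟨τ, U, V, R + φ A - U * A.map τ * V, hU, hV, fun X => ?_⟩
  have hX : φ X = U * (X - A).map τ * V + R + φ A := by
    rw [← hshift, shift, add_sub_cancel, sub_add_cancel]
  rw [hX, Matrix.map_sub _ (map_sub τ), Matrix.mul_sub, Matrix.sub_mul]
  abel

theorem RegularAtZero.isStandardEmbedding [Fintype m] [Fintype n] [Finite p] [Finite q]
    {φ : Matrix m n D → Matrix p q E} {h : (m → D) → p → E} {g : (n → D) → q → E}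
    (H : RegularAtZero φ h g) (hφ : AdjacencyPreserving φ) (h0 : φ 0 = 0)
    (hDE : OntoHoms D E) : IsStandardEmbedding φ := by
  obtain ⟨τ, U, V, hUV⟩ := H.exists_eq_mul_map_mul hφ h0 hDE
  obtain ⟨hU, hV⟩ := H.linearIndependent_of_eq_mul_map_mul (hDE.surjective τ) hUV
  refine ⟨.ofBijective τ ⟨τ.injective, hDE.surjective τ⟩, U, V, 0, hU, hV, fun X => ?_⟩
  rw [add_zero]
  exact hUV X

/-! ### Rank, degenerate and standard maps -/

theorem IsEAS.ontoHoms (hD : IsEAS D) : OntoHoms D D := ⟨hD, id⟩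

theorem IsEAS.ontoHoms_op (hD : IsEAS D) : OntoHoms D Dᵐᵒᵖ where
  surjective f e := by
    obtain ⟨d, hd⟩ := hD ((RingEquiv.opOp D).symm.toRingHom.comp ((RingHom.op f).comp f)) (unop e)
    exact ⟨unop (f d), unop_injective hd⟩
  binary h e := (h (unop e)).imp (congrArg MulOpposite.op) (congrArg MulOpposite.op)

theorem span_range_row_vecMulVec {x : p → E} (hx : x ≠ 0) (y : q → E) :
    Submodule.span E (Set.range (x ⊠ y).row) = E ∙ y := by
  refine le_antisymm (Submodule.span_le.2 ?_) ((Submodule.span_singleton_le_iff_mem _ _).2 ?_)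
  · rintro _ ⟨i, rfl⟩
    exact Submodule.mem_span_singleton.2 ⟨x i, rfl⟩
  · obtain ⟨i, hi⟩ := Function.ne_iff.1 hx
    exact (Submodule.smul_mem_iff _ hi).1 (Submodule.subset_span ⟨i, rfl⟩)

theorem exists_eq_vecMulVec_of_range_row_subset {M : Matrix p q E} {y : q → E}
    (h : Set.range M.row ⊆ E ∙ y) : ∃ x, M = x ⊠ y := by
  choose x hx using fun i => Submodule.mem_span_singleton.1 (h ⟨i, rfl⟩)
  exact ⟨x, funext fun i => (hx i).symm⟩

section FinIndexed

variable {m n p q : ℕ}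

theorem rowRank_eq_zero_iff {M : Matrix (Fin m) (Fin n) D} : rowRank M = 0 ↔ M = 0 := by
  rw [rowRank, Submodule.finrank_eq_zero, Submodule.span_eq_bot, Set.forall_mem_range]
  exact funext_iff.symm

theorem rowRank_eq_one_iff {M : Matrix (Fin m) (Fin n) D} : rowRank M = 1 ↔ IsRankOne M := by
  constructor
  · intro h
    have hM : M ≠ 0 := by simp [← rowRank_eq_zero_iff, h]
    obtain ⟨y, hy⟩ := (Submodule.finrank_le_one_iff_isPrincipal _).1 h.le
    obtain ⟨x, rfl⟩ := exists_eq_vecMulVec_of_range_row_subset (hy ▸ Submodule.subset_span)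
    exact isRankOne_vecMulVec_of_ne_zero hM
  · rintro ⟨x, y, hx, hy, rfl⟩
    rw [rowRank, span_range_row_vecMulVec hx, finrank_span_singleton hy]

theorem PreservesAdjacency.adjacencyPreserving
    {φ : Matrix (Fin m) (Fin n) D → Matrix (Fin p) (Fin q) D} (hφ : PreservesAdjacency φ) :
    AdjacencyPreserving φ :=
  fun A B h => rowRank_eq_one_iff.1 (hφ A B (rowRank_eq_one_iff.2 h))

theorem DegenerateAtZero.isDegenerateAt {φ : Matrix (Fin m) (Fin n) D → Matrix (Fin p) (Fin q) D}
    {A : Matrix (Fin m) (Fin n) D} (h : DegenerateAtZero (shift φ A)) : IsDegenerateAt φ A := by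
  obtain ⟨a, b, ha, hb, h⟩ := h
  refine ⟨a, b, ha, hb, ?_⟩
  rintro _ ⟨B, hB, rfl⟩
  have hφB : φ B = φ A + shift φ A (B - A) := by simp [shift]
  rw [hφB]
  rcases Nat.le_one_iff_eq_zero_or_eq_one.1 hB with h0 | h1
  · obtain rfl : A = B := sub_eq_zero.1 (rowRank_eq_zero_iff.1 h0)
    exact .inl ⟨0, ⟨0, zero_vecMulVec b⟩, by simp⟩
  · obtain ⟨x, y, hx, hy, hxy⟩ := rowRank_eq_one_iff.1 h1
    rw [← neg_sub, hxy, ← neg_vecMulVec]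
    rcases h (-x) y (neg_ne_zero.2 hx) hy with ⟨r, hr⟩ | ⟨r, hr⟩
    · exact .inr ⟨_, ⟨r, hr.symm⟩, rfl⟩
    · exact .inl ⟨_, ⟨r, hr.symm⟩, rfl⟩

theorem exists_linearIndependent_castLE {R V : Type*} [DivisionRing R] [AddCommGroup V]
    [Module R V] [Module.Finite R V] {d : ℕ} (hd : Module.finrank R V = d) {v : Fin n → V}
    (hv : LinearIndependent R v) :
    ∃ (h : n ≤ d) (w : Fin d → V), LinearIndependent R w ∧ ∀ i, w (Fin.castLE h i) = v i := by
  let b := Module.Basis.sumExtend hv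
  have hb (i : Fin n) : b (.inl i) = v i := by
    simp only [b, Module.Basis.sumExtend, Module.Basis.reindex_apply, Module.Basis.coe_extend]
    rfl
  have : Finite (Fin n ⊕ Module.Basis.sumExtendIndex hv) := Module.Finite.finite_basis b
  have : Finite (Module.Basis.sumExtendIndex hv) := Finite.sum_right (Fin n)
  obtain ⟨k, ⟨e⟩⟩ := Finite.exists_equiv_fin (Module.Basis.sumExtendIndex hv)
  let b' := b.reindex (((Equiv.refl (Fin n)).sumCongr e).trans finSumFinEquiv)
  obtain rfl : d = n + k := by
    simpa [hd] using Module.finrank_eq_card_basis b'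
  refine ⟨Nat.le_add_right n k, b', b'.linearIndependent, fun i => ?_⟩
  have hi : finSumFinEquiv.symm (Fin.castLE (Nat.le_add_right n k) i) = Sum.inl i := by
    rw [Equiv.symm_apply_eq]
    rfl
  rw [Module.Basis.reindex_apply, Equiv.symm_trans_apply, hi, ← hb]
  rfl

theorem exists_isUnit_row_castLE {V : Matrix (Fin n) (Fin q) D} (hV : LinearIndependent D V.row) :
    ∃ (h : n ≤ q) (S : Matrix (Fin q) (Fin q) D), IsUnit S ∧ ∀ i, S (Fin.castLE h i) = V i := by
  obtain ⟨h, S, hS, hSV⟩ := exists_linearIndependent_castLE (Module.finrank_fin_fun D) hV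
  obtain ⟨N, hN⟩ := exists_mul_eq_one_of_linearIndependent (M := of S) hS
  exact ⟨h, of S, .of_mul_eq_one N hN, hSV⟩

theorem exists_isUnit_col_castLE {U : Matrix (Fin p) (Fin m) D}
    (hU : LinearIndependent Dᵐᵒᵖ U.col) :
    ∃ (h : m ≤ p) (T : Matrix (Fin p) (Fin p) D), IsUnit T ∧
      ∀ k i, T k (Fin.castLE h i) = U k i := by
  obtain ⟨h, T, hT, hTU⟩ := exists_linearIndependent_castLE (Module.finrank_fin_fun Dᵐᵒᵖ)
    (linearIndependent_row_opTranspose_iff.2 hU)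
  obtain ⟨N, hN⟩ := exists_mul_eq_one_of_linearIndependent_col (M := opTranspose.symm (of T))
    (linearIndependent_row_opTranspose_iff.1 hT)
  exact ⟨h, opTranspose.symm (of T), .of_mul_eq_one_right N hN,
    fun k i => congrArg unop (congrFun (hTU i) k)⟩

theorem corner_eq_mul_mul (hm : m ≤ p) (hn : n ≤ q) (B : Matrix (Fin m) (Fin n) D) :
    corner p q B = (1 : Matrix (Fin p) (Fin p) D).submatrix id (Fin.castLE hm) * B *
      (1 : Matrix (Fin q) (Fin q) D).submatrix (Fin.castLE hn) id := by
  ext a b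
  by_cases hb : (b : ℕ) < n
  · obtain ⟨j, rfl⟩ : ∃ j, b = Fin.castLE hn j := ⟨⟨b, hb⟩, rfl⟩
    by_cases ha : (a : ℕ) < m
    · obtain ⟨i, rfl⟩ : ∃ i, a = Fin.castLE hm i := ⟨⟨a, ha⟩, rfl⟩
      simp [corner, mul_apply, one_apply]
    · have ha' : ∀ i, a ≠ Fin.castLE hm i := by rintro i rfl; exact ha i.2
      simp [corner, mul_apply, one_apply, ha, ha']
  · have hb' : ∀ j, Fin.castLE hn j ≠ b := by rintro j rfl; exact hb j.2
    simp [corner, mul_apply, one_apply, hb, hb']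

theorem mul_corner_mul {U : Matrix (Fin p) (Fin m) D} {V : Matrix (Fin n) (Fin q) D}
    {T : Matrix (Fin p) (Fin p) D} {S : Matrix (Fin q) (Fin q) D} (hm : m ≤ p) (hn : n ≤ q)
    (hT : ∀ k i, T k (Fin.castLE hm i) = U k i) (hS : ∀ i, S (Fin.castLE hn i) = V i)
    (B : Matrix (Fin m) (Fin n) D) : T * corner p q B * S = U * B * V := by
  have hU : T * (1 : Matrix (Fin p) (Fin p) D).submatrix id (Fin.castLE hm) = U := by
    ext k i
    simp [mul_apply, one_apply, hT]
  have hV : (1 : Matrix (Fin q) (Fin q) D).submatrix (Fin.castLE hn) id * S = V := by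
    ext j l
    simp [mul_apply, one_apply, hS]
  rw [corner_eq_mul_mul hm hn, ← hU, ← hV]
  simp only [Matrix.mul_assoc]

theorem IsStandardEmbedding.isStandardAut
    {φ : Matrix (Fin m) (Fin n) D → Matrix (Fin p) (Fin q) D} (h : IsStandardEmbedding φ) :
    IsStandardAut φ := by
  obtain ⟨τ, U, V, R, hU, hV, hφ⟩ := h
  obtain ⟨hm, T, hT, hTU⟩ := exists_isUnit_col_castLE hU
  obtain ⟨hn, S, hS, hSV⟩ := exists_isUnit_row_castLE hV
  refine ⟨hm, hn, τ, T, S, R, hT, hS, fun X => ?_⟩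
  rw [mul_corner_mul hm hn hTU hSV]
  exact hφ X

theorem linearIndependent_row_of_col_opTranspose {V : Matrix (Fin n) (Fin q) D}
    (hV : LinearIndependent Dᵐᵒᵖᵐᵒᵖ (opTranspose V).col) : LinearIndependent D V.row := by
  rw [linearIndependent_col_iff] at hV
  refine linearIndependent_row_iff.2 fun y hy h0 => hV (op ∘ y) (op_comp_ne_zero_iff.2 hy) ?_
  ext i
  have := congrArg op (congrFun h0 i)
  simpa [vecMul, mulVec, dotProduct] using this

theorem IsStandardEmbedding.isStandardAnti
    {φ : Matrix (Fin m) (Fin n) D → Matrix (Fin p) (Fin q) D}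
    (h : IsStandardEmbedding fun X => opTranspose (φ X)) : IsStandardAnti φ := by
  obtain ⟨σ, U, V, R, hU, hV, hφ⟩ := h
  obtain ⟨U, rfl⟩ := opTranspose.surjective U
  obtain ⟨V, rfl⟩ := opTranspose.surjective V
  obtain ⟨R, rfl⟩ := opTranspose.surjective R
  obtain ⟨hn, T, hT, hTV⟩ := exists_isUnit_col_castLE (linearIndependent_row_opTranspose_iff.1 hV)
  obtain ⟨hm, S, hS, hSU⟩ := exists_isUnit_row_castLE (linearIndependent_row_of_col_opTranspose hU)
  refine ⟨hn, hm, σ, T, S, R, hT, hS, fun X => opTranspose.injective ?_⟩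
  rw [mul_corner_mul hn hm hTV hSU, _root_.map_add, opTranspose_mul, opTranspose_mul,
    ← Matrix.mul_assoc]
  exact hφ X

end FinIndexed

end HuaGeometry

end

open HuaGeometry in
theorem theorem1p2_general {D E : Type*} [DivisionRing D] [DivisionRing E] {m n p q : Type*}
    [Fintype m] [Fintype n] [Finite p] [Finite q] [Nonempty p] [Nonempty q]
    (hDE : OntoHoms D E) (hDE' : OntoHoms D Eᵐᵒᵖ) {φ : Matrix m n D → Matrix p q E}
    (hφ : AdjacencyPreserving φ) :
    (∀ A, DegenerateAtZero (shift φ A)) ∨ IsStandardEmbedding φ ∨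
      IsStandardEmbedding fun X => opTranspose (φ X) := by
  refine or_iff_not_imp_left.2 fun hdeg => ?_
  obtain ⟨A, hA⟩ := not_forall.1 hdeg
  have hshift : AdjacencyPreserving (shift φ A) := hφ.shift A
  rcases degenerate_or_regular_or_transposed hshift (shift_zero φ A) with
    hdegA | ⟨h, g, H⟩ | ⟨h, g, H⟩
  · exact absurd hdegA hA
  · exact .inl (H.isStandardEmbedding hshift (shift_zero φ A) hDE).of_shift
  · have hshift' : AdjacencyPreserving fun X => opTranspose (shift φ A X) :=
      fun X Y hXY => (hshift X Y hXY).opTranspose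
    exact .inr (.of_shift (φ := fun X => opTranspose (φ X)) (A := A)
      (H.isStandardEmbedding hshift' (by simp) hDE'))

theorem theorem1p2 {D : Type*} [DivisionRing D] (hD : HuaGeometry.IsEAS D)
    (m n p q : ℕ) (hm : 0 < m) (hn : 0 < n) (hp : 0 < p) (hq : 0 < q)
    (φ : Matrix (Fin m) (Fin n) D → Matrix (Fin p) (Fin q) D)
    (hφ : HuaGeometry.PreservesAdjacency φ) :
    HuaGeometry.IsDegenerate φ ∨ HuaGeometry.IsStandard φ := by
  have : Nonempty (Fin p) := Fin.pos_iff_nonempty.1 hp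
  have : Nonempty (Fin q) := Fin.pos_iff_nonempty.1 hq
  exact (theorem1p2_general hD.ontoHoms hD.ontoHoms_op hφ.adjacencyPreserving).imp
    (fun h A => (h A).isDegenerateAt) (.imp (·.isStandardAut) (·.isStandardAnti))
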